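/- Let $r\ge 1$, $\mathbf a=(a_1,\dots,a_r),\mathbf b=(b_1,\dots,b_r)\in\mathbb Z_{\ge 0}^r$ and $\sigma\in\mathfrak S_r$ be such that $a_1,a_{\sigma^{-1}(1)}\ge 1$, $b_1,b_{\sigma^{-1}(1)}\ge 1$ and $a_{\sigma(j)}+b_j\ge 1$ for all $j$. For $\mathbf u,\mathbf z\in\mathbb C^r$ with $|z_j|<1$ put \[ \mathrm{Li}_{\mathbf u}(\mathbf z;\mathbf b)=\sum_{l_1\ge b_1,\dots,l_r\ge b_r}\frac{z_1^{l_1}\cdots z_r^{l_r}}{l_1^{u_1}(l_1+l_2)^{u_2}\cdots(l_1+\cdots+l_r)^{u_r}} , \] and write $\mathrm{Li}_{\mathbf u}(\mathbf z;\mathbf b)$ also for its analytic continuation to $(\mathbf u,\mathbf z)\in\mathbb C^r\times(\mathbb C\setminus\mathbb R_{\ge 1})^r$. For $\mathbf t=(t_1,\dots,t_r)$ put $T_j=t_j+t_{j+1}+\cdots+t_r$. For $\mathbf k\in\mathbb Z^r$ define the numbers $B_{\mathbf m}^{(\mathbf k)}(\sigma;\mathbf a;\mathbf b)$, $\mathbf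 m\in\mathbb Z_{\ge 0}^r$, by the expansion near $\mathbf t=0$ \[ \prod_{j=1}^r e^{(a_j-1)T_j}\;\frac{\mathrm{Li}_{\mathbf k}(1-e^{-T_{\sigma(1)}},\dots,1-e^{-T_{\sigma(r)}};\mathbf b)}{\prod_{j=1}^r(1-e^{-T_{\sigma(j)}})^{b_j}}=\sum_{m_1,\dots,m_r=0}^{\infty}B_{\mathbf m}^{(\mathbf k)}(\sigma;\mathbf a;\mathbf b)\frac{t_1^{m_1}}{m_1!}\cdots\frac{t_r^{m_r}}{m_r!}. \] For $\mathbf u,\mathbf s\in\mathbb C^r$ with $\mathrm{Re}(u_j),\mathrm{Re}(s_j)>0$ define, by an absolutely convergent integral, \[ \eta(\mathbf u;\mathbf s;\sigma;\mathbf a;\mathbf b)=\prod_{j=1}^r\frac1{\Gamma(s_j)}\int_{(0,\infty)^r}\prod_{j=1}^r t_j^{s_j-1}e^{(1-a_j)T_j}\;\frac{\mathrm{Li}_{\mathbf u}(1-e^{T_{\sigma(1)}},\dots,1-e^{T_{\sigma(r)}};\mathbf b)}{\prod_{j=1}^r(1-e^{T_{\sigma(j)}})^{b_j}}\,dt_1\cdots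 dt_r . \] Then the continuation of $\mathrm{Li}$ exists, the numbers $B_{\mathbf m}^{(\mathbf k)}(\sigma;\mathbf a;\mathbf b)$ are well defined, the integral converges absolutely and $\eta(\mathbf u;\mathbf s;\sigma;\mathbf a;\mathbf b)$ extends uniquely to a holomorphic function of $(\mathbf u,\mathbf s)\in\mathbb C^{2r}$, and for all $\mathbf k\in\mathbb Z^r$ and $\mathbf n\in\mathbb Z_{\ge 0}^r$ the extended function satisfies \[ \eta(\mathbf k;-\mathbf n;\sigma;\mathbf a;\mathbf b)=B_{\mathbf n}^{(\mathbf k)}(\sigma;\mathbf a;\mathbf b). \] -/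

import Mathlib

open scoped Topology

noncomputable section

/-- The tail sum `t_j + t_{j+1} + ⋯ + t_r`. -/
def tailSum {r : ℕ} {R : Type*} [AddCommMonoid R] (t : Fin r → R) (j : Fin r) : R :=
  ∑ i ∈ Finset.Ici j, t i

/-- The series `∑_{l_j ≥ a_j} z_1^{l_1} ⋯ z_r^{l_r} / (l_1^{u_1} ⋯ (l_1 + ⋯ + l_r)^{u_r})`, indexed by
`l = a + m` with `m ∈ ℕ^r`. -/
def polylogSeries {r : ℕ} (a : Fin r → ℕ) (u z : Fin r → ℂ) : ℂ :=
  ∑' m : Fin r → ℕ,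
    (∏ j, z j ^ (a j + m j)) / ∏ j, ((∑ i ∈ Finset.Iic j, (a i + m i) : ℕ) : ℂ) ^ u j

/-- The region `ℂ^r × (ℂ ∖ ℝ_{≥ 1})^r`; note that `1 - z ∈ Complex.slitPlane` says that `z` is not
a real number `≥ 1`. -/
def polylogDomain (r : ℕ) : Set ((Fin r → ℂ) × (Fin r → ℂ)) :=
  {p | ∀ j, 1 - p.2 j ∈ Complex.slitPlane}

/-- `L` is an analytic continuation of the polylogarithm series, from `|z_j| < 1` to
`ℂ^r × (ℂ ∖ ℝ_{≥ 1})^r`. -/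
structure IsPolylogContinuation {r : ℕ} (a : Fin r → ℕ)
    (L : (Fin r → ℂ) → (Fin r → ℂ) → ℂ) : Prop where
  holomorphic : DifferentiableOn ℂ (fun p : (Fin r → ℂ) × (Fin r → ℂ) => L p.1 p.2)
    (polylogDomain r)
  eq_series : ∀ u z : Fin r → ℂ, (∀ j, ‖z j‖ < 1) → L u z = polylogSeries a u z

/-- The continuation is unique on its region. -/
theorem IsPolylogContinuation.unique {r : ℕ} {a : Fin r → ℕ}
    {L L' : (Fin r → ℂ) → (Fin r → ℂ) → ℂ}
    (h : IsPolylogContinuation a L) (h' : IsPolylogContinuation a L')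
    {p : (Fin r → ℂ) × (Fin r → ℂ)} (hp : p ∈ polylogDomain r) : L p.1 p.2 = L' p.1 p.2 := by
  obtain ⟨u, z⟩ := p
  have hlin : Differentiable ℂ (fun c : ℂ => ((u, c • z) : (Fin r → ℂ) × (Fin r → ℂ))) :=
    (differentiable_const u).prodMk (differentiable_id.smul_const z)
  let V : Set ℂ := (fun c : ℂ => ((u, c • z) : (Fin r → ℂ) × (Fin r → ℂ))) ⁻¹' polylogDomain r
  have hVeq : V = ⋂ j, (fun c : ℂ => 1 - c * z j) ⁻¹' Complex.slitPlane := by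
    ext c; simp [V, polylogDomain]
  have hVo : IsOpen V := by
    rw [hVeq]
    exact isOpen_iInter_of_finite fun j => Complex.isOpen_slitPlane.preimage (by fun_prop)
  have h0 : (0 : ℂ) ∈ V := by rw [hVeq]; simp
  have h1 : (1 : ℂ) ∈ V := by simpa [V] using hp
  have hVs : StarConvex ℝ 0 V := by
    rw [hVeq]
    refine starConvex_iInter fun j => ?_
    intro c hc s t hs ht hst
    have hstar := Complex.starConvex_one_slitPlane hc hs ht hst
    have hst' : (s : ℂ) + t = 1 := by exact_mod_cast congrArg (fun x : ℝ => (x : ℂ)) hst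
    have e : s • (1 : ℂ) + t • (1 - c * z j) = 1 - (s • (0 : ℂ) + t • c) * z j := by
      simp only [Complex.real_smul]
      linear_combination hst'
    simp only [Set.mem_preimage]
    rw [← e]
    exact hstar
  have hVc : IsPreconnected V := (hVs.isPathConnected h0).isConnected.isPreconnected
  have hd : ∀ {M : (Fin r → ℂ) → (Fin r → ℂ) → ℂ}, IsPolylogContinuation a M →
      AnalyticOnNhd ℂ (fun c : ℂ => M u (c • z)) V := fun {M} hM =>
    (hM.holomorphic.comp (f := fun c : ℂ => ((u, c • z) : (Fin r → ℂ) × (Fin r → ℂ)))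
      hlin.differentiableOn (fun _ hc => hc)).analyticOnNhd hVo
  have hev : (fun c : ℂ => L u (c • z)) =ᶠ[𝓝 0] fun c : ℂ => L' u (c • z) := by
    have : ∀ᶠ c : ℂ in 𝓝 0, ∀ j, ‖(c • z) j‖ < 1 := by
      refine Filter.eventually_all.2 fun j => ?_
      have hc : ContinuousAt (fun c : ℂ => ‖(c • z) j‖) 0 := by
        simp only [Pi.smul_apply, smul_eq_mul]; fun_prop
      exact hc.eventually_lt continuousAt_const (by simp)
    filter_upwards [this] with c hc
    rw [h.eq_series _ _ hc, h'.eq_series _ _ hc]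
  simpa using (hd h).eqOn_of_preconnected_of_eventuallyEq (hd h') hVc h0 hev h1

/-- The polylogarithm `Li_u(z; a)`, continued to `ℂ^r × (ℂ ∖ ℝ_{≥ 1})^r`. -/
def polylog {r : ℕ} (a : Fin r → ℕ) : (Fin r → ℂ) → (Fin r → ℂ) → ℂ :=
  Classical.epsilon (IsPolylogContinuation a)

/-- The generating function
`∏ e^{(a_j - 1)(t_j + ⋯ + t_r)} Li_k(z; b) / (z_1^{b_1} ⋯ z_r^{b_r})` with
`z_j = 1 - e^{-(t_{σ(j)} + t_{σ(j)+1} + ⋯ + t_r)}`. -/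
def bernoulliGenFun {r : ℕ} (k : Fin r → ℤ) (σ : Equiv.Perm (Fin r)) (a b : Fin r → ℕ)
    (t : Fin r → ℂ) : ℂ :=
  (∏ j, Complex.exp (((a j : ℂ) - 1) * tailSum t j)) *
    (polylogSeries b (fun j => (k j : ℂ)) (fun j => 1 - Complex.exp (-tailSum t (σ j))) /
      ∏ j, (1 - Complex.exp (-tailSum t (σ j))) ^ b j)

/-- The numbers `B m`, `m ∈ ℕ^r`, are the coefficients of the expansion of the generating function
as an exponential power series near `t = 0`. The quotient is a true quotient only where its
denominators do not vanish; this set is dense, which determines the coefficients. -/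
def IsMultiPolyBernoulli {r : ℕ} (k : Fin r → ℤ) (σ : Equiv.Perm (Fin r)) (a b : Fin r → ℕ)
    (B : (Fin r → ℕ) → ℂ) : Prop :=
  ∀ᶠ t : Fin r → ℂ in 𝓝 0, (∀ j, 1 - Complex.exp (-tailSum t (σ j)) ≠ 0) →
    HasSum (fun m : Fin r → ℕ => B m * ∏ j, t j ^ m j / ((m j).factorial : ℂ))
      (bernoulliGenFun k σ a b t)

/-- The generalized multi-indexed poly-Bernoulli numbers `B_n^{(k)}(σ; a; b)`. -/
def multiPolyBernoulli {r : ℕ} (k : Fin r → ℤ) (σ : Equiv.Perm (Fin r)) (a b : Fin r → ℕ) :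
    (Fin r → ℕ) → ℂ :=
  Classical.epsilon (IsMultiPolyBernoulli k σ a b)

/-- The integrand of `η(u; s; σ; a; b)`, at a point `t ∈ (0, ∞)^r`. -/
def etaIntegrand {r : ℕ} (σ : Equiv.Perm (Fin r)) (a b : Fin r → ℕ) (u s : Fin r → ℂ)
    (t : Fin r → ℝ) : ℂ :=
  (∏ j, (t j : ℂ) ^ (s j - 1) * Complex.exp ((1 - (a j : ℂ)) * (tailSum t j : ℝ))) *
    (polylog b u (fun j => 1 - Complex.exp (tailSum t (σ j) : ℝ)) /
      ∏ j, (1 - Complex.exp (tailSum t (σ j) : ℝ)) ^ b j)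

/-- The open orthant `(0, ∞)^r`. -/
def openOrthant (r : ℕ) : Set (Fin r → ℝ) := Set.univ.pi fun _ => Set.Ioi 0

/-- `E` is the continuation of `η(·; ·; σ; a; b)`: it is holomorphic on all of `ℂ^r × ℂ^r`, and for
`Re u_j > 0`, `Re s_j > 0` it is given by the (absolutely convergent) integral. -/
structure IsEtaContinuation {r : ℕ} (σ : Equiv.Perm (Fin r)) (a b : Fin r → ℕ)
    (E : (Fin r → ℂ) → (Fin r → ℂ) → ℂ) : Prop where
  holomorphic : Differentiable ℂ (fun p : (Fin r → ℂ) × (Fin r → ℂ) => E p.1 p.2)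
  integrable : ∀ u s : Fin r → ℂ, (∀ j, 0 < (u j).re) → (∀ j, 0 < (s j).re) →
    MeasureTheory.IntegrableOn (etaIntegrand σ a b u s) (openOrthant r)
  eq_integral : ∀ u s : Fin r → ℂ, (∀ j, 0 < (u j).re) → (∀ j, 0 < (s j).re) →
    E u s = (∏ j, 1 / Complex.Gamma (s j)) * ∫ t in openOrthant r, etaIntegrand σ a b u s t

/-- The function `η(u; s; σ; a; b)`, continued to all `(u, s) ∈ ℂ^r × ℂ^r`. -/
def eta {r : ℕ} (σ : Equiv.Perm (Fin r)) (a b : Fin r → ℕ) :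
    (Fin r → ℂ) → (Fin r → ℂ) → ℂ :=
  Classical.epsilon (IsEtaContinuation σ a b)

end

/-! # Analytic continuation of a multi-indexed `η` function and its values at non-positive integers -/

/-! Both the polylogarithm and `η` are Mellin transforms, and one device continues both. If `f` is
holomorphic near `[0, ∞)` and decays exponentially, split `1 / Γ(s) ∫₀^∞ t^(s-1) f(t) dt` at `R /
2`. The outer part is entire in `s`. On the inner part the Taylor series of `f` gives `∑ c_m (R /
2)^(s+m) / (Γ(s) (s + m))`, and writing `c_m` as a Cauchy integral over `|w| = R` turns this into an
integral of `f` over the circle against a density that is entire in `s`. The density is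
`mellinKernel`. At `s = -n` the half-line drops out, since `1 / Γ(-n) = 0`, and on the circle only
`m = n` survives, with weight `(-1)^n n!`. In several variables one integrates over a product of
such contours (`regMellin`); one-variable identities are transferred to it one variable at a time
(`IsDecaying.integral_congr`).

Polylogarithm: expanding `∏ q_j^(b_j) / (1 - z_j q_j)`, `q_j = exp (-(x_j + ⋯ + x_r))`, into
geometric series and using `∑ l_j (x_j + ⋯ + x_r) = ∑ (l_1 + ⋯ + l_j) x_j`, its regularised Mellin
transform in `x` is `Li_u(z; b) / ∏ z_j^(b_j)`. It is holomorphic as long as the poles `1 = z_j q_j`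
stay off the contours; on thin contours `q_j` runs through a thin sector around `[0, 1]`, and the
corresponding domains in `z` exhaust `(ℂ ∖ ℝ_{≥ 1})^r`.

The function `η`: for `z_j = 1 - exp T_{σ(j)}` the factors `exp ((1 - a_j) T_j)` combine with this
kernel into `∏ p^(a_{σ(j)}) q^(b_j) / (p + q - p q)`, where `p = exp (-T_{σ(j)})` and `q = q_j`.
Since `p + q - p q` dominates both `p` and `q` in the sector, the hypotheses on `a` and `b` bound
the product by a constant times the smaller of `exp (-Re T_1)` and `exp (-Re X_1)`, with `X_1 = x_1
+ ⋯ + x_r`, hence by their geometric mean. This leaves exponential decay in all `t_j` and all `x_j`.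
So the integrand of `η` without its powers of `t` (`etaKernel`) is again holomorphic and decaying,
and its regularised Mellin transform is the continuation of `η`.

Values: at `s = -n` that transform is `∏ (-1)^(n_j) n_j!` times a Taylor coefficient of `etaKernel`
at `0`. The poly-Bernoulli generating function is `etaKernel` at `-t`, so its exponential
coefficients are the same numbers. The identity theorem gives uniqueness throughout. -/

noncomputable section

open MeasureTheory Filter Set

/-! ### Holomorphic parameter integrals, product series and the identity theorem -/

section

/-- Cauchy's estimate for the Fréchet derivative. -/
theorem norm_fderiv_le_of_forall_mem_ball_norm_le {E : Type*} [NormedAddCommGroup E]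
    [NormedSpace ℂ E] {f : E → ℂ} {p₀ p : E} {ρ C : ℝ} (hρ : 0 < ρ) (hC : 0 ≤ C)
    (hf : DifferentiableOn ℂ f (Metric.ball p₀ (2 * ρ)))
    (hb : ∀ q ∈ Metric.ball p₀ (2 * ρ), ‖f q‖ ≤ C) (hp : p ∈ Metric.ball p₀ ρ) :
    ‖fderiv ℂ f p‖ ≤ C / ρ := by
  refine ContinuousLinearMap.opNorm_le_bound _ (by positivity) fun v => ?_
  rcases eq_or_ne v 0 with rfl | hv
  · simp
  have hv' : 0 < ‖v‖ := norm_pos_iff.2 hv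
  have hmem : ∀ c ∈ Metric.closedBall (0 : ℂ) (ρ / ‖v‖), p + c • v ∈ Metric.ball p₀ (2 * ρ) := by
    intro c hc
    rw [mem_closedBall_zero_iff, le_div_iff₀ hv'] at hc
    rw [Metric.mem_ball, dist_eq_norm] at hp ⊢
    calc ‖p + c • v - p₀‖ = ‖(p - p₀) + c • v‖ := by congr 1; abel
      _ ≤ ‖p - p₀‖ + ‖c • v‖ := norm_add_le _ _
      _ < 2 * ρ := by rw [norm_smul]; linarith
  have hline : Differentiable ℂ fun c : ℂ => p + c • v := by fun_prop
  have hd : DifferentiableOn ℂ (fun c : ℂ => f (p + c • v)) (Metric.closedBall 0 (ρ / ‖v‖)) :=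
    hf.comp hline.differentiableOn hmem
  have hder : HasDerivAt (fun c : ℂ => f (p + c • v)) (fderiv ℂ f p v) 0 := by
    have h1 : DifferentiableAt ℂ f (p + (0 : ℂ) • v) :=
      hf.differentiableAt (Metric.isOpen_ball.mem_nhds (hmem 0 (by simp; positivity)))
    rw [show fderiv ℂ f p = fderiv ℂ f (p + (0 : ℂ) • v) by simp]
    have h2 : HasDerivAt (fun c : ℂ => p + c • v) v 0 := by
      simpa using ((hasDerivAt_id (0 : ℂ)).smul_const v).const_add p
    exact h1.hasFDerivAt.comp_hasDerivAt (0 : ℂ) h2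
  have key := Complex.norm_deriv_le_of_forall_mem_sphere_norm_le (c := 0) (R := ρ / ‖v‖) (C := C)
    (by positivity) ((hd.mono Metric.closure_ball_subset_closedBall).diffContOnCl)
    fun z hz => hb _ (hmem z (Metric.sphere_subset_closedBall hz))
  rw [hder.deriv] at key
  calc ‖fderiv ℂ f p v‖ ≤ C / (ρ / ‖v‖) := key
    _ = C / ρ * ‖v‖ := by field_simp

/-- A locally dominated integral of functions that are holomorphic in a finite-dimensional
parameter is holomorphic. -/
theorem differentiableOn_integral_of_dominated {E : Type*} [NormedAddCommGroup E]
    [NormedSpace ℂ E] [FiniteDimensional ℂ E] {α : Type*} [MeasurableSpace α] {μ : Measure α}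
    {f : E → α → ℂ} {U : Set E} (hU : IsOpen U)
    (hm : ∀ p ∈ U, AEStronglyMeasurable (f p) μ)
    (hd : ∀ y, DifferentiableOn ℂ (fun p => f p y) U)
    (hb : ∀ p ∈ U, ∃ V ∈ 𝓝 p, ∃ g : α → ℝ, Integrable g μ ∧ ∀ q ∈ V, ∀ y, ‖f q y‖ ≤ g y) :
    DifferentiableOn ℂ (fun p => ∫ y, f p y ∂μ) U := by
  intro p₀ hp₀
  obtain ⟨V, hV, g, hg, hVg⟩ := hb p₀ hp₀
  obtain ⟨ρ', hρ', hball⟩ := Metric.mem_nhds_iff.1 (Filter.inter_mem hV (hU.mem_nhds hp₀))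
  obtain ⟨ρ, hρ, rfl⟩ : ∃ ρ, 0 < ρ ∧ ρ' = 2 * ρ := ⟨ρ' / 2, by positivity, by ring⟩
  have hsub : ∀ q ∈ Metric.ball p₀ ρ, q ∈ U := fun q hq =>
    (hball (Metric.ball_subset_ball (by linarith) hq)).2
  have hdiff : ∀ y, ∀ q ∈ Metric.ball p₀ ρ, HasFDerivAt (fun p => f p y)
      (fderiv ℂ (fun p => f p y) q) q := fun y q hq =>
    ((hd y).differentiableAt (hU.mem_nhds (hsub q hq))).hasFDerivAt
  -- Each directional derivative is a limit of difference quotients along `v / (n + 1)`, shifted by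
  -- `N` to stay in `U`; a basis then gives the full derivative.
  have hmeas : AEStronglyMeasurable (fun y => fderiv ℂ (fun p => f p y) p₀) μ := by
    let b := Module.finBasis ℂ E
    have hv : ∀ v : E, AEStronglyMeasurable (fun y => fderiv ℂ (fun p => f p y) p₀ v) μ := by
      intro v
      have hcont : Tendsto (fun n : ℕ => p₀ + ((n : ℂ) + 1)⁻¹ • v) atTop (𝓝 p₀) := by
        have : Tendsto (fun n : ℕ => ((n : ℂ) + 1)⁻¹) atTop (𝓝 0) := by
          simpa using tendsto_one_div_add_atTop_nhds_zero_nat (𝕜 := ℂ)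
        simpa using (this.smul_const v).const_add p₀
      obtain ⟨N, hN⟩ := eventually_atTop.1 (hcont.eventually (hU.mem_nhds hp₀))
      refine aestronglyMeasurable_of_tendsto_ae atTop
        (f := fun (n : ℕ) y => ((n + N : ℕ) + 1 : ℂ) •
          (f (p₀ + (((n + N : ℕ) : ℂ) + 1)⁻¹ • v) y - f p₀ y)) ?_ ?_
      · intro n
        exact ((hm _ (hN (n + N) (by omega))).sub (hm _ hp₀)).const_smul
          (((n + N : ℕ) : ℂ) + 1)
      · refine Eventually.of_forall fun y => ?_
        have h1 : HasDerivAt (fun c : ℂ => f (p₀ + c • v) y)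
            (fderiv ℂ (fun p => f p y) p₀ v) 0 := by
          have h2 : HasDerivAt (fun c : ℂ => p₀ + c • v) v 0 := by
            simpa using ((hasDerivAt_id (0 : ℂ)).smul_const v).const_add p₀
          have h3 := hdiff y p₀ (Metric.mem_ball_self hρ)
          have h4 : HasFDerivAt (fun p => f p y) (fderiv ℂ (fun p => f p y) p₀)
            (p₀ + (0 : ℂ) • v) := by simpa using h3
          exact h4.comp_hasDerivAt (0 : ℂ) h2
        have h5 := h1.tendsto_slope_zero
        have h6 : Tendsto (fun n : ℕ => (((n + N : ℕ) : ℂ) + 1)⁻¹) atTop (𝓝[≠] 0) := by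
          refine tendsto_nhdsWithin_iff.2 ⟨?_, Eventually.of_forall fun n => ?_⟩
          · have : Tendsto (fun n : ℕ => ((n : ℂ) + 1)⁻¹) atTop (𝓝 0) := by
              simpa using tendsto_one_div_add_atTop_nhds_zero_nat (𝕜 := ℂ)
            exact this.comp (tendsto_add_atTop_nat N)
          · exact inv_ne_zero (Nat.cast_add_one_ne_zero _)
        simpa [Function.comp_def] using h5.comp h6
    have hrep : (fun y => fderiv ℂ (fun p => f p y) p₀) = fun y =>
        ∑ i, (fderiv ℂ (fun p => f p y) p₀ (b i)) •
          (LinearMap.toContinuousLinearMap (b.coord i) : E →L[ℂ] ℂ) := by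
      funext y
      ext v
      conv_lhs => rw [← b.sum_repr v, map_sum]
      simp [mul_comm]
    rw [hrep]
    have : ∀ i, AEStronglyMeasurable (fun y => (fderiv ℂ (fun p => f p y) p₀ (b i)) •
          (LinearMap.toContinuousLinearMap (b.coord i) : E →L[ℂ] ℂ)) μ := fun i =>
      (hv (b i)).smul_const _
    exact Finset.aestronglyMeasurable_fun_sum _ fun i _ => this i
  refine (hasFDerivAt_integral_of_dominated_of_fderiv_le (s := Metric.ball p₀ ρ)
    (F' := fun q y => fderiv ℂ (fun p => f p y) q) (bound := fun y => g y / ρ)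
    (Metric.ball_mem_nhds p₀ hρ) ?_ ?_ hmeas ?_ (hg.div_const ρ)
    (Eventually.of_forall hdiff)).differentiableAt.differentiableWithinAt
  · filter_upwards [hU.mem_nhds hp₀] with q hq using hm q hq
  · exact hg.mono' (hm _ hp₀) (Eventually.of_forall fun y => hVg _ (mem_of_mem_nhds hV) y)
  · refine Eventually.of_forall fun y q hq => ?_
    exact norm_fderiv_le_of_forall_mem_ball_norm_le hρ
      ((norm_nonneg _).trans (hVg p₀ (mem_of_mem_nhds hV) y))
      ((hd y).mono fun q hq => (hball hq).2) (fun q hq => hVg q (hball hq).1 y) hq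

theorem summable_norm_mul_complex {ι κ : Type*} {a : ι → ℂ} {b : κ → ℂ}
    (ha : Summable fun m => ‖a m‖) (hb : Summable fun m => ‖b m‖) :
    Summable fun x : ι × κ => ‖a x.1 * b x.2‖ :=
  Summable.mul_norm ha hb

/-- A finite product of absolutely convergent series. -/
theorem hasSum_pi_prod {n : ℕ} {g : Fin n → ℕ → ℂ} (hg : ∀ j, Summable fun m => ‖g j m‖) :
    Summable (fun m : Fin n → ℕ => ‖∏ j, g j (m j)‖) ∧
      HasSum (fun m : Fin n → ℕ => ∏ j, g j (m j)) (∏ j, ∑' m, g j m) := by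
  induction n with
  | zero =>
    refine ⟨Summable.of_finite, ?_⟩
    simp
  | succ n ih =>
    obtain ⟨h1, h2⟩ := ih (g := fun j => g j.succ) fun j => hg _
    generalize hP : (fun m : Fin n → ℕ => ∏ j, g j.succ (m j)) = P at h2
    have hP' : ∀ m : Fin n → ℕ, ∏ j, g j.succ (m j) = P m := fun m => congrFun hP m
    simp only [hP'] at h1
    let e : ℕ × (Fin n → ℕ) ≃ (Fin (n + 1) → ℕ) := Fin.consEquiv (fun _ : Fin (n + 1) => ℕ)
    have he : ∀ x, ∏ j, g j (e x j) = g 0 x.1 * P x.2 := fun x => by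
      rw [← hP', Fin.prod_univ_succ]
      simp [e]
    have hs := summable_norm_mul_complex (hg 0) h1
    constructor
    · rw [← e.summable_iff]
      exact hs.congr fun x => by rw [Function.comp_apply, he]
    · rw [← e.hasSum_iff, Fin.prod_univ_succ]
      have h3 := HasSum.mul (hg 0).of_norm.hasSum h2 hs.of_norm
      rwa [show (fun m => ∏ j, g j (m j)) ∘ e = _ from funext he]

/-- Two functions that are holomorphic on an open star-shaped set and agree near its centre agree on
the whole set. -/
theorem eqOn_of_starConvex_of_eventuallyEq {E : Type*} [NormedAddCommGroup E] [NormedSpace ℂ E]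
    [NormedSpace ℝ E] [IsScalarTower ℝ ℂ E]
    {f g : E → ℂ} {U : Set E} {p₀ : E} (hU : IsOpen U) (hs : StarConvex ℝ p₀ U)
    (hf : DifferentiableOn ℂ f U) (hg : DifferentiableOn ℂ g U) (h : f =ᶠ[𝓝 p₀] g) :
    EqOn f g U := by
  intro p hp
  have hline : Differentiable ℂ fun c : ℂ => p₀ + c • (p - p₀) := by fun_prop
  let V : Set ℂ := (fun c : ℂ => p₀ + c • (p - p₀)) ⁻¹' U
  have hVo : IsOpen V := hU.preimage hline.continuous
  have hp₀ : p₀ ∈ U := hs.mem ⟨p, hp⟩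
  have h0 : (0 : ℂ) ∈ V := by simpa [V] using hp₀
  have h1 : (1 : ℂ) ∈ V := by simpa [V] using hp
  have hVs : StarConvex ℝ 0 V := by
    intro c hc x y hx hy hxy
    have := hs hc hx hy hxy
    have e : x • p₀ + y • (p₀ + c • (p - p₀)) = p₀ + (x • (0 : ℂ) + y • c) • (p - p₀) := by
      rw [smul_add, ← add_assoc, ← add_smul, hxy, one_smul, smul_zero, zero_add, smul_assoc]
    rw [e] at this
    exact this
  have hd : ∀ {k : E → ℂ}, DifferentiableOn ℂ k U →
      AnalyticOnNhd ℂ (fun c : ℂ => k (p₀ + c • (p - p₀))) V := fun {k} hk =>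
    (hk.comp hline.differentiableOn fun _ hc => hc).analyticOnNhd hVo
  have hev : (fun c : ℂ => f (p₀ + c • (p - p₀))) =ᶠ[𝓝 0]
      fun c : ℂ => g (p₀ + c • (p - p₀)) := by
    have : Tendsto (fun c : ℂ => p₀ + c • (p - p₀)) (𝓝 0) (𝓝 p₀) := by
      simpa using (hline.continuous.tendsto (0 : ℂ))
    exact this.eventually h
  simpa using (hd hf).eqOn_of_preconnected_of_eventuallyEq (hd hg)
    (hVs.isPathConnected h0).isConnected.isPreconnected h0 hev h1

end

/-! ### The contour and the entire Mellin density -/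

section

/-- The open neighbourhood of width `ρ` of the half-line `[0, ∞)` in `ℂ`. -/
def stadium (ρ : ℝ) : Set ℂ := {x | ∃ ξ : ℝ, 0 ≤ ξ ∧ ‖x - ξ‖ < ρ}

theorem isOpen_stadium (ρ : ℝ) : IsOpen (stadium ρ) := by
  have : stadium ρ = ⋃ ξ ∈ Ici (0 : ℝ), Metric.ball (ξ : ℂ) ρ := by
    ext x; simp [stadium, dist_eq_norm]
  rw [this]
  exact isOpen_biUnion fun ξ _ => Metric.isOpen_ball

theorem ofReal_mem_stadium {ρ y : ℝ} (hρ : 0 < ρ) (hy : 0 ≤ y) : (y : ℂ) ∈ stadium ρ :=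
  ⟨y, hy, by simpa using hρ⟩

theorem mem_stadium_of_norm_lt {ρ : ℝ} {x : ℂ} (hx : ‖x‖ < ρ) : x ∈ stadium ρ :=
  ⟨0, le_rfl, by simpa using hx⟩

theorem neg_lt_re_of_mem_stadium {ρ : ℝ} {x : ℂ} (hx : x ∈ stadium ρ) : -ρ < x.re := by
  obtain ⟨ξ, hξ, h⟩ := hx
  have := (Complex.abs_re_le_norm (x - ξ)).trans_lt h
  simp only [Complex.sub_re, Complex.ofReal_re] at this
  linarith [(abs_lt.1 this).1]

/-- The circle of radius `R`, parametrised by the negative reals, followed by the half-line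
`[0, ∞)`. -/
def contour (R y : ℝ) : ℂ := if y < 0 then circleMap 0 R (-y) else y

theorem contour_of_neg {R y : ℝ} (hy : y < 0) : contour R y = circleMap 0 R (-y) := if_pos hy

theorem contour_of_nonneg {R y : ℝ} (hy : 0 ≤ y) : contour R y = y := if_neg hy.not_gt

theorem measurable_contour (R : ℝ) : Measurable (contour R) :=
  Measurable.ite measurableSet_Iio ((continuous_circleMap 0 R).comp continuous_neg).measurable
    Complex.measurable_ofReal

theorem norm_contour_of_neg {R y : ℝ} (hR : 0 < R) (hy : y < 0) : ‖contour R y‖ = R := by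
  rw [contour_of_neg hy]; simp [abs_of_pos hR]

theorem contour_ne_zero_of_neg {R y : ℝ} (hR : 0 < R) (hy : y < 0) : contour R y ≠ 0 := by
  rw [← norm_pos_iff, norm_contour_of_neg hR hy]; exact hR

theorem contour_mem_stadium {R : ℝ} (hR : 0 < R) (y : ℝ) : contour R y ∈ stadium (2 * R) := by
  rcases lt_or_ge y 0 with hy | hy
  · exact mem_stadium_of_norm_lt (by rw [norm_contour_of_neg hR hy]; linarith)
  · rw [contour_of_nonneg hy]; exact ofReal_mem_stadium (by linarith) hy

/-- The entire function `s ↦ 1 / (Γ(s) (s + m))`. -/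
def recipGammaCoeff (m : ℕ) (s : ℂ) : ℂ :=
  (ascPochhammer ℂ m).eval s * (Complex.Gamma (s + m + 1))⁻¹

theorem ascPochhammer_eval_mul_inv_Gamma (m : ℕ) (s : ℂ) :
    (ascPochhammer ℂ m).eval s * (Complex.Gamma (s + m))⁻¹ = (Complex.Gamma s)⁻¹ := by
  induction m with
  | zero => simp
  | succ m ih =>
    rw [← ih, ascPochhammer_succ_eval,
      Complex.one_div_Gamma_eq_self_mul_one_div_Gamma_add_one (s + m)]
    push_cast
    ring_nf

theorem recipGammaCoeff_mul (m : ℕ) (s : ℂ) :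
    recipGammaCoeff m s * (s + m) = (Complex.Gamma s)⁻¹ := by
  rw [← ascPochhammer_eval_mul_inv_Gamma m s, recipGammaCoeff,
    Complex.one_div_Gamma_eq_self_mul_one_div_Gamma_add_one (s + m)]
  ring

theorem differentiable_recipGammaCoeff (m : ℕ) : Differentiable ℂ (recipGammaCoeff m) := by
  have h : Differentiable ℂ fun s : ℂ => (Complex.Gamma (s + m + 1))⁻¹ :=
    Complex.differentiable_one_div_Gamma.comp (by fun_prop)
  exact (Polynomial.differentiable _).mul h

/-- For `m < n` the reciprocal Gamma factor vanishes at a non-positive integer; for `m > n` the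
Pochhammer product contains the factor `0`; for `m = n` it is `(-n)(-n+1)⋯(-1)`. -/
theorem recipGammaCoeff_neg_natCast (m n : ℕ) :
    recipGammaCoeff m (-(n : ℂ)) = if m = n then (-1) ^ n * (n.factorial : ℂ) else 0 := by
  rcases lt_trichotomy m n with h | rfl | h
  · have : (-(n : ℂ) + m + 1) = -((n - m - 1 : ℕ) : ℂ) := by
      rw [Nat.cast_sub (by omega), Nat.cast_sub (by omega)]; push_cast; ring
    rw [recipGammaCoeff, this, Complex.Gamma_neg_nat_eq_zero]
    simp [h.ne]
  · simp [recipGammaCoeff, ascPochhammer_eval_neg_eq_descPochhammer, Complex.Gamma_one,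
      descPochhammer_eval_eq_descFactorial, Nat.descFactorial_self]
  · rw [if_neg h.ne', recipGammaCoeff, ascPochhammer_eval_neg_coe_nat_of_lt h, zero_mul]

/-- Uniformity in `m`: once `m ≥ A + 1` one has `|s + m| ≥ 1`, so the coefficient is at most `|1 /
Γ(s)|`. Finitely many `m` remain, and compactness handles them. -/
theorem exists_norm_recipGammaCoeff_le (A : ℝ) :
    ∃ C, 0 ≤ C ∧ ∀ s : ℂ, ‖s‖ ≤ A → ∀ m, ‖recipGammaCoeff m s‖ ≤ C := by
  have hb : ∀ f : ℂ → ℂ, Continuous f → ∃ C, 0 ≤ C ∧ ∀ s : ℂ, ‖s‖ ≤ A → ‖f s‖ ≤ C := by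
    intro f hf
    obtain ⟨C, hC⟩ := (isCompact_closedBall (0 : ℂ) A).exists_bound_of_continuousOn hf.continuousOn
    exact ⟨max C 0, le_max_right _ _, fun s hs =>
      (hC s (by simpa using hs)).trans (le_max_left _ _)⟩
  obtain ⟨C₀, hC₀, h₀⟩ := hb _ Complex.differentiable_one_div_Gamma.continuous
  choose C hC hCb using fun m => hb _ (differentiable_recipGammaCoeff m).continuous
  obtain ⟨N, hN⟩ := exists_nat_ge (A + 1)
  have hsum : 0 ≤ ∑ m ∈ Finset.range N, C m := Finset.sum_nonneg fun i _ => hC i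
  refine ⟨C₀ + ∑ m ∈ Finset.range N, C m, by positivity, fun s hs m => ?_⟩
  rcases lt_or_ge m N with hm | hm
  · calc _ ≤ C m := hCb m s hs
      _ ≤ ∑ m ∈ Finset.range N, C m :=
        Finset.single_le_sum (f := C) (fun i _ => hC i) (Finset.mem_range.2 hm)
      _ ≤ _ := by linarith
  · have h1 : 1 ≤ ‖s + m‖ := by
      have : (m : ℝ) ≤ ‖s + m‖ + ‖s‖ := by
        calc (m : ℝ) = ‖(s + m) - s‖ := by simp
          _ ≤ _ := norm_sub_le _ _
      have : (N : ℝ) ≤ m := by exact_mod_cast hm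
      linarith
    have h2 := congrArg norm (recipGammaCoeff_mul m s)
    rw [norm_mul] at h2
    calc ‖recipGammaCoeff m s‖ ≤ ‖recipGammaCoeff m s‖ * ‖s + m‖ :=
          le_mul_of_one_le_right (norm_nonneg _) h1
      _ ≤ C₀ := by rw [h2]; exact h₀ s hs
      _ ≤ _ := le_add_of_nonneg_right hsum

/-- The generating function of the coefficients `1 / (Γ(s) (s + m))`. -/
def recipGammaSeries (s q : ℂ) : ℂ := ∑' m, recipGammaCoeff m s * q ^ m

theorem norm_recipGammaCoeff_mul_pow_le {C : ℝ} {s q : ℂ} (hq : ‖q‖ ≤ 1 / 2) {m : ℕ}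
    (h : ‖recipGammaCoeff m s‖ ≤ C) : ‖recipGammaCoeff m s * q ^ m‖ ≤ C * (1 / 2) ^ m := by
  rw [norm_mul, norm_pow]
  have : 0 ≤ C := (norm_nonneg _).trans h
  gcongr

theorem summable_recipGammaSeries (s : ℂ) {q : ℂ} (hq : ‖q‖ ≤ 1 / 2) :
    Summable fun m => recipGammaCoeff m s * q ^ m := by
  obtain ⟨C, -, hC⟩ := exists_norm_recipGammaCoeff_le ‖s‖
  exact Summable.of_norm_bounded (summable_geometric_two.mul_left C) fun m =>
    norm_recipGammaCoeff_mul_pow_le hq (hC s le_rfl m)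

theorem exists_norm_recipGammaSeries_le (A : ℝ) :
    ∃ C, 0 ≤ C ∧ ∀ s q : ℂ, ‖s‖ ≤ A → ‖q‖ ≤ 1 / 2 → ‖recipGammaSeries s q‖ ≤ C := by
  obtain ⟨C, hC0, hC⟩ := exists_norm_recipGammaCoeff_le A
  refine ⟨C * 2, by positivity, fun s q hs hq => ?_⟩
  refine tsum_of_norm_bounded (hasSum_geometric_two.mul_left C) fun m => ?_
  exact norm_recipGammaCoeff_mul_pow_le hq (hC s hs m)

theorem differentiable_recipGammaSeries {q : ℂ} (hq : ‖q‖ ≤ 1 / 2) :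
    Differentiable ℂ fun s => recipGammaSeries s q := by
  intro s
  obtain ⟨C, -, hC⟩ := exists_norm_recipGammaCoeff_le (‖s‖ + 1)
  have : DifferentiableOn ℂ (fun s => recipGammaSeries s q) (Metric.ball 0 (‖s‖ + 1)) :=
    Complex.differentiableOn_tsum_of_summable_norm (summable_geometric_two.mul_left C)
      (fun m => ((differentiable_recipGammaCoeff m).mul_const _).differentiableOn)
      Metric.isOpen_ball fun m w hw =>
        norm_recipGammaCoeff_mul_pow_le hq (hC w (by simpa using (mem_ball_zero_iff.1 hw).le) m)
  exact this.differentiableAt (Metric.isOpen_ball.mem_nhds (by simp))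

theorem continuousOn_recipGammaSeries (s : ℂ) :
    ContinuousOn (recipGammaSeries s) (Metric.closedBall 0 (1 / 2)) := by
  obtain ⟨C, -, hC⟩ := exists_norm_recipGammaCoeff_le ‖s‖
  exact continuousOn_tsum (fun m => by fun_prop) (summable_geometric_two.mul_left C)
    fun m q hq => norm_recipGammaCoeff_mul_pow_le (by simpa using hq) (hC s le_rfl m)

/-- The density on the contour that represents the regularised Mellin transform
`f ↦ 1 / Γ(s) ∫₀^∞ t ^ (s - 1) f(t) dt`. It is entire in `s`. -/
def mellinKernel (R : ℝ) (s : ℂ) (y : ℝ) : ℂ :=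
  if y ∈ Ioo (-(2 * Real.pi)) 0 then
    (2 * Real.pi : ℂ)⁻¹ * (R / 2 : ℝ) ^ s * recipGammaSeries s ((R / 2 : ℝ) / contour R y)
  else if R / 2 < y then (y : ℂ) ^ (s - 1) * (Complex.Gamma s)⁻¹ else 0

theorem norm_half_div_contour_le {R y : ℝ} (hR : 0 < R) (hy : y < 0) :
    ‖((R / 2 : ℝ) : ℂ) / contour R y‖ ≤ 1 / 2 := by
  rw [norm_div, norm_contour_of_neg hR hy, Complex.norm_real, Real.norm_of_nonneg (by positivity)]
  exact le_of_eq (by field_simp)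

theorem differentiable_mellinKernel {R : ℝ} (hR : 0 < R) (y : ℝ) :
    Differentiable ℂ fun s => mellinKernel R s y := by
  unfold mellinKernel
  split_ifs with h1 h2
  · have : ((R / 2 : ℝ) : ℂ) ≠ 0 := by exact_mod_cast (half_pos hR).ne'
    have h3 : Differentiable ℂ fun s : ℂ => ((R / 2 : ℝ) : ℂ) ^ s :=
      fun s => (differentiableAt_id).const_cpow (Or.inl this)
    exact (h3.const_mul _).mul (differentiable_recipGammaSeries (norm_half_div_contour_le hR h1.2))
  · have : (y : ℂ) ≠ 0 := by exact_mod_cast ((half_pos hR).trans h2).ne'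
    have h3 : Differentiable ℂ fun s : ℂ => (y : ℂ) ^ (s - 1) :=
      fun s => (differentiableAt_id.sub_const 1).const_cpow (Or.inl this)
    exact h3.mul Complex.differentiable_one_div_Gamma
  · exact differentiable_const 0

theorem measurable_mellinKernel {R : ℝ} (hR : 0 < R) (s : ℂ) : Measurable (mellinKernel R s) := by
  have hc : Continuous fun y => ((R / 2 : ℝ) : ℂ) / circleMap 0 R (-y) :=
    continuous_const.div ((continuous_circleMap 0 R).comp continuous_neg)
      fun y => circleMap_ne_center hR.ne'
  have hc' : Continuous fun y => recipGammaSeries s (((R / 2 : ℝ) : ℂ) / circleMap 0 R (-y)) := by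
    refine (continuousOn_recipGammaSeries s).comp_continuous hc fun y => ?_
    rw [mem_closedBall_zero_iff, norm_div, norm_circleMap_zero, abs_of_pos hR, Complex.norm_real,
      Real.norm_of_nonneg (by positivity)]
    exact le_of_eq (by field_simp)
  have : mellinKernel R s = fun y => if y ∈ Ioo (-(2 * Real.pi)) 0 then
      (2 * Real.pi : ℂ)⁻¹ * (R / 2 : ℝ) ^ s *
        recipGammaSeries s (((R / 2 : ℝ) : ℂ) / circleMap 0 R (-y))
      else if R / 2 < y then (y : ℂ) ^ (s - 1) * (Complex.Gamma s)⁻¹ else 0 := by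
    funext y
    unfold mellinKernel
    split_ifs with h
    · rw [contour_of_neg h.2]
    · rfl
    · rfl
  rw [this]
  refine Measurable.ite measurableSet_Ioo (hc'.measurable.const_mul _) ?_
  refine Measurable.ite measurableSet_Ioi ?_ measurable_const
  exact (Measurable.pow_const Complex.measurable_ofReal _).mul_const _

/-- The half-line part is killed by `1 / Γ(-n) = 0`, and in the circle part the two powers of `R /
2` cancel. What is left is the density of Cauchy's formula for the `n`-th Taylor coefficient. -/
theorem mellinKernel_neg_natCast {R : ℝ} (hR : 0 < R) (n : ℕ) (y : ℝ) :
    mellinKernel R (-(n : ℂ)) y = (Ioo (-(2 * Real.pi)) 0).indicator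
      (fun y => (2 * Real.pi : ℂ)⁻¹ * ((-1) ^ n * n.factorial) * (contour R y)⁻¹ ^ n) y := by
  by_cases h : y ∈ Ioo (-(2 * Real.pi)) 0
  · have hc := contour_ne_zero_of_neg hR h.2
    have hR' : ((R / 2 : ℝ) : ℂ) ≠ 0 := by exact_mod_cast (half_pos hR).ne'
    rw [mellinKernel, if_pos h, indicator_of_mem h, recipGammaSeries, tsum_eq_single n]
    · rw [recipGammaCoeff_neg_natCast, if_pos rfl, Complex.cpow_neg, Complex.cpow_natCast, div_pow,
        inv_pow]
      field_simp
    · intro m hm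
      rw [recipGammaCoeff_neg_natCast, if_neg hm, zero_mul]
  · rw [mellinKernel, if_neg h, indicator_of_notMem h, Complex.Gamma_neg_nat_eq_zero]
    simp

/-- For `y > R` both `y` and `1 / y` lie below `y + 1 + 1 / R`, a base at least `1`, so powers of
either sign are at most one fixed power of it. -/
theorem exists_rpow_le_mul_exp {R c A : ℝ} (hR : 0 < R) (hc : 0 < c) :
    ∃ C, 0 ≤ C ∧ ∀ σ y : ℝ, |σ| ≤ A → R < y → y ^ σ ≤ C * Real.exp (c * y) := by
  obtain ⟨N, hN⟩ := exists_nat_ge A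
  refine ⟨N.factorial * (1 / c) ^ N * Real.exp (c * (1 + R⁻¹)), by positivity, ?_⟩
  intro σ y hσ hy
  have hy0 : 0 < y := hR.trans hy
  set K := 1 + R⁻¹ with hK
  have hK0 : 0 < K := by positivity
  have h1 : y ^ σ ≤ (y + K) ^ N := by
    rw [← Real.rpow_natCast]
    rcases le_or_gt 0 σ with h | h
    · calc y ^ σ ≤ (y + K) ^ σ := Real.rpow_le_rpow hy0.le (by linarith) h
        _ ≤ _ := Real.rpow_le_rpow_of_exponent_le
            (by have := inv_pos.2 hR; linarith) (by linarith [le_abs_self σ])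
    · calc y ^ σ = (y⁻¹) ^ (-σ) := by rw [Real.inv_rpow hy0.le, Real.rpow_neg hy0.le, inv_inv]
        _ ≤ (y + K) ^ (-σ) := Real.rpow_le_rpow (by positivity)
            (by have := inv_anti₀ hR hy.le; linarith) (by linarith)
        _ ≤ _ := Real.rpow_le_rpow_of_exponent_le
            (by have := inv_pos.2 hR; linarith) (by linarith [neg_le_abs σ])
  have h2 := Real.pow_div_factorial_le_exp (c * (y + K)) (by positivity) N
  rw [div_le_iff₀ (by positivity)] at h2
  calc y ^ σ ≤ (y + K) ^ N := h1
    _ = (1 / c) ^ N * (c * (y + K)) ^ N := by rw [← mul_pow]; congr 1; field_simp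
    _ ≤ (1 / c) ^ N * (Real.exp (c * (y + K)) * N.factorial) := by gcongr
    _ = _ := by rw [mul_add, Real.exp_add]; ring

/-- Half of the decay rate absorbs the power `y ^ (s - 1)`, the other half remains. Uniformity for
`s` in a disc is what makes the transform holomorphic in `s`. -/
theorem exists_norm_mellinKernel_mul_exp_le {R c : ℝ} (hR : 0 < R) (hc : 0 < c) (A : ℝ) :
    ∃ C, 0 ≤ C ∧ ∀ s : ℂ, ‖s‖ ≤ A → ∀ y : ℝ,
      ‖mellinKernel R s y‖ * Real.exp (-c * (contour R y).re) ≤ C * Real.exp (-(c / 2) * |y|) := by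
  obtain ⟨C₁, hC₁, h₁⟩ := exists_norm_recipGammaSeries_le A
  obtain ⟨C₂, hC₂, h₂⟩ := exists_rpow_le_mul_exp (A := A + 1) (half_pos hR) (half_pos hc)
  obtain ⟨C₃, h₃⟩ := (isCompact_closedBall (0 : ℂ) A).exists_bound_of_continuousOn
    Complex.differentiable_one_div_Gamma.continuous.continuousOn
  obtain ⟨C₄, h₄⟩ := (isCompact_closedBall (0 : ℂ) A).exists_bound_of_continuousOn
    (f := fun s : ℂ => (2 * Real.pi : ℂ)⁻¹ * (R / 2 : ℝ) ^ s)
    (by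
      have : ((R / 2 : ℝ) : ℂ) ≠ 0 := by exact_mod_cast (half_pos hR).ne'
      exact (continuous_const.mul (continuous_const.cpow continuous_id
        fun _ => Or.inl (by
          exact_mod_cast (half_pos hR)))).continuousOn)
  refine ⟨|C₄| * C₁ * Real.exp (c * R) * Real.exp (c / 2 * (2 * Real.pi)) + C₂ * |C₃|,
    by positivity, fun s hs y => ?_⟩
  have hs' : s ∈ Metric.closedBall (0 : ℂ) A := by simpa using hs
  have hpos1 : 0 ≤ |C₄| * C₁ * Real.exp (c * R) * Real.exp (c / 2 * (2 * Real.pi)) := by positivity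
  have hpos2 : 0 ≤ C₂ * |C₃| := by positivity
  unfold mellinKernel
  split_ifs with hy1 hy2
  · have e1 : ‖(2 * Real.pi : ℂ)⁻¹ * (R / 2 : ℝ) ^ s *
        recipGammaSeries s ((R / 2 : ℝ) / contour R y)‖ ≤ |C₄| * C₁ := by
      rw [norm_mul]
      exact mul_le_mul ((h₄ s hs').trans (le_abs_self _))
        (h₁ s _ hs (norm_half_div_contour_le hR hy1.2)) (norm_nonneg _) (abs_nonneg _)
    have e2 : Real.exp (-c * (contour R y).re) ≤ Real.exp (c * R) := by
      have := (Complex.abs_re_le_norm (contour R y)).trans_eq (norm_contour_of_neg hR hy1.2)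
      have := (abs_le.1 this).1
      exact Real.exp_le_exp.2 (by nlinarith)
    -- The circle uses only `|y| < 2π`, so the decaying factor costs a constant there.
    have e3 : Real.exp (c / 2 * (2 * Real.pi)) * Real.exp (-(c / 2) * |y|) ≥ 1 := by
      rw [← Real.exp_add, ge_iff_le, Real.one_le_exp_iff, abs_of_neg hy1.2]
      have := hy1.1
      nlinarith
    calc _ ≤ |C₄| * C₁ * Real.exp (c * R) := mul_le_mul e1 e2 (Real.exp_pos _).le (by positivity)
      _ ≤ |C₄| * C₁ * Real.exp (c * R) *
          (Real.exp (c / 2 * (2 * Real.pi)) * Real.exp (-(c / 2) * |y|)) :=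
        le_mul_of_one_le_right (by positivity) e3
      _ ≤ _ := by
        rw [add_mul, ← mul_assoc]
        exact le_add_of_nonneg_right (by positivity)
  · have hy0 : 0 < y := (half_pos hR).trans hy2
    have e1 : ‖(y : ℂ) ^ (s - 1)‖ ≤ C₂ * Real.exp (c / 2 * y) := by
      rw [Complex.norm_cpow_eq_rpow_re_of_pos hy0]
      refine h₂ _ _ ?_ hy2
      calc |(s - 1).re| ≤ ‖s - 1‖ := Complex.abs_re_le_norm _
        _ ≤ ‖s‖ + ‖(1 : ℂ)‖ := norm_sub_le _ _
        _ ≤ A + 1 := by simpa using hs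
    rw [norm_mul, contour_of_nonneg hy0.le, Complex.ofReal_re, abs_of_pos hy0]
    calc _ ≤ C₂ * Real.exp (c / 2 * y) * |C₃| * Real.exp (-c * y) := by
          gcongr
          exact (h₃ s hs').trans (le_abs_self _)
      _ = C₂ * |C₃| * Real.exp (-(c / 2) * y) := by
          rw [show C₂ * Real.exp (c / 2 * y) * |C₃| * Real.exp (-c * y) =
            C₂ * |C₃| * (Real.exp (c / 2 * y) * Real.exp (-c * y)) by ring, ← Real.exp_add]
          ring_nf
      _ ≤ _ := by
        rw [add_mul]
        exact le_add_of_nonneg_left (by positivity)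
  · simp only [norm_zero, zero_mul]
    positivity

theorem integrable_exp_neg_mul_abs {c : ℝ} (hc : 0 < c) :
    Integrable fun y : ℝ => Real.exp (-c * |y|) := by
  have h : IntegrableOn (fun y : ℝ => Real.exp (-c * y)) (Ioi 0) := exp_neg_integrableOn_Ioi 0 hc
  have h1 : IntegrableOn (fun y : ℝ => Real.exp (-c * |y|)) (Ioi 0) :=
    h.congr_fun (fun y hy => by simp only [abs_of_pos (mem_Ioi.1 hy)]) measurableSet_Ioi
  have h2 : IntegrableOn (fun y : ℝ => Real.exp (-c * |y|)) (Iio 0) := by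
    have := ((Measure.measurePreserving_neg (volume : Measure ℝ)).integrableOn_comp_preimage
      (Homeomorph.neg ℝ).measurableEmbedding).2 h1
    simpa [Function.comp_def] using this
  have h3 := ((integrableOn_Iic_iff_integrableOn_Iio (by simp)).2 h2).union h1
  rwa [Iic_union_Ioi, integrableOn_univ] at h3

end

/-! ### Integration of decaying holomorphic functions over products of weighted paths -/

section

/-- A complex density `κ` along a path `γ` in `S`, integrable against `exp (-c Re x)`. -/
structure IsPathWeight (S : Set ℂ) (c : ℝ) (γ κ : ℝ → ℂ) : Prop where
  measurable_path : Measurable γ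
  mem : ∀ y, γ y ∈ S
  measurable_density : Measurable κ
  integrable : Integrable fun y => ‖κ y‖ * Real.exp (-c * (γ y).re)

/-- Holomorphic functions on `S ^ n` that decay like `∏ exp (-c Re x_j)`. -/
structure IsDecaying (S : Set ℂ) (c : ℝ) {n : ℕ} (F : (Fin n → ℂ) → ℂ) : Prop where
  differentiableOn : DifferentiableOn ℂ F (univ.pi fun _ => S)
  bound : ∃ C, ∀ x : Fin n → ℂ, (∀ j, x j ∈ S) → ‖F x‖ ≤ C * ∏ j, Real.exp (-c * (x j).re)

section

variable {S : Set ℂ} {c : ℝ} {n : ℕ}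

/-- `F` is controlled only on the open set `S ^ n`, so it is replaced outside by `0`, which the
paths do not see. -/
theorem measurable_comp_path (hS : IsOpen S) {F : (Fin n → ℂ) → ℂ}
    (hF : ContinuousOn F (univ.pi fun _ => S)) {γ : Fin n → ℝ → ℂ} (hγ : ∀ j, Measurable (γ j))
    (hmem : ∀ j y, γ j y ∈ S) : Measurable fun y : Fin n → ℝ => F fun j => γ j (y j) := by
  classical
  have hP : MeasurableSet (univ.pi fun _ : Fin n => S) :=
    (isOpen_set_pi finite_univ fun _ _ => hS).measurableSet
  have h1 : Measurable ((univ.pi fun _ : Fin n => S).piecewise F 0) :=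
    hF.measurable_piecewise continuousOn_const hP
  have h2 : Measurable fun (y : Fin n → ℝ) j => γ j (y j) :=
    measurable_pi_lambda _ fun j => (hγ j).comp (measurable_pi_apply j)
  convert h1.comp h2 using 1
  funext y
  rw [Function.comp_apply, piecewise_eq_of_mem _ _ _ (mem_univ_pi.2 fun j => hmem j _)]

theorem IsDecaying.norm_comp_mul_le {F : (Fin n → ℂ) → ℂ} {C : ℝ} {x κ : Fin n → ℂ}
    (hC : ‖F x‖ ≤ C * ∏ j, Real.exp (-c * (x j).re)) :
    ‖F x * ∏ j, κ j‖ ≤ C * ∏ j, (‖κ j‖ * Real.exp (-c * (x j).re)) := by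
  rw [norm_mul, norm_prod, Finset.prod_mul_distrib]
  calc _ ≤ (C * ∏ j, Real.exp (-c * (x j).re)) * ∏ j, ‖κ j‖ := by gcongr
    _ = _ := by ring

theorem IsDecaying.integrable (hS : IsOpen S) {F : (Fin n → ℂ) → ℂ} (hF : IsDecaying S c F)
    {γ κ : Fin n → ℝ → ℂ} (h : ∀ j, IsPathWeight S c (γ j) (κ j)) :
    Integrable fun y : Fin n → ℝ => F (fun j => γ j (y j)) * ∏ j, κ j (y j) := by
  obtain ⟨C, hC⟩ := hF.bound
  have hg : Integrable fun y : Fin n → ℝ =>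
      ∏ j, (‖κ j (y j)‖ * Real.exp (-c * (γ j (y j)).re)) :=
    Integrable.fintype_prod (f := fun j y => ‖κ j y‖ * Real.exp (-c * (γ j y).re))
      fun j => (h j).integrable
  refine (hg.const_mul C).mono' ?_ (Eventually.of_forall fun y =>
    IsDecaying.norm_comp_mul_le (hC _ fun j => (h j).mem _))
  refine Measurable.aestronglyMeasurable (Measurable.mul ?_ ?_)
  · exact measurable_comp_path hS hF.differentiableOn.continuousOn
      (fun j => (h j).measurable_path) fun j => (h j).mem
  · exact Finset.measurable_prod _ fun j _ =>
      (h j).measurable_density.comp (measurable_pi_apply j)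

theorem integral_fin_succ {G : (Fin (n + 1) → ℝ) → ℂ} (hG : Integrable G) :
    ∫ y, G y = ∫ y₀ : ℝ, ∫ y : Fin n → ℝ, G (Fin.cons y₀ y) ∧
      ∫ y, G y = ∫ y : Fin n → ℝ, ∫ y₀ : ℝ, G (Fin.cons y₀ y) := by
  have hp := (volume_preserving_piFinSuccAbove (fun _ : Fin (n + 1) => ℝ) 0).symm
  have he : ∀ x : ℝ × (Fin n → ℝ),
      (MeasurableEquiv.piFinSuccAbove (fun _ : Fin (n + 1) => ℝ) 0).symm x = Fin.cons x.1 x.2 := by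
    intro x
    simp [MeasurableEquiv.piFinSuccAbove_symm_apply, Fin.insertNthEquiv]
  have hi : Integrable fun x : ℝ × (Fin n → ℝ) => G (Fin.cons x.1 x.2) := by
    have := (hp.integrable_comp_emb (MeasurableEquiv.measurableEmbedding _)).2 hG
    exact this.congr (Eventually.of_forall fun x => congrArg G (he x))
  have hI : ∫ y, G y = ∫ x : ℝ × (Fin n → ℝ), G (Fin.cons x.1 x.2) := by
    rw [← hp.integral_comp']
    simp only [he]
  rw [hI]
  exact ⟨integral_prod _ hi, integral_prod_symm _ hi⟩

theorem IsDecaying.cons_left {F : (Fin (n + 1) → ℂ) → ℂ} (hF : IsDecaying S c F) {x₀ : ℂ}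
    (hx₀ : x₀ ∈ S) : IsDecaying S c fun x : Fin n → ℂ => F (Fin.cons x₀ x) where
  differentiableOn := by
    refine hF.differentiableOn.comp (f := fun x : Fin n → ℂ => (Fin.cons x₀ x : Fin (n + 1) → ℂ))
      (Differentiable.differentiableOn ?_) fun x hx => ?_
    · refine differentiable_pi.2 fun j => ?_
      refine Fin.cases ?_ (fun j => ?_) j
      · simp
      · simp only [Fin.cons_succ]; fun_prop
    · refine mem_univ_pi.2 fun j => Fin.cases ?_ (fun j => ?_) j
      · simpa using hx₀
      · simpa using hx j (mem_univ j)
  bound := by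
    obtain ⟨C, hC⟩ := hF.bound
    refine ⟨C * Real.exp (-c * x₀.re), fun x hx => ?_⟩
    refine (hC _ fun j => ?_).trans_eq ?_
    · refine Fin.cases ?_ (fun j => ?_) j
      · simpa using hx₀
      · simpa using hx j
    · rw [Fin.prod_univ_succ]
      simp [mul_assoc]

theorem IsDecaying.cons_right {F : (Fin (n + 1) → ℂ) → ℂ} (hF : IsDecaying S c F) {x : Fin n → ℂ}
    (hx : ∀ j, x j ∈ S) : DifferentiableOn ℂ (fun x₀ => F (Fin.cons x₀ x)) S ∧
      ∃ C, ∀ x₀ ∈ S, ‖F (Fin.cons x₀ x)‖ ≤ C * Real.exp (-c * x₀.re) := by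
  have hmem : ∀ x₀ ∈ S, ∀ j, (Fin.cons x₀ x : Fin (n + 1) → ℂ) j ∈ S := fun x₀ hx₀ j =>
    Fin.cases (by simpa using hx₀) (fun j => by simpa using hx j) j
  constructor
  · refine hF.differentiableOn.comp (f := fun x₀ : ℂ => (Fin.cons x₀ x : Fin (n + 1) → ℂ))
      (Differentiable.differentiableOn ?_) fun x₀ hx₀ => mem_univ_pi.2 (hmem x₀ hx₀)
    refine differentiable_pi.2 fun j => ?_
    refine Fin.cases ?_ (fun j => ?_) j
    · simp
    · simp
  · obtain ⟨C, hC⟩ := hF.bound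
    refine ⟨C * ∏ j, Real.exp (-c * (x j).re), fun x₀ hx₀ => ?_⟩
    refine (hC _ (hmem x₀ hx₀)).trans_eq ?_
    rw [Fin.prod_univ_succ]
    simp only [Fin.cons_zero, Fin.cons_succ]
    ring

/-- Path weights that agree on decaying holomorphic functions of one variable agree on those of
several variables. -/
theorem IsDecaying.integral_congr (hS : IsOpen S) {γ κ γ' κ' : Fin n → ℝ → ℂ}
    (h : ∀ j, IsPathWeight S c (γ j) (κ j)) (h' : ∀ j, IsPathWeight S c (γ' j) (κ' j))
    (heq : ∀ j, ∀ f : ℂ → ℂ, DifferentiableOn ℂ f S →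
      (∃ C, ∀ x ∈ S, ‖f x‖ ≤ C * Real.exp (-c * x.re)) →
      ∫ y, f (γ j y) * κ j y = ∫ y, f (γ' j y) * κ' j y)
    {F : (Fin n → ℂ) → ℂ} (hF : IsDecaying S c F) :
    ∫ y : Fin n → ℝ, F (fun j => γ j (y j)) * ∏ j, κ j (y j) =
      ∫ y : Fin n → ℝ, F (fun j => γ' j (y j)) * ∏ j, κ' j (y j) := by
  induction n with
  | zero =>
    refine integral_congr_ae (Eventually.of_forall fun y => ?_)
    simp only [Finset.univ_eq_empty, Finset.prod_empty]
    congr 2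
    exact Subsingleton.elim _ _
  | succ n ih =>
    have hsplit : ∀ δ ν : Fin (n + 1) → ℝ → ℂ, ∀ (y₀ : ℝ) (y : Fin n → ℝ),
        (F (fun j => δ j ((Fin.cons y₀ y : Fin (n + 1) → ℝ) j)) *
          ∏ j, ν j ((Fin.cons y₀ y : Fin (n + 1) → ℝ) j)) =
        F (Fin.cons (δ 0 y₀) fun j => δ j.succ (y j)) *
          (ν 0 y₀ * ∏ j : Fin n, ν j.succ (y j)) := by
      intro δ ν y₀ y
      rw [Fin.prod_univ_succ]
      simp only [Fin.cons_zero, Fin.cons_succ]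
      congr 2
      funext j
      refine Fin.cases ?_ (fun j => ?_) j <;> simp
    -- Hybrid weights: the first variable is still on the old path, the others already on the new
    -- one. Fubini in the two orders isolates the induction hypothesis and the one-variable
    -- identity.
    let δ : Fin (n + 1) → ℝ → ℂ := Fin.cons (γ 0) fun j => γ' j.succ
    let ν : Fin (n + 1) → ℝ → ℂ := Fin.cons (κ 0) fun j => κ' j.succ
    have hδ : ∀ j, IsPathWeight S c (δ j) (ν j) := fun j =>
      Fin.cases (by simpa [δ, ν] using h 0) (fun j => by simpa [δ, ν] using h' j.succ) j
    rw [(integral_fin_succ (hF.integrable hS h)).1, (integral_fin_succ (hF.integrable hS h')).2]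
    trans ∫ y : Fin (n + 1) → ℝ, F (fun j => δ j (y j)) * ∏ j, ν j (y j)
    · rw [(integral_fin_succ (hF.integrable hS hδ)).1]
      refine integral_congr_ae (Eventually.of_forall fun y₀ => ?_)
      simp only [hsplit]
      simp only [δ, ν, Fin.cons_zero, Fin.cons_succ]
      have := ih (fun j => h j.succ) (fun j => h' j.succ) (fun j => heq j.succ)
        (hF.cons_left ((h 0).mem y₀))
      simp only [mul_left_comm _ (κ 0 y₀), integral_const_mul]
      rw [this]
    · rw [(integral_fin_succ (hF.integrable hS hδ)).2]
      refine integral_congr_ae (Eventually.of_forall fun y => ?_)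
      simp only [hsplit]
      simp only [δ, ν, Fin.cons_zero, Fin.cons_succ]
      obtain ⟨h1, h2⟩ := hF.cons_right (x := fun j => γ' j.succ (y j)) fun j => (h' j.succ).mem _
      simp only [← mul_assoc, integral_mul_const]
      rw [heq 0 _ h1 h2]

end

end

/-! ### One-variable Mellin and Cauchy formulas along the contour -/

section

theorem HasSum.congr_term {ι : Type*} {f g : ι → ℂ} {a : ℂ} (h : HasSum g a)
    (hfg : ∀ i, f i = g i) : HasSum f a := by
  rwa [funext hfg]

theorem IsPathWeight.integrable_comp {S : Set ℂ} {c : ℝ} (hS : IsOpen S) {γ κ : ℝ → ℂ}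
    (h : IsPathWeight S c γ κ) {f : ℂ → ℂ} (hf : ContinuousOn f S)
    (hb : ∃ C, ∀ x ∈ S, ‖f x‖ ≤ C * Real.exp (-c * x.re)) :
    Integrable fun y => f (γ y) * κ y := by
  classical
  obtain ⟨C, hC⟩ := hb
  have h1 : Measurable (S.piecewise f 0) :=
    hf.measurable_piecewise continuousOn_const hS.measurableSet
  have h2 : Measurable fun y => f (γ y) := by
    convert h1.comp h.measurable_path using 1
    funext y
    rw [Function.comp_apply, piecewise_eq_of_mem _ _ _ (h.mem y)]
  refine (h.integrable.const_mul C).mono' (h2.mul h.measurable_density).aestronglyMeasurable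
    (Eventually.of_forall fun y => ?_)
  rw [norm_mul]
  calc _ ≤ C * Real.exp (-c * (γ y).re) * ‖κ y‖ := by gcongr; exact hC _ (h.mem y)
    _ = _ := by ring

theorem isPathWeight_contour_mellinKernel {R c : ℝ} (hR : 0 < R) (hc : 0 < c) (s : ℂ) :
    IsPathWeight (stadium (2 * R)) c (contour R) (mellinKernel R s) where
  measurable_path := measurable_contour R
  mem := contour_mem_stadium hR
  measurable_density := measurable_mellinKernel hR s
  integrable := by
    obtain ⟨C, -, hC⟩ := exists_norm_mellinKernel_mul_exp_le hR hc ‖s‖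
    refine ((integrable_exp_neg_mul_abs (half_pos hc)).const_mul C).mono' ?_
      (Eventually.of_forall fun y => ?_)
    · have := Complex.measurable_re.comp (measurable_contour R)
      exact ((measurable_mellinKernel hR s).norm.mul
        (Real.measurable_exp.comp (this.const_mul _))).aestronglyMeasurable
    · rw [Real.norm_of_nonneg (by positivity)]
      exact hC s le_rfl y

/-- The ordinary Mellin integral as a path weight. The path is frozen at `0` for `y ≤ 0`, where the
density vanishes, so that it stays in the stadium. -/
theorem isPathWeight_halfLine {ρ c : ℝ} (hρ : 0 < ρ) (hc : 0 < c) {s : ℂ} (hs : 0 < s.re) :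
    IsPathWeight (stadium ρ) c (fun y => (max y 0 : ℝ))
      ((Ioi 0).indicator fun y => (y : ℂ) ^ (s - 1) * (Complex.Gamma s)⁻¹) where
  measurable_path := Complex.measurable_ofReal.comp (measurable_id.max measurable_const)
  mem y := ofReal_mem_stadium hρ (le_max_right _ _)
  measurable_density := ((Complex.measurable_ofReal.pow_const _).mul_const _).indicator
    measurableSet_Ioi
  integrable := by
    have h1 : IntegrableOn (fun x : ℝ => x ^ (s.re - 1) * Real.exp (-c * x ^ (1 : ℝ))) (Ioi 0) :=
      integrableOn_rpow_mul_exp_neg_mul_rpow (by linarith) one_pos hc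
    have h2 := (integrable_indicator_iff measurableSet_Ioi).2
      (h1.const_mul ‖(Complex.Gamma s)⁻¹‖)
    refine h2.congr (Eventually.of_forall fun y => ?_)
    by_cases hy : y ∈ Ioi (0 : ℝ)
    · simp only [indicator_of_mem hy, norm_mul, Complex.ofReal_re, max_eq_left (mem_Ioi.1 hy).le,
        Complex.norm_cpow_eq_rpow_re_of_pos (mem_Ioi.1 hy), Real.rpow_one, Complex.sub_re,
        Complex.one_re]
      ring
    · simp only [indicator_of_notMem hy, norm_zero, zero_mul]

/-- With `w = R exp (iθ)`, `dw / (2πi (w - t))` is `w / (w - t) dθ / 2π`: this density integrates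
holomorphic functions to their value at `t`. -/
theorem isPathWeight_contour_cauchy {R c : ℝ} (hR : 0 < R) {t : ℂ} (ht : ‖t‖ < R) :
    IsPathWeight (stadium (2 * R)) c (contour R) ((Ioo (-(2 * Real.pi)) 0).indicator
      fun y => (2 * Real.pi : ℂ)⁻¹ * (contour R y / (contour R y - t))) where
  measurable_path := measurable_contour R
  mem := contour_mem_stadium hR
  measurable_density := (((measurable_contour R).div
    ((measurable_contour R).sub_const t)).const_mul _).indicator measurableSet_Ioo
  integrable := by
    have hm := measurable_contour R
    have hi : Integrable ((Ioo (-(2 * Real.pi)) 0).indicator fun _ =>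
        ‖(2 * Real.pi : ℂ)⁻¹‖ * (R / (R - ‖t‖)) * Real.exp (|c| * R)) :=
      (integrable_indicator_iff measurableSet_Ioo).2
        (integrableOn_const (by rw [Real.volume_Ioo]; exact ENNReal.ofReal_ne_top))
    refine hi.mono' ?_ (Eventually.of_forall fun y => ?_)
    · exact ((((hm.div (hm.sub_const t)).const_mul _).indicator measurableSet_Ioo).norm.mul
        (Real.measurable_exp.comp ((Complex.measurable_re.comp hm).const_mul
          (-c)))).aestronglyMeasurable
    · by_cases hy : y ∈ Ioo (-(2 * Real.pi)) 0
      · have hn := norm_contour_of_neg hR hy.2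
        rw [indicator_of_mem hy, indicator_of_mem hy, norm_mul, norm_norm, norm_mul, norm_div, hn,
          Real.norm_of_nonneg (Real.exp_pos _).le]
        have h1 : R - ‖t‖ ≤ ‖contour R y - t‖ := by
          simpa only [hn] using norm_sub_norm_le (contour R y) t
        have h2 : 0 < R - ‖t‖ := by linarith
        have h3 : -c * (contour R y).re ≤ |c| * R := by
          calc -c * (contour R y).re ≤ |(-c) * (contour R y).re| := le_abs_self _
            _ = |c| * |(contour R y).re| := by rw [abs_mul, abs_neg]
            _ ≤ _ := by gcongr; simpa only [hn] using Complex.abs_re_le_norm (contour R y)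
        gcongr
      · simp [indicator_of_notMem hy]

/-- A constant path with total mass `1` plays the role of the point mass at `t`, so evaluation at a
point fits the same comparison principle. -/
theorem isPathWeight_const {S : Set ℂ} {c : ℝ} {t : ℂ} (ht : t ∈ S) :
    IsPathWeight S c (fun _ => t) ((Ioo 0 1).indicator 1) where
  measurable_path := measurable_const
  mem _ := ht
  measurable_density := measurable_one.indicator measurableSet_Ioo
  integrable := by
    have : Integrable ((Ioo (0 : ℝ) 1).indicator fun _ => Real.exp (-c * t.re)) :=
      (integrable_indicator_iff measurableSet_Ioo).2 (integrableOn_const (by simp))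
    refine this.congr (Eventually.of_forall fun y => ?_)
    by_cases hy : y ∈ Ioo (0 : ℝ) 1 <;> simp [hy, indicator]

theorem integral_indicator_contour (R : ℝ) (g : ℂ → ℂ) :
    ∫ y, (Ioo (-(2 * Real.pi)) 0).indicator (fun y => g (contour R y)) y =
      ∫ θ in (0 : ℝ)..2 * Real.pi, g (circleMap 0 R θ) := by
  rw [integral_indicator measurableSet_Ioo, ← integral_Ioc_eq_integral_Ioo,
    ← intervalIntegral.integral_of_le (by linarith [Real.pi_pos])]
  have := intervalIntegral.integral_comp_neg (a := -(2 * Real.pi)) (b := 0)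
    (fun θ => g (circleMap 0 R θ))
  rw [neg_zero, neg_neg] at this
  rw [← this]
  refine intervalIntegral.integral_congr_ae ?_
  have h0 : ∀ᵐ y : ℝ, y ≠ 0 := by simp [ae_iff]
  filter_upwards [h0] with y hy0 hy
  rw [uIoc_of_le (by linarith [Real.pi_pos])] at hy
  rw [contour_of_neg (lt_of_le_of_ne hy.2 hy0)]

/-- The Cauchy integral for the `m`-th Taylor coefficient. -/
def taylorCoeff (f : ℂ → ℂ) (R : ℝ) (m : ℕ) : ℂ :=
  (2 * Real.pi : ℂ)⁻¹ * ∫ θ in (0 : ℝ)..2 * Real.pi,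
    f (circleMap 0 R θ) * (circleMap 0 R θ)⁻¹ ^ m

section

variable {R : ℝ} {f : ℂ → ℂ}

theorem hasSum_taylorCoeff (hf : DifferentiableOn ℂ f (Metric.closedBall 0 R))
    {t : ℂ} (ht : ‖t‖ < R) : HasSum (fun m => taylorCoeff f R m * t ^ m) (f t) := by
  have hR : 0 < R := (norm_nonneg t).trans_lt ht
  have hci : CircleIntegrable f 0 R :=
    (hf.continuousOn.mono Metric.sphere_subset_closedBall).circleIntegrable hR.le
  have h1 := hasSum_two_pi_I_cauchyPowerSeries_integral hci ht
  rw [zero_add, hf.circleIntegral_sub_inv_smul (by simpa using ht)] at h1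
  have hne : (2 * Real.pi * Complex.I : ℂ) ≠ 0 := by simp [Real.pi_ne_zero]
  have h2 := h1.mul_left (2 * Real.pi * Complex.I : ℂ)⁻¹
  rw [smul_eq_mul, inv_mul_cancel_left₀ hne] at h2
  refine h2.congr_term fun m => ?_
  rw [circleIntegral, taylorCoeff, ← intervalIntegral.integral_const_mul,
    ← intervalIntegral.integral_const_mul, ← intervalIntegral.integral_mul_const]
  refine intervalIntegral.integral_congr fun θ _ => ?_
  have hw : circleMap 0 R θ ≠ 0 := circleMap_ne_center hR.ne'
  have hpi : (Real.pi : ℂ) ≠ 0 := by exact_mod_cast Real.pi_ne_zero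
  simp only [deriv_circleMap, sub_zero, smul_eq_mul, div_pow, inv_pow]
  field_simp

theorem exists_norm_le_on_circle (hR : 0 < R) (hf : ContinuousOn f (Metric.closedBall 0 R)) :
    ∃ M, 0 ≤ M ∧ (∀ θ, ‖f (circleMap 0 R θ)‖ ≤ M) ∧
      ∀ m, ‖taylorCoeff f R m‖ ≤ M * R⁻¹ ^ m := by
  obtain ⟨M, hM⟩ := (isCompact_closedBall (0 : ℂ) R).exists_bound_of_continuousOn hf
  have hM' : ∀ θ, ‖f (circleMap 0 R θ)‖ ≤ M := fun θ =>
    hM _ (by simp [abs_of_pos hR])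
  have hM0 : 0 ≤ M := (norm_nonneg _).trans (hM' 0)
  refine ⟨M, hM0, hM', fun m => ?_⟩
  have h1 : ‖∫ θ in (0 : ℝ)..2 * Real.pi, f (circleMap 0 R θ) * (circleMap 0 R θ)⁻¹ ^ m‖ ≤
      (M * R⁻¹ ^ m) * |2 * Real.pi - 0| := by
    refine intervalIntegral.norm_integral_le_of_norm_le_const fun θ _ => ?_
    rw [norm_mul, norm_pow, norm_inv, norm_circleMap_zero, abs_of_pos hR]
    gcongr
    exact hM' θ
  rw [taylorCoeff, norm_mul, norm_inv]
  have hpi : ‖(2 * Real.pi : ℂ)‖ = 2 * Real.pi := by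
    simp [abs_of_pos Real.pi_pos]
  rw [sub_zero, abs_of_pos Real.two_pi_pos] at h1
  rw [hpi, inv_mul_le_iff₀ Real.two_pi_pos]
  linarith

/-- Expanding the density termwise on the circle produces the same series as integrating the Taylor
expansion over `[0, R / 2]` in `hasSum_segment_part`; the two integrals are equal because their
series agree. The ratio `(R / 2) / w` has norm `1 / 2`, whence the geometric majorant. -/
theorem hasSum_circle_part (hR : 0 < R) (hf : ContinuousOn f (Metric.closedBall 0 R)) (s : ℂ) :
    HasSum (fun m => recipGammaCoeff m s * ((R / 2 : ℝ) : ℂ) ^ (s + m) * taylorCoeff f R m)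
      (∫ θ in (0 : ℝ)..2 * Real.pi, f (circleMap 0 R θ) * ((2 * Real.pi : ℂ)⁻¹ * (R / 2 : ℝ) ^ s *
        recipGammaSeries s ((R / 2 : ℝ) / circleMap 0 R θ))) := by
  obtain ⟨M, hM0, hM, -⟩ := exists_norm_le_on_circle hR hf
  obtain ⟨C, hC0, hC⟩ := exists_norm_recipGammaCoeff_le ‖s‖
  have hR' : ((R / 2 : ℝ) : ℂ) ≠ 0 := by exact_mod_cast (half_pos hR).ne'
  have hq : ∀ θ, ‖((R / 2 : ℝ) : ℂ) / circleMap 0 R θ‖ ≤ 1 / 2 := fun θ => by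
    rw [norm_div, norm_circleMap_zero, abs_of_pos hR, Complex.norm_real,
      Real.norm_of_nonneg (by positivity)]
    exact le_of_eq (by field_simp)
  have hcont : Continuous fun θ => f (circleMap 0 R θ) :=
    hf.comp_continuous (continuous_circleMap 0 R) fun θ => by simp [abs_of_pos hR]
  have hcont2 : Continuous fun θ => ((R / 2 : ℝ) : ℂ) / circleMap 0 R θ :=
    continuous_const.div (continuous_circleMap 0 R) fun θ => circleMap_ne_center hR.ne'
  have key := intervalIntegral.hasSum_integral_of_dominated_convergence
    (μ := volume) (a := 0) (b := 2 * Real.pi)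
    (F := fun m θ => f (circleMap 0 R θ) * ((2 * Real.pi : ℂ)⁻¹ * (R / 2 : ℝ) ^ s *
      (recipGammaCoeff m s * ((R / 2 : ℝ) / circleMap 0 R θ) ^ m)))
    (f := fun θ => f (circleMap 0 R θ) * ((2 * Real.pi : ℂ)⁻¹ * (R / 2 : ℝ) ^ s *
        recipGammaSeries s ((R / 2 : ℝ) / circleMap 0 R θ)))
    (fun m _ => M * (‖(2 * Real.pi : ℂ)⁻¹ * (R / 2 : ℝ) ^ s‖ * (C * (1 / 2) ^ m)))
    (fun m => (hcont.mul (continuous_const.mul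
      (continuous_const.mul (hcont2.pow m)))).aestronglyMeasurable)
    (fun m => Eventually.of_forall fun θ _ => by
      rw [norm_mul, norm_mul _ (recipGammaCoeff m s * _)]
      gcongr
      · exact hM θ
      · exact norm_recipGammaCoeff_mul_pow_le (hq θ) (hC s le_rfl m))
    (Eventually.of_forall fun θ _ =>
      ((summable_geometric_two.mul_left C).mul_left _).mul_left M)
    intervalIntegrable_const
    (Eventually.of_forall fun θ _ =>
      ((summable_recipGammaSeries s (hq θ)).hasSum.mul_left _).mul_left _)
  refine key.congr_term fun m => ?_
  rw [taylorCoeff, Complex.cpow_add _ _ hR', Complex.cpow_natCast, ← mul_assoc,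
    ← intervalIntegral.integral_const_mul]
  refine intervalIntegral.integral_congr fun θ _ => ?_
  simp only [inv_pow, div_eq_mul_inv]
  ring

theorem hasSum_segment_part (hR : 0 < R) (hf : DifferentiableOn ℂ f (Metric.closedBall 0 R))
    {s : ℂ} (hs : 0 < s.re) :
    HasSum (fun m => recipGammaCoeff m s * ((R / 2 : ℝ) : ℂ) ^ (s + m) * taylorCoeff f R m)
      (∫ y in (0 : ℝ)..R / 2, f y * ((y : ℂ) ^ (s - 1) * (Complex.Gamma s)⁻¹)) := by
  obtain ⟨M, hM0, -, hM⟩ := exists_norm_le_on_circle hR hf.continuousOn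
  have hR2 : (0 : ℝ) ≤ R / 2 := (half_pos hR).le
  have hint : IntervalIntegrable (fun y : ℝ => (y : ℂ) ^ (s - 1)) volume 0 (R / 2) :=
    intervalIntegral.intervalIntegrable_cpow' (by simpa using hs)
  have key := intervalIntegral.hasSum_integral_of_dominated_convergence
    (μ := volume) (a := 0) (b := R / 2)
    (F := fun m (y : ℝ) => taylorCoeff f R m * (y : ℂ) ^ m *
      ((y : ℂ) ^ (s - 1) * (Complex.Gamma s)⁻¹))
    (f := fun y : ℝ => f y * ((y : ℂ) ^ (s - 1) * (Complex.Gamma s)⁻¹))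
    (fun m y => M * (1 / 2) ^ m * ‖(y : ℂ) ^ (s - 1) * (Complex.Gamma s)⁻¹‖)
    (fun m => (((Complex.measurable_ofReal.pow_const m).const_mul _).mul
      ((Complex.measurable_ofReal.pow_const (s - 1)).mul_const _)).aestronglyMeasurable)
    (fun m => Eventually.of_forall fun y hy => by
      rw [uIoc_of_le hR2] at hy
      rw [norm_mul, norm_mul, norm_pow, Complex.norm_real, Real.norm_of_nonneg hy.1.le]
      refine mul_le_mul_of_nonneg_right ?_ (norm_nonneg _)
      calc ‖taylorCoeff f R m‖ * y ^ m ≤ (M * R⁻¹ ^ m) * (R / 2) ^ m := by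
            exact mul_le_mul (hM m) (pow_le_pow_left₀ hy.1.le hy.2 m) (pow_nonneg hy.1.le _)
              ((norm_nonneg _).trans (hM m))
        _ = M * (1 / 2) ^ m := by
            rw [mul_assoc, ← mul_pow]; congr 2; field_simp)
    (Eventually.of_forall fun y _ => (summable_geometric_two.mul_left M).mul_right _)
    (by
      simp only [tsum_mul_right]
      exact ((hint.mul_const _).norm).const_mul _)
    (Eventually.of_forall fun y hy => by
      rw [uIoc_of_le hR2] at hy
      refine HasSum.mul_right _ (hasSum_taylorCoeff hf ?_)
      rw [Complex.norm_real, Real.norm_of_nonneg hy.1.le]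
      linarith [hy.2])
  refine key.congr_term fun m => ?_
  have hsm : s + m ≠ 0 := fun h => by
    have := congrArg Complex.re h
    simp only [Complex.add_re, Complex.natCast_re, Complex.zero_re] at this
    have : (0 : ℝ) ≤ m := m.cast_nonneg
    linarith
  have hI : ∫ y in (0 : ℝ)..R / 2, (y : ℂ) ^ (s + m - 1) = ((R / 2 : ℝ) : ℂ) ^ (s + m) / (s + m) := by
    rw [integral_cpow (Or.inl (by
      simp only [Complex.sub_re, Complex.add_re, Complex.natCast_re, Complex.one_re]
      have : (0 : ℝ) ≤ m := m.cast_nonneg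
      linarith))]
    simp [Complex.zero_cpow hsm]
  have h2 : ∫ y in (0 : ℝ)..R / 2, taylorCoeff f R m * (y : ℂ) ^ m *
      ((y : ℂ) ^ (s - 1) * (Complex.Gamma s)⁻¹) =
      ∫ y in (0 : ℝ)..R / 2, taylorCoeff f R m * (Complex.Gamma s)⁻¹ * (y : ℂ) ^ (s + m - 1) := by
    refine intervalIntegral.integral_congr_ae (Eventually.of_forall fun y hy => ?_)
    rw [uIoc_of_le hR2] at hy
    have hy0 : (y : ℂ) ≠ 0 := by exact_mod_cast hy.1.ne'
    rw [show s + m - 1 = s - 1 + m by ring, Complex.cpow_add _ _ hy0, Complex.cpow_natCast]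
    ring
  -- Here `1 / Γ(s)` is rewritten as `recipGammaCoeff m s * (s + m)` to cancel the denominator
  -- created by integrating the power.
  rw [h2, intervalIntegral.integral_const_mul, hI, ← recipGammaCoeff_mul m s]
  field_simp

end

/-- For `Re s > 0` the regularised Mellin transform is the Mellin integral. -/
theorem integral_contour_mellinKernel {R c : ℝ} (hR : 0 < R) (hc : 0 < c) {s : ℂ} (hs : 0 < s.re)
    {f : ℂ → ℂ} (hf : DifferentiableOn ℂ f (stadium (2 * R)))
    (hb : ∃ C, ∀ x ∈ stadium (2 * R), ‖f x‖ ≤ C * Real.exp (-c * x.re)) :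
    ∫ y, f (contour R y) * mellinKernel R s y = ∫ y, f (max y 0 : ℝ) *
      (Ioi 0).indicator (fun y : ℝ => (y : ℂ) ^ (s - 1) * (Complex.Gamma s)⁻¹) y := by
  have hball : Metric.closedBall (0 : ℂ) R ⊆ stadium (2 * R) := fun x hx =>
    mem_stadium_of_norm_lt (by rw [mem_closedBall_zero_iff] at hx; linarith)
  have hfb := hf.mono hball
  have hS := isOpen_stadium (2 * R)
  have hi1 := (isPathWeight_contour_mellinKernel hR hc s).integrable_comp hS hf.continuousOn hb
  have hi2 := (isPathWeight_halfLine (ρ := 2 * R) (by linarith) hc hs).integrable_comp hS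
    hf.continuousOn hb
  set B : ℝ → ℂ := fun y => f y * ((y : ℂ) ^ (s - 1) * (Complex.Gamma s)⁻¹) with hB
  have hr : (fun y => f (max y 0 : ℝ) *
      (Ioi 0).indicator (fun y : ℝ => (y : ℂ) ^ (s - 1) * (Complex.Gamma s)⁻¹) y) =
      (Ioi 0).indicator B := by
    funext y
    by_cases hy : y ∈ Ioi (0 : ℝ)
    · simp [hB, indicator_of_mem hy, max_eq_left (mem_Ioi.1 hy).le]
    · simp [indicator_of_notMem hy]
  have hiB : IntegrableOn B (Ioi 0) := by
    rw [hr] at hi2; exact (integrable_indicator_iff measurableSet_Ioi).1 hi2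
  -- Only the piece up to `R / 2`, inside the disc where the Taylor series converges geometrically,
  -- is traded for the circle; the rest is common to both sides.
  have hIoi : Ioi (0 : ℝ) = Ioc 0 (R / 2) ∪ Ioi (R / 2) :=
    (Ioc_union_Ioi_eq_Ioi (half_pos hR).le).symm
  rw [hr, integral_indicator measurableSet_Ioi, hIoi, setIntegral_union Ioc_disjoint_Ioi_same
    measurableSet_Ioi (hiB.mono_set (by rw [hIoi]; exact subset_union_left))
    (hiB.mono_set (by rw [hIoi]; exact subset_union_right)),
    ← intervalIntegral.integral_of_le (half_pos hR).le]
  rw [(hasSum_segment_part hR hfb hs).unique (hasSum_circle_part hR hfb.continuousOn s),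
    ← integral_indicator_contour R fun w => f w * ((2 * Real.pi : ℂ)⁻¹ * (R / 2 : ℝ) ^ s *
      recipGammaSeries s ((R / 2 : ℝ) / w)), ← integral_indicator measurableSet_Ioi,
    ← integral_add]
  · refine integral_congr_ae (Eventually.of_forall fun y => ?_)
    by_cases h1 : y ∈ Ioo (-(2 * Real.pi)) 0
    · have h2 : y ∉ Ioi (R / 2) := fun h => by
        have := mem_Ioi.1 h; linarith [h1.2]
      simp only [mellinKernel, if_pos h1, indicator_of_mem h1, indicator_of_notMem h2, add_zero]
    · by_cases h2 : R / 2 < y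
      · have : 0 ≤ y := by linarith
        simp only [mellinKernel, if_neg h1, indicator_of_notMem h1, if_pos h2,
          indicator_of_mem (mem_Ioi.2 h2), zero_add, hB, contour_of_nonneg this]
      · simp only [mellinKernel, if_neg h1, indicator_of_notMem h1, if_neg h2,
          indicator_of_notMem (notMem_Ioi.2 (not_lt.1 h2)), mul_zero, add_zero]
  · refine (hi1.indicator (measurableSet_Ioo (a := -(2 * Real.pi)) (b := (0 : ℝ)))).congr
      (Eventually.of_forall fun y => ?_)
    by_cases h1 : y ∈ Ioo (-(2 * Real.pi)) 0
    · simp only [mellinKernel, if_pos h1, indicator_of_mem h1]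
    · simp only [indicator_of_notMem h1]
  · exact (integrable_indicator_iff measurableSet_Ioi).2
      (hiB.mono_set (Ioi_subset_Ioi (half_pos hR).le))

/-- Cauchy's formula, as an integral along the contour. -/
theorem integral_contour_cauchy {R : ℝ} {f : ℂ → ℂ}
    (hf : DifferentiableOn ℂ f (stadium (2 * R))) {t : ℂ} (ht : ‖t‖ < R) :
    ∫ y, f (contour R y) * (Ioo (-(2 * Real.pi)) 0).indicator
      (fun y => (2 * Real.pi : ℂ)⁻¹ * (contour R y / (contour R y - t))) y =
      ∫ y, f t * (Ioo (0 : ℝ) 1).indicator 1 y := by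
  have hR : 0 < R := (norm_nonneg t).trans_lt ht
  have hball : Metric.closedBall (0 : ℂ) R ⊆ stadium (2 * R) := fun x hx =>
    mem_stadium_of_norm_lt (by rw [mem_closedBall_zero_iff] at hx; linarith)
  have h1 := (hf.mono hball).circleIntegral_sub_inv_smul (by simpa using ht)
  have h2 := integral_indicator_contour R
    (fun w => f w * ((2 * Real.pi : ℂ)⁻¹ * (w / (w - t))))
  rw [integral_const_mul, integral_indicator measurableSet_Ioo]
  trans ∫ y, (Ioo (-(2 * Real.pi)) 0).indicator (fun y => f (contour R y) *
      ((2 * Real.pi : ℂ)⁻¹ * (contour R y / (contour R y - t)))) y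
  · refine integral_congr_ae (Eventually.of_forall fun y => ?_)
    simp only [indicator_mul_right]
  have hne : (2 * Real.pi * Complex.I : ℂ) ≠ 0 := by simp [Real.pi_ne_zero]
  rw [h2]
  simp only [Pi.one_apply, setIntegral_const, measureReal_def, Real.volume_Ioo, sub_zero,
    ENNReal.ofReal_one, ENNReal.toReal_one, one_smul, mul_one]
  rw [← mul_right_inj' hne, ← smul_eq_mul _ (f t), ← h1, circleIntegral,
    ← intervalIntegral.integral_const_mul]
  refine intervalIntegral.integral_congr fun θ _ => ?_
  have hpi : (Real.pi : ℂ) ≠ 0 := by exact_mod_cast Real.pi_ne_zero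
  simp only [deriv_circleMap, smul_eq_mul]
  field_simp

end

/-! ### The regularised Mellin transform in several variables -/

section

theorem differentiableOn_fun_prod {E ι : Type*} [NormedAddCommGroup E] [NormedSpace ℂ E]
    {U : Set E} {u : Finset ι} {f : ι → E → ℂ} (hf : ∀ i ∈ u, DifferentiableOn ℂ (f i) U) :
    DifferentiableOn ℂ (fun p => ∏ i ∈ u, f i p) U := by
  classical
  induction u using Finset.induction_on with
  | empty => simp
  | insert i u hi ih =>
    simp only [Finset.prod_insert hi]
    exact (hf i (Finset.mem_insert_self _ _)).mul
      (ih fun j hj => hf j (Finset.mem_insert_of_mem hj))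

/-- The regularised Mellin transform `∏ 1 / Γ(s_j) ∫ ∏ t_j ^ (s_j - 1) F(t) dt`, as an integral over
a product of contours. -/
def regMellin (R : ℝ) {n : ℕ} (F : (Fin n → ℂ) → ℂ) (s : Fin n → ℂ) : ℂ :=
  ∫ y : Fin n → ℝ, F (fun j => contour R (y j)) * ∏ j, mellinKernel R (s j) (y j)

section

variable {R c : ℝ} {n : ℕ}

/-- The majorant `g` depends on `c`, `R`, `n` and the bound for the exponents, but not on `F`. The
same `g` therefore serves whole families of kernels and the dominated convergence arguments. -/
theorem exists_norm_regMellin_integrand_le (hR : 0 < R) (hc : 0 < c) (n : ℕ) (A : ℝ) :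
    ∃ g : (Fin n → ℝ) → ℝ, Integrable g ∧ (∀ y, 0 ≤ g y) ∧
      ∀ (s : Fin n → ℂ), (∀ j, ‖s j‖ ≤ A) → ∀ (F : (Fin n → ℂ) → ℂ) (C : ℝ), 0 ≤ C →
        (∀ x : Fin n → ℂ, (∀ j, x j ∈ stadium (2 * R)) →
          ‖F x‖ ≤ C * ∏ j, Real.exp (-c * (x j).re)) →
        ∀ y : Fin n → ℝ, ‖F (fun j => contour R (y j)) * ∏ j, mellinKernel R (s j) (y j)‖ ≤
          C * g y := by
  obtain ⟨K, hK, hb⟩ := exists_norm_mellinKernel_mul_exp_le hR hc A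
  refine ⟨fun y => ∏ j, (K * Real.exp (-(c / 2) * |y j|)), ?_,
    fun y => Finset.prod_nonneg fun j _ => by positivity, ?_⟩
  · exact Integrable.fintype_prod (f := fun (_ : Fin n) y => K * Real.exp (-(c / 2) * |y|))
      fun _ => (integrable_exp_neg_mul_abs (half_pos hc)).const_mul K
  · intro s hs F C hC hF y
    refine (IsDecaying.norm_comp_mul_le (hF _ fun j => contour_mem_stadium hR (y j))).trans ?_
    exact mul_le_mul_of_nonneg_left
      (Finset.prod_le_prod (fun j _ => by positivity) fun j _ => hb _ (hs j) _) hC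

theorem exists_norm_regMellin_le (hR : 0 < R) (hc : 0 < c) (n : ℕ) (A : ℝ) :
    ∃ K, 0 ≤ K ∧ ∀ (s : Fin n → ℂ), (∀ j, ‖s j‖ ≤ A) → ∀ (F : (Fin n → ℂ) → ℂ) (C : ℝ), 0 ≤ C →
        (∀ x : Fin n → ℂ, (∀ j, x j ∈ stadium (2 * R)) →
          ‖F x‖ ≤ C * ∏ j, Real.exp (-c * (x j).re)) →
        ‖regMellin R F s‖ ≤ C * K := by
  obtain ⟨g, hg, hg0, hb⟩ := exists_norm_regMellin_integrand_le hR hc n A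
  refine ⟨∫ y, g y, integral_nonneg hg0, fun s hs F C hC hF => ?_⟩
  rw [← integral_const_mul]
  exact norm_integral_le_of_norm_le (hg.const_mul C) (Eventually.of_forall (hb s hs F C hC hF))

theorem measurable_regMellin_integrand (hR : 0 < R) {F : (Fin n → ℂ) → ℂ}
    (hF : ContinuousOn F (univ.pi fun _ => stadium (2 * R))) (s : Fin n → ℂ) :
    Measurable fun y : Fin n → ℝ =>
      F (fun j => contour R (y j)) * ∏ j, mellinKernel R (s j) (y j) :=
  (measurable_comp_path (isOpen_stadium _) hF (fun _ => measurable_contour R)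
    fun _ => contour_mem_stadium hR).mul
    (Finset.measurable_prod _ fun j _ =>
      (measurable_mellinKernel hR (s j)).comp (measurable_pi_apply j))

/-- The regularised Mellin transform is holomorphic in the exponents and in parameters. -/
theorem differentiableOn_regMellin {E : Type*} [NormedAddCommGroup E] [NormedSpace ℂ E]
    [FiniteDimensional ℂ E] (hR : 0 < R) (hc : 0 < c) {U : Set E} (hU : IsOpen U)
    {G : E → (Fin n → ℂ) → ℂ}
    (hd : ∀ x : Fin n → ℂ, (∀ j, x j ∈ stadium (2 * R)) → DifferentiableOn ℂ (fun p => G p x) U)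
    (hcont : ∀ p ∈ U, ContinuousOn (G p) (univ.pi fun _ => stadium (2 * R)))
    (hb : ∀ p ∈ U, ∃ V ∈ 𝓝 p, ∃ C, ∀ q ∈ V, ∀ x : Fin n → ℂ, (∀ j, x j ∈ stadium (2 * R)) →
      ‖G q x‖ ≤ C * ∏ j, Real.exp (-c * (x j).re)) :
    DifferentiableOn ℂ (fun p : (Fin n → ℂ) × E => regMellin R (G p.2) p.1) (univ ×ˢ U) := by
  refine differentiableOn_integral_of_dominated (isOpen_univ.prod hU) (fun p hp => ?_)
    (fun y => ?_) fun p hp => ?_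
  · exact (measurable_regMellin_integrand hR (hcont _ hp.2) _).aestronglyMeasurable
  · refine DifferentiableOn.mul ?_ (differentiableOn_fun_prod fun j _ =>
      Differentiable.differentiableOn ?_)
    · exact (hd _ fun j => contour_mem_stadium hR (y j)).comp differentiableOn_snd fun p hp => hp.2
    · have h : Differentiable ℂ fun p : (Fin n → ℂ) × E => p.1 j := by fun_prop
      exact (differentiable_mellinKernel hR (y j)).comp h
  · obtain ⟨V, hV, C, hC⟩ := hb p.2 hp.2
    obtain ⟨g, hg, hg0, hgb⟩ := exists_norm_regMellin_integrand_le hR hc n (‖p.1‖ + 1)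
    refine ⟨Metric.ball p.1 1 ×ˢ V, prod_mem_nhds (Metric.ball_mem_nhds _ one_pos) hV,
      fun y => max C 0 * g y, hg.const_mul _, fun q hq y => ?_⟩
    refine hgb q.1 (fun j => ?_) (G q.2) _ (le_max_right _ _) (fun x hx => ?_) y
    · have h1 : ‖q.1 - p.1‖ < 1 := by simpa [dist_eq_norm] using hq.1
      calc ‖q.1 j‖ ≤ ‖q.1‖ := norm_le_pi_norm _ j
        _ ≤ ‖p.1‖ + ‖q.1 - p.1‖ := norm_le_insert' _ _
        _ ≤ _ := by linarith
    · refine (hC q.2 hq.2 x hx).trans ?_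
      gcongr
      exact le_max_left _ _

/-- For `Re s > 0` this is Euler's integral for `Γ(s)`; both sides are entire in `s`, so it persists
for all `s`. It is the source of the denominators of the polylogarithm. -/
theorem integral_exp_contour_mellinKernel (hR : 0 < R) {l : ℝ} (hl : 0 < l) (s : ℂ) :
    ∫ y, Complex.exp (-l * contour R y) * mellinKernel R s y = (l : ℂ) ^ (-s) := by
  have hexp : ∀ x : ℂ, ‖Complex.exp (-l * x)‖ = Real.exp (-l * x.re) := fun x => by
    rw [Complex.norm_exp]; simp
  have hl' : (l : ℂ) ≠ 0 := by exact_mod_cast hl.ne'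
  have hd1 : DifferentiableOn ℂ
      (fun s : ℂ => ∫ y, Complex.exp (-l * contour R y) * mellinKernel R s y) univ := by
    refine differentiableOn_integral_of_dominated isOpen_univ (fun s _ => ?_) (fun y => ?_)
      fun s _ => ?_
    · exact ((Complex.measurable_exp.comp ((measurable_contour R).const_mul _)).mul
        (measurable_mellinKernel hR s)).aestronglyMeasurable
    · exact ((differentiable_mellinKernel hR y).const_mul _).differentiableOn
    · obtain ⟨K, hK, hb⟩ := exists_norm_mellinKernel_mul_exp_le hR hl (‖s‖ + 1)
      refine ⟨Metric.ball s 1, Metric.ball_mem_nhds _ one_pos, _,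
        (integrable_exp_neg_mul_abs (half_pos hl)).const_mul K, fun q hq y => ?_⟩
      rw [norm_mul, hexp, mul_comm]
      refine hb q ?_ y
      have h1 : ‖q - s‖ < 1 := by simpa [dist_eq_norm] using hq
      calc ‖q‖ ≤ ‖s‖ + ‖q - s‖ := norm_le_insert' _ _
        _ ≤ _ := by linarith
  have hd2 : DifferentiableOn ℂ (fun s : ℂ => (l : ℂ) ^ (-s)) univ :=
    Differentiable.differentiableOn fun s => (differentiableAt_id.neg).const_cpow (Or.inl hl')
  refine eqOn_of_starConvex_of_eventuallyEq (p₀ := (1 : ℂ)) isOpen_univ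
    (convex_univ.starConvex (mem_univ _)) hd1 hd2 ?_ (mem_univ s)
  have hopen : IsOpen {s : ℂ | 0 < s.re} := isOpen_lt continuous_const Complex.continuous_re
  filter_upwards [hopen.mem_nhds (show (1 : ℂ) ∈ {s : ℂ | 0 < s.re} by simp)] with s hs
  rw [integral_contour_mellinKernel (f := fun x => Complex.exp (-l * x)) hR hl hs
    (by fun_prop) ⟨1, fun x _ => by rw [hexp, one_mul]⟩]
  trans ∫ y in Ioi (0 : ℝ), (y : ℂ) ^ (s - 1) * Complex.exp (-(l * y)) * (Complex.Gamma s)⁻¹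
  · rw [← integral_indicator measurableSet_Ioi]
    refine integral_congr_ae (Eventually.of_forall fun y => ?_)
    by_cases hy : y ∈ Ioi (0 : ℝ)
    · simp only [indicator_of_mem hy, max_eq_left (mem_Ioi.1 hy).le]
      ring_nf
    · simp only [indicator_of_notMem hy, mul_zero]
  · have hG : Complex.Gamma s ≠ 0 := Complex.Gamma_ne_zero_of_re_pos hs
    rw [integral_mul_const, Complex.integral_cpow_mul_exp_neg_mul_Ioi hs hl,
      mul_inv_cancel_right₀ hG, one_div, Complex.inv_cpow _ _ (by
        rw [Complex.arg_ofReal_of_nonneg hl.le]; exact Real.pi_pos.ne), Complex.cpow_neg]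

theorem regMellin_exp (hR : 0 < R) {l : Fin n → ℝ} (hl : ∀ j, 0 < l j) (s : Fin n → ℂ) :
    regMellin R (fun x => ∏ j, Complex.exp (-l j * x j)) s = ∏ j, (l j : ℂ) ^ (-s j) := by
  simp only [regMellin, ← Finset.prod_mul_distrib]
  rw [integral_fintype_prod_volume_eq_prod
    (fun j y => Complex.exp (-l j * contour R y) * mellinKernel R (s j) y)]
  simp only [integral_exp_contour_mellinKernel hR (hl _)]

/-- For `Re s_j > 0` the regularised Mellin transform is the Mellin integral. -/
theorem regMellin_eq_integral (hR : 0 < R) (hc : 0 < c) {F : (Fin n → ℂ) → ℂ}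
    (hF : IsDecaying (stadium (2 * R)) c F) {s : Fin n → ℂ} (hs : ∀ j, 0 < (s j).re) :
    IntegrableOn (fun t : Fin n → ℝ => F (fun j => t j) * ∏ j, (t j : ℂ) ^ (s j - 1))
      (openOrthant n) ∧
    regMellin R F s = (∏ j, 1 / Complex.Gamma (s j)) *
      ∫ t in openOrthant n, F (fun j => t j) * ∏ j, (t j : ℂ) ^ (s j - 1) := by
  have hR2 : 0 < 2 * R := by linarith
  have hS := isOpen_stadium (2 * R)
  have hmeas : MeasurableSet (openOrthant n) :=
    MeasurableSet.univ_pi fun _ => measurableSet_Ioi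
  have hw := fun j => isPathWeight_halfLine (ρ := 2 * R) hR2 hc (hs j)
  have hi := hF.integrable hS hw
  have hG : ∏ j, Complex.Gamma (s j) ≠ 0 :=
    Finset.prod_ne_zero_iff.2 fun j _ => Complex.Gamma_ne_zero_of_re_pos (hs j)
  have hfun : (fun y : Fin n → ℝ => F (fun j => (max (y j) 0 : ℝ)) * ∏ j,
      (Ioi (0 : ℝ)).indicator (fun y : ℝ => (y : ℂ) ^ (s j - 1) * (Complex.Gamma (s j))⁻¹) (y j)) =
      (openOrthant n).indicator fun t => (∏ j, Complex.Gamma (s j))⁻¹ *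
        (F (fun j => t j) * ∏ j, (t j : ℂ) ^ (s j - 1)) := by
    funext y
    by_cases hy : y ∈ openOrthant n
    · have hy' : ∀ j, 0 < y j := fun j => hy j (mem_univ j)
      rw [indicator_of_mem hy]
      simp only [indicator_of_mem (mem_Ioi.2 (hy' _)), max_eq_left (hy' _).le,
        Finset.prod_mul_distrib, Finset.prod_inv_distrib]
      ring
    · rw [indicator_of_notMem hy]
      obtain ⟨j, hj⟩ : ∃ j, y j ∉ Ioi (0 : ℝ) := by
        simpa [openOrthant] using hy
      rw [Finset.prod_eq_zero (Finset.mem_univ j) (indicator_of_notMem hj _), mul_zero]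
  constructor
  · rw [hfun, integrable_indicator_iff hmeas] at hi
    have := hi.const_mul (∏ j, Complex.Gamma (s j))
    simp only [mul_inv_cancel_left₀ hG] at this
    exact this
  · have := hF.integral_congr hS
      (fun j => isPathWeight_contour_mellinKernel hR hc (s j)) hw
      (fun j f hf hb => integral_contour_mellinKernel hR hc (hs j) hf hb)
    rw [regMellin, this, hfun, integral_indicator hmeas, integral_const_mul]
    simp only [one_div, Finset.prod_inv_distrib]

/-- The Taylor coefficient at the origin, as an integral over a torus. -/
def torusCoeff (R : ℝ) {n : ℕ} (F : (Fin n → ℂ) → ℂ) (m : Fin n → ℕ) : ℂ :=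
  ∫ y : Fin n → ℝ, F (fun j => contour R (y j)) * ∏ j, (Ioo (-(2 * Real.pi)) 0).indicator
    (fun y => (2 * Real.pi : ℂ)⁻¹ * (contour R y)⁻¹ ^ m j) (y j)

/-- At non-positive integers the regularised Mellin transform is a Taylor coefficient. -/
theorem regMellin_neg_natCast (hR : 0 < R) (F : (Fin n → ℂ) → ℂ) (m : Fin n → ℕ) :
    regMellin R F (fun j => -(m j : ℂ)) =
      (∏ j, ((-1) ^ m j * ((m j).factorial : ℂ))) * torusCoeff R F m := by
  rw [regMellin, torusCoeff, ← integral_const_mul]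
  refine integral_congr_ae (Eventually.of_forall fun y => ?_)
  simp only [mellinKernel_neg_natCast hR]
  rw [mul_left_comm, ← Finset.prod_mul_distrib]
  congr 1
  refine Finset.prod_congr rfl fun j _ => ?_
  by_cases hy : y j ∈ Ioo (-(2 * Real.pi)) 0
  · simp only [indicator_of_mem hy]; ring
  · simp only [indicator_of_notMem hy, mul_zero]

/-- Cauchy's formula on the torus, with each factor `w / (w - t)` expanded as a geometric series in
`t / w`. It comes from the one-variable formula by swapping each Cauchy weight for the point mass at
`t_j`. -/
theorem hasSum_torusCoeff {F : (Fin n → ℂ) → ℂ}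
    (hF : IsDecaying (stadium (2 * R)) c F) (hR : 0 < R) {t : Fin n → ℂ} (ht : ∀ j, ‖t j‖ < R) :
    HasSum (fun m : Fin n → ℕ => torusCoeff R F m * ∏ j, t j ^ m j) (F t) := by
  have hS := isOpen_stadium (2 * R)
  have hw := fun j => isPathWeight_contour_cauchy (c := c) hR (ht j)
  -- At `t = 0` the Cauchy weight is the constant density `1 / 2π` on one turn; it supplies the
  -- integrable majorant.
  have hw0 := fun _ : Fin n => isPathWeight_contour_cauchy (c := c) (t := 0) hR (by simpa using hR)
  have hi0 := hF.integrable hS hw0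
  have hcauchy := hF.integral_congr hS hw
    (fun j => isPathWeight_const (t := t j)
      (mem_stadium_of_norm_lt ((ht j).trans (by linarith))))
    (fun j f hf _ => integral_contour_cauchy hf (ht j))
  have hFt : ∫ y : Fin n → ℝ, F (fun j => t j) * ∏ j, (Ioo (0 : ℝ) 1).indicator 1 (y j) = F t := by
    rw [integral_const_mul, integral_fintype_prod_volume_eq_prod
      (fun (_ : Fin n) (y : ℝ) => (Ioo (0 : ℝ) 1).indicator (1 : ℝ → ℂ) y)]
    have : ∫ y : ℝ, (Ioo (0 : ℝ) 1).indicator (1 : ℝ → ℂ) y = 1 := by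
      rw [integral_indicator measurableSet_Ioo]; simp [measureReal_def]
    simp [this]
  rw [hFt] at hcauchy
  rw [← hcauchy]
  simp only [torusCoeff, ← integral_mul_const]
  have hterm : ∀ (m : Fin n → ℕ) (y : Fin n → ℝ),
      F (fun j => contour R (y j)) * (∏ j, (Ioo (-(2 * Real.pi)) 0).indicator
        (fun y => (2 * Real.pi : ℂ)⁻¹ * (contour R y)⁻¹ ^ m j) (y j)) * ∏ j, t j ^ m j =
      F (fun j => contour R (y j)) * ∏ j, ((Ioo (-(2 * Real.pi)) 0).indicator
        (fun y => (2 * Real.pi : ℂ)⁻¹ * (contour R y / (contour R y - 0))) (y j) *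
          (t j / contour R (y j)) ^ m j) := by
    intro m y
    rw [mul_assoc, ← Finset.prod_mul_distrib]
    congr 1
    refine Finset.prod_congr rfl fun j _ => ?_
    by_cases hy : y j ∈ Ioo (-(2 * Real.pi)) 0
    · have := contour_ne_zero_of_neg hR hy.2
      simp only [indicator_of_mem hy, sub_zero, div_self this, div_pow, inv_pow]
      ring
    · simp only [indicator_of_notMem hy, zero_mul]
  simp only [hterm]
  have hratio : ∀ j, ‖t j‖ / R < 1 := fun j => (div_lt_one hR).2 (ht j)
  have hratio0 : ∀ j, 0 ≤ ‖t j‖ / R := fun j => by positivity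
  have hgeom := (hasSum_pi_prod (n := n) (g := fun j m => (((‖t j‖ / R : ℝ) : ℂ)) ^ m)
    fun j => by
      simpa using summable_geometric_of_lt_one (hratio0 j) (hratio j)).1
  have hgeom' : Summable fun m : Fin n → ℕ => ∏ j, (‖t j‖ / R) ^ m j := by
    refine hgeom.congr fun m => ?_
    simp only [norm_prod, norm_pow, Complex.norm_real, Real.norm_of_nonneg (hratio0 _)]
  have hnorm : ∀ (j : Fin n) (m : ℕ) (y : ℝ), ‖(Ioo (-(2 * Real.pi)) 0).indicator
        (fun y => (2 * Real.pi : ℂ)⁻¹ * (contour R y / (contour R y - 0))) y *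
          (t j / contour R y) ^ m‖ ≤ ‖(Ioo (-(2 * Real.pi)) 0).indicator
        (fun y => (2 * Real.pi : ℂ)⁻¹ * (contour R y / (contour R y - 0))) y‖ *
          (‖t j‖ / R) ^ m := by
    intro j m y
    by_cases hy : y ∈ Ioo (-(2 * Real.pi)) 0
    · rw [norm_mul, norm_pow, norm_div, norm_contour_of_neg hR hy.2]
    · simp only [indicator_of_notMem hy, zero_mul, norm_zero, le_refl]
  refine hasSum_integral_of_dominated_convergence
    (fun m y => ‖F (fun j => contour R (y j)) * ∏ j, (Ioo (-(2 * Real.pi)) 0).indicator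
        (fun y => (2 * Real.pi : ℂ)⁻¹ * (contour R y / (contour R y - 0))) (y j)‖ *
        ∏ j, (‖t j‖ / R) ^ m j) ?_ ?_ ?_ ?_ ?_
  · intro m
    refine ((measurable_comp_path hS hF.differentiableOn.continuousOn
      (fun j => (hw j).measurable_path) fun j => (hw j).mem).mul
      (Finset.measurable_prod _ fun j _ => ?_)).aestronglyMeasurable
    exact ((hw0 j).measurable_density.comp (measurable_pi_apply j)).mul
      ((((measurable_contour R).comp (measurable_pi_apply j)).const_div _).pow_const _)
  · refine fun m => Eventually.of_forall fun y => ?_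
    rw [norm_mul, norm_mul, norm_prod, norm_prod, mul_assoc, ← Finset.prod_mul_distrib]
    gcongr with j
    exact hnorm j _ _
  · exact Eventually.of_forall fun y => hgeom'.mul_left _
  · simp only [tsum_mul_left]
    exact hi0.norm.mul_const _
  · refine Eventually.of_forall fun y => HasSum.mul_left _ ?_
    have hs : ∀ j : Fin n, HasSum (fun m : ℕ => (Ioo (-(2 * Real.pi)) 0).indicator
        (fun y => (2 * Real.pi : ℂ)⁻¹ * (contour R y / (contour R y - 0))) (y j) *
          (t j / contour R (y j)) ^ m) ((Ioo (-(2 * Real.pi)) 0).indicator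
        (fun y => (2 * Real.pi : ℂ)⁻¹ * (contour R y / (contour R y - t j))) (y j)) := by
      intro j
      by_cases hy : y j ∈ Ioo (-(2 * Real.pi)) 0
      · have h0 := contour_ne_zero_of_neg hR hy.2
        have h1 : ‖t j / contour R (y j)‖ < 1 := by
          rw [norm_div, norm_contour_of_neg hR hy.2]; exact hratio j
        have h2 := (hasSum_geometric_of_norm_lt_one h1).mul_left (2 * Real.pi : ℂ)⁻¹
        simp only [indicator_of_mem hy, sub_zero, div_self h0, mul_one]
        rw [one_sub_div h0, inv_div] at h2
        exact h2
      · simp only [indicator_of_notMem hy, zero_mul]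
        exact hasSum_zero
    have := (hasSum_pi_prod (n := n) (g := fun j (m : ℕ) => (Ioo (-(2 * Real.pi)) 0).indicator
        (fun y => (2 * Real.pi : ℂ)⁻¹ * (contour R y / (contour R y - 0))) (y j) *
          (t j / contour R (y j)) ^ m) fun j => (hs j).summable.norm).2
    simpa only [(hs _).tsum_eq] using this

end

end

/-! ### Sectors and the continuation of the polylogarithm -/

section

/-- A compact sector containing `exp (-x)` for `x` near the half-line `[0, ∞)`. -/
def sector (η : ℝ) : Set ℂ := {q | ‖q‖ ≤ 1 + η ∧ |q.im| ≤ η * q.re}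

theorem isCompact_sector (η : ℝ) : IsCompact (sector η) := by
  refine (isCompact_closedBall (0 : ℂ) (1 + η)).of_isClosed_subset ?_ fun q hq => by
    simpa using hq.1
  exact (isClosed_le continuous_norm continuous_const).inter
    (isClosed_le (continuous_abs.comp Complex.continuous_im)
      (continuous_const.mul Complex.continuous_re))

theorem smul_mem_sector {η x : ℝ} {q : ℂ} (hx : 0 ≤ x) (hx1 : x ≤ 1) (hq : q ∈ sector η) :
    x • q ∈ sector η := by
  obtain ⟨h1, h2⟩ := hq
  constructor
  · rw [norm_smul, Real.norm_of_nonneg hx]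
    exact (mul_le_of_le_one_left (norm_nonneg _) hx1).trans h1
  · rw [Complex.smul_im, Complex.smul_re, smul_eq_mul, smul_eq_mul, abs_mul, abs_of_nonneg hx]
    nlinarith

theorem re_nonneg_of_mem_sector {η : ℝ} (h0 : 0 < η) {q : ℂ} (hq : q ∈ sector η) : 0 ≤ q.re :=
  nonneg_of_mul_nonneg_right ((abs_nonneg _).trans hq.2) h0

/-- Writing `x = ξ + w` with `ξ ≥ 0` and `w` small, `exp (-w)` is within `η / 2` of `1`, hence in
the sector, and multiplication by `exp (-ξ) ∈ (0, 1]` preserves it. -/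
theorem exp_neg_mem_sector {ρ η : ℝ} (hη : η ≤ 1) (hρ : 4 * ρ ≤ η) {x : ℂ}
    (hx : x ∈ stadium ρ) : Complex.exp (-x) ∈ sector η := by
  obtain ⟨ξ, hξ, hw⟩ := hx
  set w := x - ξ with hwdef
  have hsplit : Complex.exp (-x) = Real.exp (-ξ) • Complex.exp (-w) := by
    rw [Complex.real_smul, Complex.ofReal_exp, ← Complex.exp_add, hwdef]
    congr 1; push_cast; ring
  rw [hsplit]
  refine smul_mem_sector (Real.exp_pos _).le (by simpa using hξ) ?_
  have h1 : ‖Complex.exp (-w) - 1‖ ≤ η / 2 := by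
    calc _ ≤ 2 * ‖-w‖ := Complex.norm_exp_sub_one_le (by rw [norm_neg]; linarith)
      _ ≤ _ := by rw [norm_neg]; linarith
  have hre := (Complex.abs_re_le_norm _).trans h1
  have him := (Complex.abs_im_le_norm _).trans h1
  simp only [Complex.sub_re, Complex.sub_im, Complex.one_re, Complex.one_im, sub_zero] at hre him
  have hre' := (abs_le.1 hre).1
  have hη0 : 0 ≤ η := by linarith [norm_nonneg (Complex.exp (-w) - 1)]
  constructor
  · calc ‖Complex.exp (-w)‖ = ‖1 + (Complex.exp (-w) - 1)‖ := by congr 1; ring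
      _ ≤ ‖(1 : ℂ)‖ + ‖Complex.exp (-w) - 1‖ := norm_add_le _ _
      _ ≤ 1 + η := by rw [norm_one]; linarith
  · nlinarith

section

variable {r : ℕ}

theorem tailSum_mem_stadium {ρ : ℝ} (hρ : 0 ≤ ρ) {x : Fin r → ℂ} (hx : ∀ j, x j ∈ stadium ρ)
    (j : Fin r) : tailSum x j ∈ stadium (r * ρ) := by
  choose ξ hξ hw using hx
  refine ⟨∑ i ∈ Finset.Ici j, ξ i, Finset.sum_nonneg fun i _ => hξ i, ?_⟩
  rw [tailSum, Complex.ofReal_sum, ← Finset.sum_sub_distrib]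
  calc _ ≤ ∑ i ∈ Finset.Ici j, ‖x i - ξ i‖ := norm_sum_le _ _
    _ < ∑ i ∈ Finset.Ici j, ρ := Finset.sum_lt_sum_of_nonempty ⟨j, Finset.mem_Ici.2 le_rfl⟩
      fun i _ => hw i
    _ ≤ r * ρ := by
      rw [Finset.sum_const, nsmul_eq_mul]
      gcongr
      exact_mod_cast (Finset.card_le_univ _).trans_eq (Fintype.card_fin r)

theorem continuous_tailSum {R : Type*} [AddCommMonoid R] [TopologicalSpace R] [ContinuousAdd R]
    (j : Fin r) : Continuous fun x : Fin r → R => tailSum x j :=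
  continuous_finsetSum _ fun i _ => continuous_apply i

theorem differentiable_tailSum (j : Fin r) :
    Differentiable ℂ fun x : Fin r → ℂ => tailSum x j := by
  unfold tailSum
  fun_prop

/-- The exchange of summation that turns tail sums of the variables into the partial sums `l_1 + ⋯ +
l_j` in the series. -/
theorem sum_mul_tailSum (l x : Fin r → ℂ) :
    ∑ j, l j * tailSum x j = ∑ j, (∑ i ∈ Finset.Iic j, l i) * x j := by
  simp only [tailSum, Finset.mul_sum, Finset.sum_mul]
  exact Finset.sum_comm' (by simp)

/-- The points `z` such that `1 - z_j q ≠ 0` for all `q` in the sector. -/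
def sectorDomain (r : ℕ) (η : ℝ) : Set (Fin r → ℂ) := {z | ∀ j, ∀ q ∈ sector η, 1 - z j * q ≠ 0}

/-- Compactness of the sector gives a positive lower bound at `z`, and the bound survives small
perturbations because the sector is bounded. -/
theorem exists_le_norm_one_sub_mul {η : ℝ} (hη : 0 < η) {z : Fin r → ℂ}
    (hz : z ∈ sectorDomain r η) : ∃ δ > 0, ∃ m > 0, ∀ w ∈ Metric.ball z δ, ∀ j, ∀ q ∈ sector η,
      m ≤ ‖1 - w j * q‖ := by
  have h1 : ∀ j, ∃ m > 0, ∀ q ∈ sector η, m ≤ ‖1 - z j * q‖ := fun j => by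
    have hne : (sector η).Nonempty := ⟨0, by simp [sector]; positivity⟩
    obtain ⟨q, hq, hmin⟩ := (isCompact_sector η).exists_isMinOn hne
      (f := fun q => ‖1 - z j * q‖) (by fun_prop)
    exact ⟨_, norm_pos_iff.2 (hz j q hq), fun q' hq' => hmin hq'⟩
  choose m hm hmin using h1
  obtain ⟨m₀, hm₀, hle⟩ : ∃ m₀ > 0, ∀ j, m₀ ≤ m j := by
    rcases isEmpty_or_nonempty (Fin r) with h | h
    · exact ⟨1, one_pos, fun j => h.elim j⟩
    · obtain ⟨j, -, hj⟩ := Finset.exists_min_image Finset.univ m Finset.univ_nonempty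
      exact ⟨m j, hm j, fun i => hj i (Finset.mem_univ i)⟩
  refine ⟨m₀ / (2 * (1 + η)), by positivity, m₀ / 2, by positivity, fun w hw j q hq => ?_⟩
  have h2 : ‖w j - z j‖ < m₀ / (2 * (1 + η)) := by
    rw [Metric.mem_ball, dist_eq_norm] at hw
    exact (norm_le_pi_norm (w - z) j).trans_lt hw
  have h3 : ‖(w j - z j) * q‖ ≤ m₀ / 2 := by
    rw [norm_mul]
    calc _ ≤ m₀ / (2 * (1 + η)) * (1 + η) := by gcongr; exact hq.1
      _ = m₀ / 2 := by field_simp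
  have h4 : ‖1 - z j * q‖ - ‖(w j - z j) * q‖ ≤ ‖(1 - z j * q) - (w j - z j) * q‖ :=
    norm_sub_norm_le _ _
  rw [show (1 - z j * q) - (w j - z j) * q = 1 - w j * q by ring] at h4
  linarith [hmin j q hq, hle j]

theorem isOpen_sectorDomain {η : ℝ} (hη : 0 < η) : IsOpen (sectorDomain r η) := by
  refine Metric.isOpen_iff.2 fun z hz => ?_
  obtain ⟨δ, hδ, m, hm, h⟩ := exists_le_norm_one_sub_mul hη hz
  exact ⟨δ, hδ, fun w hw j q hq => norm_pos_iff.1 (hm.trans_le (h w hw j q hq))⟩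

theorem starConvex_sectorDomain (η : ℝ) : StarConvex ℝ 0 (sectorDomain r η) := by
  intro z hz x y hx hy hxy j q hq
  have := hz j _ (smul_mem_sector hy (by linarith) hq)
  simpa [mul_left_comm, mul_assoc] using this

theorem mem_sectorDomain_of_norm_lt {η : ℝ} {z : Fin r → ℂ}
    (hz : ∀ j, ‖z j‖ * (1 + η) < 1) : z ∈ sectorDomain r η := by
  intro j q hq h
  have h1 : ‖z j * q‖ < 1 := by
    rw [norm_mul]
    exact (mul_le_mul_of_nonneg_left hq.1 (norm_nonneg _)).trans_lt (hz j)
  rw [sub_eq_zero] at h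
  rw [← h, norm_one] at h1
  exact lt_irrefl _ h1

/-- If `z_j` is not in `[1, ∞)`, then `1 - z_j q` has no zero on the segment `[0, 1]`, hence none on
a neighbourhood of it, and thin sectors lie in that neighbourhood. -/
theorem exists_mem_sectorDomain {z : Fin r → ℂ} (hz : ∀ j, 1 - z j ∈ Complex.slitPlane) :
    ∃ η, 0 < η ∧ η ≤ 1 ∧ z ∈ sectorDomain r η := by
  have hK : IsCompact ((fun x : ℝ => (x : ℂ)) '' Icc 0 1) :=
    isCompact_Icc.image Complex.continuous_ofReal
  have hU : IsOpen {q : ℂ | ∀ j, 1 - z j * q ≠ 0} := by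
    simp only [ofPred_forall]
    exact isOpen_iInter_of_finite fun j => isOpen_ne_fun (by fun_prop) continuous_const
  have hKU : (fun x : ℝ => (x : ℂ)) '' Icc 0 1 ⊆ {q : ℂ | ∀ j, 1 - z j * q ≠ 0} := by
    rintro _ ⟨c, hc, rfl⟩ j h
    have hc0 : c ≠ 0 := by rintro rfl; simp at h
    have hcpos : 0 < c := lt_of_le_of_ne hc.1 (Ne.symm hc0)
    have hzj : z j = ((c⁻¹ : ℝ) : ℂ) := by
      rw [Complex.ofReal_inv]
      exact eq_inv_of_mul_eq_one_left (sub_eq_zero.1 h).symm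
    have h1 := hz j
    rw [hzj, ← Complex.ofReal_one, ← Complex.ofReal_sub, Complex.ofReal_mem_slitPlane] at h1
    have := (one_le_inv₀ hcpos).2 hc.2
    linarith
  obtain ⟨δ, hδ, hsub⟩ := hK.exists_cthickening_subset_open hU hKU
  -- A sector point is within `η` of `[0, 1]` in real part and `2 η` in imaginary part, hence the
  -- factor `3`.
  refine ⟨min 1 (δ / 3), by positivity, min_le_left _ _, fun j q hq => ?_⟩
  have hη0 : 0 < min 1 (δ / 3) := by positivity
  set η := min 1 (δ / 3)
  have hη1 : η ≤ 1 := min_le_left _ _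
  have hη2 : η ≤ δ / 3 := min_le_right _ _
  have hre := re_nonneg_of_mem_sector hη0 hq
  have hre1 : q.re ≤ 1 + η := (Complex.re_le_norm q).trans hq.1
  refine hsub (Metric.mem_cthickening_of_dist_le q ((min q.re 1 : ℝ) : ℂ) δ _
    ⟨_, ⟨le_min hre zero_le_one, min_le_right _ _⟩, rfl⟩ ?_) j
  rw [dist_eq_norm]
  refine (Complex.norm_le_abs_re_add_abs_im _).trans ?_
  simp only [Complex.sub_re, Complex.sub_im, Complex.ofReal_re, Complex.ofReal_im, sub_zero]
  have h1 : |q.re - min q.re 1| ≤ η := by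
    rw [abs_of_nonneg (sub_nonneg.2 (min_le_left _ _))]
    rcases min_cases q.re 1 with h | h <;> linarith
  have h2 : |q.im| ≤ η * 2 := hq.2.trans (by gcongr; linarith)
  linarith

/-- The Laplace-type kernel `∏ q_j ^ b_j / (1 - z_j q_j)`, `q_j = exp (-(x_j + ⋯ + x_r))`, whose
Mellin transform is the polylogarithm divided by `∏ z_j ^ b_j`. -/
def polylogKernel (b : Fin r → ℕ) (z x : Fin r → ℂ) : ℂ :=
  ∏ j, Complex.exp (-tailSum x j) ^ b j / (1 - z j * Complex.exp (-tailSum x j))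

theorem exp_neg_tailSum_mem_sector [NeZero r] {η : ℝ} (hη : 0 < η) (hη1 : η ≤ 1) {x : Fin r → ℂ}
    (hx : ∀ j, x j ∈ stadium (2 * (η / (8 * r)))) (j : Fin r) :
    Complex.exp (-tailSum x j) ∈ sector η := by
  have hr : (0 : ℝ) < r := by exact_mod_cast NeZero.pos r
  refine exp_neg_mem_sector hη1 ?_ (tailSum_mem_stadium (by positivity) hx j)
  exact le_of_eq (by field_simp; norm_num)

theorem norm_exp_neg_tailSum_zero [NeZero r] (x : Fin r → ℂ) :
    ‖Complex.exp (-tailSum x 0)‖ = ∏ j, Real.exp (-1 * (x j).re) := by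
  rw [Complex.norm_exp, ← Real.exp_sum, tailSum, show Finset.Ici (0 : Fin r) = Finset.univ by
    ext j; simp]
  simp

/-- One factor `q 0` is kept because its exponent is the sum of all variables, so it alone gives
decay in every direction; all other factors are merely bounded by `2`. -/
theorem prod_norm_pow_le [NeZero r] {η : ℝ} (hη1 : η ≤ 1) {b : Fin r → ℕ} (hb : 1 ≤ b 0)
    {q : Fin r → ℂ} (hq : ∀ j, q j ∈ sector η) :
    ∏ j, ‖q j‖ ^ b j ≤ 2 ^ (∑ j, b j) * ‖q 0‖ := by
  have hq2 : ∀ j, ‖q j‖ ≤ 2 := fun j => (hq j).1.trans (by linarith)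
  calc ∏ j, ‖q j‖ ^ b j ≤ ∏ j, (2 ^ b j * if j = 0 then ‖q 0‖ else 1) := by
        refine Finset.prod_le_prod (fun j _ => by positivity) fun j _ => ?_
        split_ifs with h
        · subst h
          obtain ⟨k, hk⟩ := Nat.exists_eq_add_of_le' hb
          rw [hk, pow_succ]
          have h1 : ‖q 0‖ ^ k ≤ 2 ^ (k + 1) :=
            (pow_le_pow_left₀ (norm_nonneg _) (hq2 0) k).trans
              (pow_le_pow_right₀ one_le_two (Nat.le_succ k))
          gcongr
        · rw [mul_one]
          exact pow_le_pow_left₀ (norm_nonneg _) (hq2 j) _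
    _ = _ := by
        rw [Finset.prod_mul_distrib, Finset.prod_pow_eq_pow_sum, Finset.prod_ite_eq']
        simp

theorem norm_polylogKernel_le [NeZero r] {η m : ℝ} (hη : 0 < η) (hη1 : η ≤ 1) {b : Fin r → ℕ}
    (hb : 1 ≤ b 0) {z x : Fin r → ℂ} (hm : 0 < m)
    (hz : ∀ j, ∀ q ∈ sector η, m ≤ ‖1 - z j * q‖) (hx : ∀ j, x j ∈ stadium (2 * (η / (8 * r)))) :
    ‖polylogKernel b z x‖ ≤ 2 ^ (∑ j, b j) / m ^ r * ∏ j, Real.exp (-1 * (x j).re) := by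
  have hq := exp_neg_tailSum_mem_sector hη hη1 hx
  rw [polylogKernel, Finset.prod_div_distrib, norm_div, norm_prod, norm_prod,
    ← norm_exp_neg_tailSum_zero]
  simp only [norm_pow]
  have h2 : m ^ r ≤ ∏ j, ‖1 - z j * Complex.exp (-tailSum x j)‖ := by
    calc m ^ r = ∏ _j : Fin r, m := by simp
      _ ≤ _ := Finset.prod_le_prod (fun _ _ => hm.le) fun j _ => hz j _ (hq j)
  rw [div_mul_eq_mul_div]
  exact div_le_div₀ (by positivity) (prod_norm_pow_le hη1 hb hq) (by positivity) h2

/-- The polylogarithm divided by `∏ z_j ^ b_j`, on the domain attached to a sector. -/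
def sectorPolylog (η : ℝ) (b : Fin r → ℕ) (u z : Fin r → ℂ) : ℂ :=
  regMellin (η / (8 * r)) (polylogKernel b z) u

theorem differentiableOn_sectorPolylog [NeZero r] {η : ℝ} (hη : 0 < η) (hη1 : η ≤ 1)
    {b : Fin r → ℕ} (hb : 1 ≤ b 0) :
    DifferentiableOn ℂ (fun p : (Fin r → ℂ) × (Fin r → ℂ) => sectorPolylog η b p.1 p.2)
      (univ ×ˢ sectorDomain r η) := by
  have hr : (0 : ℝ) < r := by exact_mod_cast NeZero.pos r
  have hR : 0 < η / (8 * r) := by positivity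
  refine differentiableOn_regMellin hR one_pos (isOpen_sectorDomain hη) (fun x hx => ?_)
    (fun z hz => ?_) fun z hz => ?_
  · refine differentiableOn_fun_prod fun j _ => ?_
    have hd : Differentiable ℂ fun z : Fin r → ℂ => 1 - z j * Complex.exp (-tailSum x j) := by
      fun_prop
    simp only [div_eq_mul_inv]
    have hne : MapsTo (fun z : Fin r → ℂ => 1 - z j * Complex.exp (-tailSum x j))
        (sectorDomain r η) {w | w ≠ 0} := fun z hz =>
      hz j _ (exp_neg_tailSum_mem_sector hη hη1 hx j)
    exact (differentiableOn_inv.comp hd.differentiableOn hne).const_mul _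
  · refine continuousOn_finsetProd _ fun j _ => ?_
    have hc := continuous_tailSum (R := ℂ) j
    exact ContinuousOn.div (by fun_prop) (by fun_prop)
      fun x hx => hz j _ (exp_neg_tailSum_mem_sector hη hη1 (fun j => hx j (mem_univ j)) j)
  · obtain ⟨δ, hδ, m, hm, h⟩ := exists_le_norm_one_sub_mul hη hz
    exact ⟨_, Metric.ball_mem_nhds z hδ, _, fun w hw x hx =>
      norm_polylogKernel_le hη hη1 hb hm (h w hw) hx⟩

theorem prod_exp_neg_tailSum_pow (l : Fin r → ℕ) (x : Fin r → ℂ) :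
    ∏ j, Complex.exp (-tailSum x j) ^ l j =
      ∏ j, Complex.exp (-((∑ i ∈ Finset.Iic j, l i : ℕ) : ℝ) * x j) := by
  simp only [← Complex.exp_nat_mul, ← Complex.exp_sum]
  congr 1
  have := sum_mul_tailSum (fun j => (l j : ℂ)) x
  simp only [mul_neg, neg_mul, Finset.sum_neg_distrib, this]
  simp

/-- The normalised polylogarithm has the expected power series. -/
theorem hasSum_sectorPolylog [NeZero r] {η : ℝ} (hη : 0 < η) (hη1 : η ≤ 1) {b : Fin r → ℕ}
    (hb : 1 ≤ b 0) (u : Fin r → ℂ) {z : Fin r → ℂ} (hz : ∀ j, ‖z j‖ * (1 + η) < 1) :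
    HasSum (fun m : Fin r → ℕ => (∏ j, z j ^ m j) /
        ∏ j, ((∑ i ∈ Finset.Iic j, (b i + m i) : ℕ) : ℂ) ^ u j)
      (sectorPolylog η b u z) := by
  have hr : (0 : ℝ) < r := by exact_mod_cast NeZero.pos r
  have hR : 0 < η / (8 * r) := by positivity
  set R := η / (8 * r) with hRdef
  have hpos : ∀ (m : Fin r → ℕ) (j : Fin r), 0 < ∑ i ∈ Finset.Iic j, (b i + m i) := fun m j =>
    (show 0 < b 0 + m 0 by omega).trans_le
      (Finset.single_le_sum (f := fun i => b i + m i) (fun i _ => Nat.zero_le _) (by simp))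
  have hgeom : Summable fun m : Fin r → ℕ => ∏ j, (‖z j‖ * (1 + η)) ^ m j := by
    have h0 : ∀ j, 0 ≤ ‖z j‖ * (1 + η) := fun j => by positivity
    have := (hasSum_pi_prod (n := r) (g := fun j m => (((‖z j‖ * (1 + η) : ℝ) : ℂ)) ^ m)
      fun j => by
        simp only [norm_pow, Complex.norm_real, Real.norm_of_nonneg (h0 j)]
        exact summable_geometric_of_lt_one (h0 j) (hz j)).1
    refine this.congr fun m => ?_
    simp only [norm_prod, norm_pow, Complex.norm_real, Real.norm_of_nonneg (h0 _)]
  -- Dominated convergence along the contours: there `|q_j| ≤ 1 + η`, which is why the condition on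
  -- `z` carries that factor.
  obtain ⟨g, hg, hg0, hgb⟩ := exists_norm_regMellin_integrand_le hR one_pos r ‖u‖
  have hterm : ∀ m : Fin r → ℕ, (∏ j, z j ^ m j) /
        ∏ j, ((∑ i ∈ Finset.Iic j, (b i + m i) : ℕ) : ℂ) ^ u j =
      regMellin R (fun x => (∏ j, z j ^ m j) *
        ∏ j, Complex.exp (-tailSum x j) ^ (b j + m j)) u := by
    intro m
    have h1 := regMellin_exp hR (l := fun j => ((∑ i ∈ Finset.Iic j, (b i + m i) : ℕ) : ℝ))
      (fun j => by exact_mod_cast hpos m j) u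
    simp only [prod_exp_neg_tailSum_pow]
    rw [regMellin] at h1 ⊢
    simp only [mul_assoc (∏ j, z j ^ m j), integral_const_mul]
    rw [h1, div_eq_mul_inv, ← Finset.prod_inv_distrib]
    simp only [Complex.cpow_neg, Complex.ofReal_natCast]
  refine HasSum.congr_term ?_ hterm
  refine hasSum_integral_of_dominated_convergence
    (fun m y => 2 ^ (∑ j, b j) * (∏ j, (‖z j‖ * (1 + η)) ^ m j) * g y) ?_ ?_ ?_ ?_ ?_
  · intro m
    refine (measurable_regMellin_integrand hR (F := fun x => (∏ j, z j ^ m j) *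
      ∏ j, Complex.exp (-tailSum x j) ^ (b j + m j))
      (Continuous.continuousOn ?_) u).aestronglyMeasurable
    have hc := fun j => continuous_tailSum (r := r) (R := ℂ) j
    fun_prop
  · refine fun m => Eventually.of_forall fun y => ?_
    refine hgb u (fun j => norm_le_pi_norm u j) (fun x => (∏ j, z j ^ m j) *
      ∏ j, Complex.exp (-tailSum x j) ^ (b j + m j)) _ (by positivity) (fun x hx => ?_) y
    have hq := exp_neg_tailSum_mem_sector hη hη1 hx
    rw [norm_mul, norm_prod, norm_prod, ← norm_exp_neg_tailSum_zero]
    simp only [norm_mul, norm_pow, pow_add, Finset.prod_mul_distrib, mul_pow]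
    calc _ = (∏ j, ‖Complex.exp (-tailSum x j)‖ ^ b j) * ((∏ j, ‖z j‖ ^ m j) *
          ∏ j, ‖Complex.exp (-tailSum x j)‖ ^ m j) := by ring
      _ ≤ (2 ^ (∑ j, b j) * ‖Complex.exp (-tailSum x 0)‖) * ((∏ j, ‖z j‖ ^ m j) *
          ∏ j, (1 + η) ^ m j) := by
        refine mul_le_mul (prod_norm_pow_le hη1 hb hq) ?_ (by positivity) (by positivity)
        gcongr with j
        exact (hq j).1
      _ = _ := by ring
  · exact Eventually.of_forall fun y => (hgeom.mul_left _).mul_right _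
  · simp only [tsum_mul_right]
    exact hg.const_mul _
  · refine Eventually.of_forall fun y => HasSum.mul_right _ ?_
    set x := fun j => contour R (y j)
    have hq := exp_neg_tailSum_mem_sector hη hη1 (x := x) fun j => contour_mem_stadium hR _
    have hlt : ∀ j, ‖z j * Complex.exp (-tailSum x j)‖ < 1 := fun j => by
      rw [norm_mul]
      exact (mul_le_mul_of_nonneg_left (hq j).1 (norm_nonneg _)).trans_lt (hz j)
    have hs := (hasSum_pi_prod (n := r)
      (g := fun j m => (z j * Complex.exp (-tailSum x j)) ^ m) fun j => by
        simpa only [norm_pow] using summable_geometric_of_lt_one (norm_nonneg _) (hlt j)).2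
    have hs2 := hs.mul_left (∏ j, Complex.exp (-tailSum x j) ^ b j)
    simp only [tsum_geometric_of_norm_lt_one (hlt _), ← Finset.prod_mul_distrib,
      ← div_eq_mul_inv] at hs2
    refine hs2.congr_term fun m => ?_
    dsimp only
    rw [← Finset.prod_mul_distrib]
    refine Finset.prod_congr rfl fun j _ => ?_
    rw [pow_add, mul_pow]; ring

/-- Both functions have the same power series near `0`, and the intersection of the two domains is
star-shaped about `0`. This makes the gluing in `normPolylog` independent of the chosen sector. -/
theorem sectorPolylog_eq [NeZero r] {η η' : ℝ} (hη : 0 < η) (hη1 : η ≤ 1) (hη' : 0 < η')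
    (hη1' : η' ≤ 1) {b : Fin r → ℕ} (hb : 1 ≤ b 0) (u : Fin r → ℂ) {z : Fin r → ℂ}
    (hz : z ∈ sectorDomain r η) (hz' : z ∈ sectorDomain r η') :
    sectorPolylog η b u z = sectorPolylog η' b u z := by
  have hslice : ∀ η, 0 < η → η ≤ 1 →
      DifferentiableOn ℂ (sectorPolylog η b u) (sectorDomain r η) := fun η hη hη1 =>
    (differentiableOn_sectorPolylog hη hη1 hb).comp (f := fun z => (u, z))
      ((differentiable_const u).prodMk differentiable_id).differentiableOn
      fun z hz => ⟨mem_univ _, hz⟩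
  have hopen := (isOpen_sectorDomain (r := r) hη).inter (isOpen_sectorDomain hη')
  refine eqOn_of_starConvex_of_eventuallyEq hopen
    ((starConvex_sectorDomain η).inter (starConvex_sectorDomain η'))
    ((hslice η hη hη1).mono inter_subset_left) ((hslice η' hη' hη1').mono inter_subset_right)
    ?_ ⟨hz, hz'⟩
  have hball : ∀ᶠ z : Fin r → ℂ in 𝓝 0, ‖z‖ < 1 / 2 := by
    filter_upwards [Metric.ball_mem_nhds (0 : Fin r → ℂ) (show (0 : ℝ) < 1 / 2 by norm_num)]
      with z hz
    simpa using hz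
  filter_upwards [hball] with z hz
  have hlt : ∀ η, 0 < η → η ≤ 1 → ∀ j, ‖z j‖ * (1 + η) < 1 := fun η h0 h1 j => by
    have := (norm_le_pi_norm z j).trans_lt hz
    nlinarith [norm_nonneg (z j)]
  exact (hasSum_sectorPolylog hη hη1 hb u (hlt η hη hη1)).unique
    (hasSum_sectorPolylog hη' hη1' hb u (hlt η' hη' hη1'))

open Classical in
/-- The polylogarithm divided by `∏ z_j ^ b_j`, continued to `ℂ^r × (ℂ ∖ ℝ_{≥ 1})^r`. -/
def normPolylog (b : Fin r → ℕ) (u z : Fin r → ℂ) : ℂ :=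
  if h : ∀ j, 1 - z j ∈ Complex.slitPlane then
    sectorPolylog (exists_mem_sectorDomain h).choose b u z else 0

theorem mem_slitPlane_of_mem_sectorDomain {η : ℝ} (hη : 0 < η) {z : Fin r → ℂ}
    (hz : z ∈ sectorDomain r η) (j : Fin r) : 1 - z j ∈ Complex.slitPlane := by
  by_contra h
  rw [Complex.mem_slitPlane_iff, not_or, not_lt, not_not] at h
  simp only [Complex.sub_re, Complex.one_re, Complex.sub_im, Complex.one_im, zero_sub,
    neg_eq_zero] at h
  have hre : 1 ≤ (z j).re := by linarith [h.1]
  have hzj : z j = ((z j).re : ℂ) := Complex.ext rfl (by simp [h.2])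
  have hpos : 0 < (z j).re := by linarith
  refine hz j (((z j).re⁻¹ : ℝ) : ℂ) ⟨?_, ?_⟩ ?_
  · rw [Complex.norm_real, Real.norm_of_nonneg (by positivity)]
    linarith [inv_le_one_of_one_le₀ hre]
  · simp only [Complex.ofReal_im, abs_zero, Complex.ofReal_re]
    positivity
  · rw [hzj, ← Complex.ofReal_mul, Complex.ofReal_re, mul_inv_cancel₀ hpos.ne']
    simp

theorem normPolylog_eq [NeZero r] {η : ℝ} (hη : 0 < η) (hη1 : η ≤ 1) {b : Fin r → ℕ}
    (hb : 1 ≤ b 0) (u : Fin r → ℂ) {z : Fin r → ℂ} (hz : z ∈ sectorDomain r η) :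
    normPolylog b u z = sectorPolylog η b u z := by
  have h := mem_slitPlane_of_mem_sectorDomain hη hz
  obtain ⟨h1, h2, h3⟩ := (exists_mem_sectorDomain h).choose_spec
  rw [normPolylog, dif_pos h]
  exact sectorPolylog_eq h1 h2 hη hη1 hb u h3 hz

theorem differentiableOn_normPolylog [NeZero r] {b : Fin r → ℕ} (hb : 1 ≤ b 0) :
    DifferentiableOn ℂ (fun p : (Fin r → ℂ) × (Fin r → ℂ) => normPolylog b p.1 p.2)
      (polylogDomain r) := by
  intro p hp
  obtain ⟨η, hη, hη1, hz⟩ := exists_mem_sectorDomain hp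
  have hopen : IsOpen ((univ : Set (Fin r → ℂ)) ×ˢ sectorDomain r η) :=
    isOpen_univ.prod (isOpen_sectorDomain hη)
  have hmem : (univ : Set (Fin r → ℂ)) ×ˢ sectorDomain r η ∈ 𝓝 p :=
    hopen.mem_nhds ⟨mem_univ _, hz⟩
  have h1 := (differentiableOn_sectorPolylog hη hη1 hb).differentiableAt hmem
  refine (h1.congr_of_eventuallyEq ?_).differentiableWithinAt
  filter_upwards [hmem] with q hq
  exact normPolylog_eq hη hη1 hb q.1 hq.2

theorem hasSum_normPolylog [NeZero r] {b : Fin r → ℕ} (hb : 1 ≤ b 0) (u : Fin r → ℂ)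
    {z : Fin r → ℂ} (hz : ∀ j, ‖z j‖ < 1) :
    HasSum (fun m : Fin r → ℕ => (∏ j, z j ^ m j) /
        ∏ j, ((∑ i ∈ Finset.Iic j, (b i + m i) : ℕ) : ℂ) ^ u j) (normPolylog b u z) := by
  obtain ⟨j₀, -, hj₀⟩ := Finset.exists_max_image Finset.univ (fun j => ‖z j‖) Finset.univ_nonempty
  -- With `M = max |z_j| < 1`, the inequality `M (1 + η) < 1` amounts to `(1 - M) (2 - M) > 0`.
  set η := (1 - ‖z j₀‖) / 2 with hη
  have hη0 : 0 < η := by linarith [hz j₀]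
  have hη1 : η ≤ 1 := by linarith [norm_nonneg (z j₀)]
  have hlt : ∀ j, ‖z j‖ * (1 + η) < 1 := fun j => by
    have := hj₀ j (Finset.mem_univ j)
    nlinarith [norm_nonneg (z j), norm_nonneg (z j₀), hz j₀]
  rw [normPolylog_eq hη0 hη1 hb u (mem_sectorDomain_of_norm_lt hlt)]
  exact hasSum_sectorPolylog hη0 hη1 hb u hlt

theorem polylogSeries_eq [NeZero r] {b : Fin r → ℕ} (hb : 1 ≤ b 0) (u : Fin r → ℂ)
    {z : Fin r → ℂ} (hz : ∀ j, ‖z j‖ < 1) :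
    polylogSeries b u z = (∏ j, z j ^ b j) * normPolylog b u z := by
  rw [← ((hasSum_normPolylog hb u hz).mul_left (∏ j, z j ^ b j)).tsum_eq, polylogSeries]
  congr 1
  funext m
  simp only [pow_add, Finset.prod_mul_distrib]
  ring

theorem isPolylogContinuation_normPolylog [NeZero r] {b : Fin r → ℕ} (hb : 1 ≤ b 0) :
    IsPolylogContinuation b fun u z => (∏ j, z j ^ b j) * normPolylog b u z where
  holomorphic := by
    refine DifferentiableOn.mul ?_ (differentiableOn_normPolylog hb)
    exact differentiableOn_fun_prod fun j _ => Differentiable.differentiableOn (by fun_prop)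
  eq_series u z hz := (polylogSeries_eq hb u hz).symm

theorem polylog_eq [NeZero r] {b : Fin r → ℕ} (hb : 1 ≤ b 0) (u : Fin r → ℂ) {z : Fin r → ℂ}
    (hz : ∀ j, 1 - z j ∈ Complex.slitPlane) :
    polylog b u z = (∏ j, z j ^ b j) * normPolylog b u z :=
  (Classical.epsilon_spec ⟨_, isPolylogContinuation_normPolylog hb⟩ :
    IsPolylogContinuation b (polylog b)).unique (isPolylogContinuation_normPolylog hb)
    (p := (u, z)) hz

end

end

/-! ### The two-variable kernel `p ^ a q ^ b / (p + q - p q)` -/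

section

/-- In this sector `Re q ≥ (6 / 7) |q|` and `|q| ≤ 7 / 6`. The product costs at most `7 / 6` times
the smaller norm, leaving at least `23 / 42` of the larger one. -/
theorem half_norm_le_norm_add_sub_mul {p q : ℂ} (hp : p ∈ sector (1 / 6)) (hq : q ∈ sector (1 / 6)) :
    ‖p‖ / 2 ≤ ‖p + q - p * q‖ ∧ ‖q‖ / 2 ≤ ‖p + q - p * q‖ := by
  have hre : ∀ q ∈ sector (1 / 6), 6 / 7 * ‖q‖ ≤ q.re := fun q hq => by
    have h0 := re_nonneg_of_mem_sector (by norm_num) hq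
    have := Complex.norm_le_abs_re_add_abs_im q
    rw [abs_of_nonneg h0] at this
    linarith [hq.2]
  have h1 : p.re + q.re - ‖p‖ * ‖q‖ ≤ ‖p + q - p * q‖ := by
    rw [← norm_mul]
    have h2 := Complex.re_le_norm (p + q - p * q)
    have h3 := Complex.re_le_norm (p * q)
    simp only [Complex.sub_re, Complex.add_re] at h2
    linarith
  have hp1 := hre p hp
  have hq1 := hre q hq
  have hp2 : ‖p‖ ≤ 7 / 6 := hp.1.trans (by norm_num)
  have hq2 : ‖q‖ ≤ 7 / 6 := hq.1.trans (by norm_num)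
  have hp0 := norm_nonneg p
  have hq0 := norm_nonneg q
  rcases le_total ‖p‖ ‖q‖ with h | h
  · have : ‖p‖ * ‖q‖ ≤ ‖p‖ * (7 / 6) := by gcongr
    constructor <;> linarith
  · have : ‖p‖ * ‖q‖ ≤ 7 / 6 * ‖q‖ := by gcongr
    constructor <;> linarith

theorem pow_mul_pow_le_two_pow {x y : ℝ} (hx : 0 ≤ x) (hx2 : x ≤ 2) (hy : 0 ≤ y) (hy2 : y ≤ 2)
    {k l N : ℕ} (h : k + l ≤ N) : x ^ k * y ^ l ≤ 2 ^ N := by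
  calc x ^ k * y ^ l ≤ 2 ^ k * 2 ^ l := by gcongr
    _ = 2 ^ (k + l) := (pow_add _ _ _).symm
    _ ≤ 2 ^ N := pow_le_pow_right₀ one_le_two h

section

variable {p q : ℂ} {a b : ℕ}

/-- Common pattern of the next four bounds: one power of `p` or `q` is spent on the denominator, the
factor `Y` records any decay kept, and the remaining powers are at most `2 ^ (a + b)`. -/
theorem norm_two_variable_kernel_le_of_le {Y : ℝ} {k l : ℕ} (hp : p ∈ sector (1 / 6))
    (hq : q ∈ sector (1 / 6)) (hp0 : p ≠ 0) (hkl : k + l ≤ a + b)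
    (h : ‖p‖ ^ a * ‖q‖ ^ b ≤ ‖p‖ ^ k * ‖q‖ ^ l * (2 * ‖p + q - p * q‖ * Y)) (hY : 0 ≤ Y) :
    ‖p ^ a * q ^ b / (p + q - p * q)‖ ≤ 2 ^ (a + b + 1) * Y := by
  have hD : 0 < ‖p + q - p * q‖ :=
    (half_pos (norm_pos_iff.2 hp0)).trans_le (half_norm_le_norm_add_sub_mul hp hq).1
  have hp2 : ‖p‖ ≤ 2 := hp.1.trans (by norm_num)
  have hq2 : ‖q‖ ≤ 2 := hq.1.trans (by norm_num)
  rw [norm_div, norm_mul, norm_pow, norm_pow, div_le_iff₀ hD]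
  calc _ ≤ ‖p‖ ^ k * ‖q‖ ^ l * (2 * ‖p + q - p * q‖ * Y) := h
    _ ≤ 2 ^ (a + b) * (2 * ‖p + q - p * q‖ * Y) := by
      gcongr
      exact pow_mul_pow_le_two_pow (norm_nonneg _) hp2 (norm_nonneg _) hq2 hkl
    _ = _ := by rw [pow_succ]; ring

theorem norm_two_variable_kernel_le (hp : p ∈ sector (1 / 6)) (hq : q ∈ sector (1 / 6))
    (hp0 : p ≠ 0) (hab : 1 ≤ a + b) :
    ‖p ^ a * q ^ b / (p + q - p * q)‖ ≤ 2 ^ (a + b + 1) := by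
  obtain ⟨h1, h2⟩ := half_norm_le_norm_add_sub_mul hp hq
  rw [← mul_one ((2 : ℝ) ^ (a + b + 1))]
  rcases Nat.eq_zero_or_pos a with ha | ha
  · obtain ⟨l, rfl⟩ := Nat.exists_eq_add_of_le' (show 1 ≤ b by omega)
    refine norm_two_variable_kernel_le_of_le (k := a) (l := l) hp hq hp0 (by omega) ?_ zero_le_one
    rw [pow_succ, ← mul_assoc]
    gcongr
    linarith
  · obtain ⟨k, rfl⟩ := Nat.exists_eq_add_of_le' (show 1 ≤ a by omega)
    refine norm_two_variable_kernel_le_of_le (k := k) (l := b) hp hq hp0 (by omega) ?_ zero_le_one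
    rw [pow_succ, mul_right_comm]
    gcongr
    linarith

theorem norm_two_variable_kernel_le_div (hp : p ∈ sector (1 / 6)) (hq : q ∈ sector (1 / 6))
    (hp0 : p ≠ 0) (hb : 1 ≤ b) :
    ‖p ^ a * q ^ b / (p + q - p * q)‖ ≤ 2 ^ (a + b + 1) * (‖q‖ / ‖p‖) := by
  obtain ⟨h1, h2⟩ := half_norm_le_norm_add_sub_mul hp hq
  obtain ⟨l, rfl⟩ := Nat.exists_eq_add_of_le' hb
  have hp0' := norm_pos_iff.2 hp0
  refine norm_two_variable_kernel_le_of_le (k := a) (l := l) hp hq hp0 (by omega) ?_ (by positivity)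
  rw [pow_succ, ← mul_assoc]
  gcongr
  calc ‖q‖ = ‖p‖ * (‖q‖ / ‖p‖) := by field_simp
    _ ≤ _ := by gcongr; linarith

theorem norm_two_variable_kernel_le_left (hp : p ∈ sector (1 / 6)) (hq : q ∈ sector (1 / 6))
    (hp0 : p ≠ 0) (ha : 1 ≤ a) (hb : 1 ≤ b) :
    ‖p ^ a * q ^ b / (p + q - p * q)‖ ≤ 2 ^ (a + b + 1) * ‖p‖ := by
  obtain ⟨h1, h2⟩ := half_norm_le_norm_add_sub_mul hp hq
  obtain ⟨l, rfl⟩ := Nat.exists_eq_add_of_le' hb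
  refine norm_two_variable_kernel_le_of_le (k := a - 1) (l := l) hp hq hp0 (by omega) ?_
    (norm_nonneg _)
  obtain ⟨k, rfl⟩ := Nat.exists_eq_add_of_le' ha
  rw [Nat.add_sub_cancel, pow_succ, pow_succ,
    show ‖p‖ ^ k * ‖p‖ * (‖q‖ ^ l * ‖q‖) = ‖p‖ ^ k * ‖q‖ ^ l * (‖q‖ * ‖p‖) by ring]
  gcongr
  linarith

theorem norm_two_variable_kernel_le_right (hp : p ∈ sector (1 / 6)) (hq : q ∈ sector (1 / 6))
    (hp0 : p ≠ 0) (ha : 1 ≤ a) (hb : 1 ≤ b) :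
    ‖p ^ a * q ^ b / (p + q - p * q)‖ ≤ 2 ^ (a + b + 1) * ‖q‖ := by
  obtain ⟨h1, h2⟩ := half_norm_le_norm_add_sub_mul hp hq
  obtain ⟨l, rfl⟩ := Nat.exists_eq_add_of_le' hb
  refine norm_two_variable_kernel_le_of_le (k := a - 1) (l := l) hp hq hp0 (by omega) ?_
    (norm_nonneg _)
  obtain ⟨k, rfl⟩ := Nat.exists_eq_add_of_le' ha
  rw [Nat.add_sub_cancel, pow_succ, pow_succ,
    show ‖p‖ ^ k * ‖p‖ * (‖q‖ ^ l * ‖q‖) = ‖p‖ ^ k * ‖q‖ ^ l * (‖p‖ * ‖q‖) by ring]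
  gcongr
  linarith

end

/-! ### Decay of the kernel of `η` and its continuation -/

section

theorem ofReal_tailSum {r : ℕ} (t : Fin r → ℝ) (j : Fin r) :
    ((tailSum t j : ℝ) : ℂ) = tailSum (fun j => (t j : ℂ)) j := by
  simp [tailSum]

theorem IsEtaContinuation.unique {r : ℕ} {σ : Equiv.Perm (Fin r)} {a b : Fin r → ℕ}
    {E E' : (Fin r → ℂ) → (Fin r → ℂ) → ℂ}
    (h : IsEtaContinuation σ a b E) (h' : IsEtaContinuation σ a b E') : E = E' := by
  funext u s
  refine eqOn_of_starConvex_of_eventuallyEq (p₀ := ((1, 1) : (Fin r → ℂ) × (Fin r → ℂ)))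
    isOpen_univ (convex_univ.starConvex (mem_univ _)) h.holomorphic.differentiableOn
    h'.holomorphic.differentiableOn ?_ (mem_univ (u, s))
  have hre : ∀ᶠ v : Fin r → ℂ in 𝓝 1, ∀ j, 0 < (v j).re := by
    refine eventually_all.2 fun j => ?_
    have hc : Continuous fun v : Fin r → ℂ => (v j).re :=
      Complex.continuous_re.comp (continuous_apply j)
    exact (isOpen_lt continuous_const hc).mem_nhds (by simp)
  filter_upwards [prod_mem_nhds hre hre] with p hp
  rw [h.eq_integral p.1 p.2 hp.1 hp.2, h'.eq_integral p.1 p.2 hp.1 hp.2]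

theorem one_sub_mul_eq (T q : ℂ) : 1 - (1 - Complex.exp T) * q =
    (Complex.exp (-T) + q - Complex.exp (-T) * q) / Complex.exp (-T) := by
  rw [eq_div_iff (Complex.exp_ne_zero _), Complex.exp_neg]
  field_simp [Complex.exp_ne_zero T]
  ring

/-- The factor `exp T` of each exponential cancels against the denominator of `1 - (1 - exp T) q`.
In the result the variables `t` and `x` enter symmetrically up to `σ`. -/
theorem prod_exp_mul_polylogKernel {r : ℕ} {σ : Equiv.Perm (Fin r)} {a b : Fin r → ℕ}
    (t x : Fin r → ℂ) :
    (∏ j, Complex.exp ((1 - (a j : ℂ)) * tailSum t j)) *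
      polylogKernel b (fun j => 1 - Complex.exp (tailSum t (σ j))) x =
    ∏ j, (Complex.exp (-tailSum t (σ j)) ^ a (σ j) * Complex.exp (-tailSum x j) ^ b j /
      (Complex.exp (-tailSum t (σ j)) + Complex.exp (-tailSum x j) -
        Complex.exp (-tailSum t (σ j)) * Complex.exp (-tailSum x j))) := by
  rw [polylogKernel, ← Equiv.prod_comp σ, ← Finset.prod_mul_distrib]
  refine Finset.prod_congr rfl fun j _ => ?_
  rw [one_sub_mul_eq, div_div_eq_mul_div, ← mul_div_assoc, ← Complex.exp_nat_mul (-tailSum t (σ j)),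
    mul_comm (_ ^ b j), ← mul_assoc, ← Complex.exp_add]
  congr 3
  ring

variable {r : ℕ} [NeZero r] {σ : Equiv.Perm (Fin r)} {a b : Fin r → ℕ}

/-- Decay of the duality-symmetric kernel in both groups of variables. -/
theorem prod_norm_two_variable_kernel_le (ha : 1 ≤ a 0) (hb : 1 ≤ b 0) (hb' : 1 ≤ b (σ.symm 0))
    (hab : ∀ j, 1 ≤ a (σ j) + b j) {p q : Fin r → ℂ} (hp : ∀ j, p j ∈ sector (1 / 6))
    (hq : ∀ j, q j ∈ sector (1 / 6)) (hp0 : ∀ j, p j ≠ 0) (hle : ∀ j, ‖p 0‖ ≤ 2 * ‖p j‖)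
    {A B : ℝ} (hA : 0 ≤ A) (hB : 0 ≤ B) (hpA : ‖p 0‖ = A ^ 2) (hqB : ‖q 0‖ = B ^ 2) :
    ∏ j, ‖p (σ j) ^ a (σ j) * q j ^ b j / (p (σ j) + q j - p (σ j) * q j)‖ ≤
      (∏ j, 2 ^ (a (σ j) + b j + 1)) * 2 * (A * B) := by
  set K : ℝ := ∏ j, 2 ^ (a (σ j) + b j + 1) with hK
  have hK0 : 0 ≤ K := Finset.prod_nonneg fun j _ => by positivity
  have ha' : ∀ j, σ j = 0 → 1 ≤ a (σ j) := fun j hj => hj ▸ ha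
  have hb'' : ∀ j, σ j = 0 → 1 ≤ b j := fun j hj => by
    rwa [← σ.symm_apply_apply j, hj]
  -- Decay in `p 0` comes from the single index `j = σ⁻¹(0)`; all other factors are merely bounded.
  have h1 : ∏ j, ‖p (σ j) ^ a (σ j) * q j ^ b j / (p (σ j) + q j - p (σ j) * q j)‖ ≤
      K * A ^ 2 := by
    calc _ ≤ ∏ j, (2 ^ (a (σ j) + b j + 1) * if j = σ.symm 0 then ‖p 0‖ else 1) := by
          refine Finset.prod_le_prod (fun j _ => norm_nonneg _) fun j _ => ?_
          split_ifs with h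
          · have hj : σ j = 0 := by rw [h, σ.apply_symm_apply]
            have := norm_two_variable_kernel_le_left (hp (σ j)) (hq j) (hp0 _) (ha' j hj)
              (hb'' j hj)
            rwa [hj] at this ⊢
          · rw [mul_one]
            exact norm_two_variable_kernel_le (hp _) (hq _) (hp0 _) (hab j)
      _ = K * A ^ 2 := by
          rw [Finset.prod_mul_distrib, Finset.prod_ite_eq', if_pos (Finset.mem_univ _), hpA]
  -- Decay in `q 0` comes from the index `0`, at the price of `1 / |p (σ 0)|`. The factor `|p 0|`
  -- from the index `σ⁻¹(0)` pays for it through `hle`; if the two indices coincide, that one factor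
  -- gives `|q 0|` directly.
  have h2 : ∏ j, ‖p (σ j) ^ a (σ j) * q j ^ b j / (p (σ j) + q j - p (σ j) * q j)‖ ≤
      K * (2 * B ^ 2) := by
    calc _ ≤ ∏ j, (2 ^ (a (σ j) + b j + 1) * ((if j = σ.symm 0 then ‖p 0‖ else 1) *
          if j = 0 then ‖q 0‖ / ‖p (σ 0)‖ else 1)) := by
          refine Finset.prod_le_prod (fun j _ => norm_nonneg _) fun j _ => ?_
          split_ifs with h h' h'
          · have hj : σ j = 0 := by rw [h, σ.apply_symm_apply]
            have := norm_two_variable_kernel_le_right (hp (σ j)) (hq j) (hp0 _) (ha' j hj)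
              (hb'' j hj)
            subst h'
            rw [hj] at this ⊢
            rwa [mul_div_cancel₀ _ (norm_ne_zero_iff.2 (hp0 0))]
          · have hj : σ j = 0 := by rw [h, σ.apply_symm_apply]
            have := norm_two_variable_kernel_le_left (hp (σ j)) (hq j) (hp0 _) (ha' j hj)
              (hb'' j hj)
            rw [hj] at this ⊢
            rwa [mul_one]
          · subst h'
            rw [one_mul]
            exact norm_two_variable_kernel_le_div (hp _) (hq _) (hp0 _) hb
          · rw [mul_one, mul_one]
            exact norm_two_variable_kernel_le (hp _) (hq _) (hp0 _) (hab j)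
      _ = K * (‖p 0‖ * (‖q 0‖ / ‖p (σ 0)‖)) := by
          rw [Finset.prod_mul_distrib, Finset.prod_mul_distrib, Finset.prod_ite_eq',
            Finset.prod_ite_eq', if_pos (Finset.mem_univ _), if_pos (Finset.mem_univ _)]
      _ ≤ K * (2 * B ^ 2) := by
          have hpos := norm_pos_iff.2 (hp0 (σ 0))
          refine mul_le_mul_of_nonneg_left ?_ hK0
          calc ‖p 0‖ * (‖q 0‖ / ‖p (σ 0)‖) ≤ (2 * ‖p (σ 0)‖) * (‖q 0‖ / ‖p (σ 0)‖) := by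
                gcongr; exact hle _
            _ = 2 * B ^ 2 := by rw [hqB]; field_simp
  -- The minimum of `A ^ 2` and `2 * B ^ 2` is at most `2 * A * B`.
  rcases le_total A B with h | h
  · refine h1.trans ?_
    rw [mul_assoc]
    gcongr
    nlinarith
  · refine h2.trans ?_
    rw [mul_assoc]
    gcongr
    nlinarith

/-- The function `∏ e^{(1 - a_j) T_j} Li_u(z) / ∏ z_j ^ b_j`, with `z_j = 1 - e^{T_{σ(j)}}`. -/
def etaKernel (σ : Equiv.Perm (Fin r)) (a b : Fin r → ℕ) (u t : Fin r → ℂ) : ℂ :=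
  (∏ j, Complex.exp ((1 - (a j : ℂ)) * tailSum t j)) *
    normPolylog b u fun j => 1 - Complex.exp (tailSum t (σ j))

/-- The radius of the contours on which the continuation of `η` is defined. -/
def etaRadius (r : ℕ) : ℝ := (1 / 6) / (8 * r)

theorem etaRadius_pos (r : ℕ) [NeZero r] : 0 < etaRadius r := by
  have hr : (0 : ℝ) < r := by exact_mod_cast NeZero.pos r
  unfold etaRadius; positivity

theorem exp_neg_tailSum_mem_sector_sixth {t : Fin r → ℂ}
    (ht : ∀ j, t j ∈ stadium (2 * etaRadius r)) (j : Fin r) :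
    Complex.exp (-tailSum t j) ∈ sector (1 / 6) :=
  exp_neg_tailSum_mem_sector (by norm_num) (by norm_num) ht j

/-- By `one_sub_mul_eq` the denominators are `(p + q - p q) / p`, which cannot vanish for `p`, `q`
in the sector. Hence one fixed sector serves for all `t` near `[0, ∞)^r`. -/
theorem one_sub_exp_mem_sectorDomain {t : Fin r → ℂ} (ht : ∀ j, t j ∈ stadium (2 * etaRadius r)) :
    (fun j => 1 - Complex.exp (tailSum t (σ j))) ∈ sectorDomain r (1 / 6) := by
  intro j q hq
  have hp := exp_neg_tailSum_mem_sector_sixth ht (σ j)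
  rw [one_sub_mul_eq]
  refine div_ne_zero (norm_pos_iff.1 ?_) (Complex.exp_ne_zero _)
  exact (half_pos (norm_pos_iff.2 (Complex.exp_ne_zero _))).trans_le
    (half_norm_le_norm_add_sub_mul hp hq).1

/-- The two tail sums differ by variables whose real parts are only slightly negative at worst: in
total at least `-1 / 2`, and `exp (1 / 2) ≤ 2`. -/
theorem norm_exp_neg_tailSum_zero_le {t : Fin r → ℂ} (ht : ∀ j, t j ∈ stadium (2 * etaRadius r))
    (j : Fin r) : ‖Complex.exp (-tailSum t 0)‖ ≤ 2 * ‖Complex.exp (-tailSum t j)‖ := by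
  have hr : (0 : ℝ) < r := by exact_mod_cast NeZero.pos r
  have hpos := etaRadius_pos r
  rw [Complex.norm_exp, Complex.norm_exp]
  have h0 : tailSum t 0 = tailSum t j + ∑ i ∈ Finset.Iio j, t i := by
    rw [tailSum, tailSum, add_comm, show Finset.Ici (0 : Fin r) = Finset.univ by ext j; simp,
      ← Finset.sum_union (by
        rw [Finset.disjoint_left]; intro i; simp)]
    congr 1
    ext i; simp [lt_or_ge]
  have h1 : -(1 / 2) ≤ (∑ i ∈ Finset.Iio j, t i).re := by
    rw [Complex.re_sum]
    calc -(1 / 2 : ℝ) ≤ -(r * (2 * etaRadius r)) := by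
          unfold etaRadius; field_simp; norm_num
      _ ≤ ∑ i ∈ Finset.Iio j, -(2 * etaRadius r) := by
          rw [Finset.sum_const, nsmul_eq_mul, mul_neg, neg_le_neg_iff]
          gcongr
          exact_mod_cast (Finset.card_le_univ _).trans_eq (Fintype.card_fin r)
      _ ≤ _ := Finset.sum_le_sum fun i _ => (neg_lt_re_of_mem_stadium (ht i)).le
  have h2 : Real.exp (1 / 2) ≤ 2 := by
    have h3 : Real.exp (1 / 2) ^ 2 ≤ 2 ^ 2 := by
      rw [← Real.exp_nat_mul]
      have := Real.exp_one_lt_d9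
      norm_num at this ⊢
      linarith
    exact le_of_sq_le_sq h3 (by norm_num)
  calc Real.exp (-tailSum t 0).re ≤ Real.exp (1 / 2 + (-tailSum t j).re) := by
        rw [h0, Real.exp_le_exp]
        simp only [Complex.neg_re, Complex.add_re]
        linarith
    _ ≤ _ := by rw [Real.exp_add]; gcongr

theorem norm_prod_exp_mul_polylogKernel_le (ha : 1 ≤ a 0) (hb : 1 ≤ b 0) (hb' : 1 ≤ b (σ.symm 0))
    (hab : ∀ j, 1 ≤ a (σ j) + b j) {t x : Fin r → ℂ}
    (ht : ∀ j, t j ∈ stadium (2 * etaRadius r)) (hx : ∀ j, x j ∈ stadium (2 * etaRadius r)) :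
    ‖(∏ j, Complex.exp ((1 - (a j : ℂ)) * tailSum t j)) *
      polylogKernel b (fun j => 1 - Complex.exp (tailSum t (σ j))) x‖ ≤
    (∏ j, 2 ^ (a (σ j) + b j + 1)) * 2 * (∏ j, Real.exp (-(1 / 2) * (t j).re)) *
      ∏ j, Real.exp (-(1 / 2) * (x j).re) := by
  have hsq : ∀ t : Fin r → ℂ, ‖Complex.exp (-tailSum t 0)‖ =
      (∏ j, Real.exp (-(1 / 2) * (t j).re)) ^ 2 := fun t => by
    rw [norm_exp_neg_tailSum_zero, ← Finset.prod_pow]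
    refine Finset.prod_congr rfl fun j _ => ?_
    rw [← Real.exp_nat_mul]
    congr 1
    push_cast
    ring
  rw [prod_exp_mul_polylogKernel, norm_prod, mul_assoc]
  exact prod_norm_two_variable_kernel_le (p := fun j => Complex.exp (-tailSum t j))
    (q := fun j => Complex.exp (-tailSum x j)) ha hb hb' hab
    (exp_neg_tailSum_mem_sector_sixth ht) (exp_neg_tailSum_mem_sector_sixth hx)
    (fun j => Complex.exp_ne_zero _) (norm_exp_neg_tailSum_zero_le ht)
    (Finset.prod_nonneg fun j _ => (Real.exp_pos _).le)
    (Finset.prod_nonneg fun j _ => (Real.exp_pos _).le) (hsq t) (hsq x)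

/-- The exponential prefactor is moved inside the integral over `x`, where the joint estimate
applies. Half of the decay makes that integral converge; the half in `t` comes out as a constant. -/
theorem exists_norm_etaKernel_le (ha : 1 ≤ a 0) (hb : 1 ≤ b 0) (hb' : 1 ≤ b (σ.symm 0))
    (hab : ∀ j, 1 ≤ a (σ j) + b j) (A : ℝ) :
    ∃ C, ∀ u : Fin r → ℂ, (∀ j, ‖u j‖ ≤ A) → ∀ t : Fin r → ℂ,
      (∀ j, t j ∈ stadium (2 * etaRadius r)) →
      ‖etaKernel σ a b u t‖ ≤ C * ∏ j, Real.exp (-(1 / 2) * (t j).re) := by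
  obtain ⟨K, hK, hb2⟩ := exists_norm_regMellin_le (etaRadius_pos r)
    (show (0 : ℝ) < 1 / 2 by norm_num) r A
  refine ⟨(∏ j, 2 ^ (a (σ j) + b j + 1)) * 2 * K, fun u hu t ht => ?_⟩
  have h1 := hb2 u hu (fun x => (∏ j, Complex.exp ((1 - (a j : ℂ)) * tailSum t j)) *
      polylogKernel b (fun j => 1 - Complex.exp (tailSum t (σ j))) x) _
    (mul_nonneg (mul_nonneg (Finset.prod_nonneg fun j _ => by positivity) zero_le_two)
      (Finset.prod_nonneg fun j _ => (Real.exp_pos _).le))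
    fun x hx => norm_prod_exp_mul_polylogKernel_le ha hb hb' hab ht hx
  rw [etaKernel, normPolylog_eq (by norm_num) (by norm_num) hb u (one_sub_exp_mem_sectorDomain ht),
    sectorPolylog]
  rw [regMellin] at h1 ⊢
  simp only [mul_assoc _ (polylogKernel _ _ _), integral_const_mul] at h1
  refine h1.trans_eq ?_
  ring

theorem differentiableOn_etaKernel (hb : 1 ≤ b 0) :
    DifferentiableOn ℂ (fun p : (Fin r → ℂ) × (Fin r → ℂ) => etaKernel σ a b p.1 p.2)
      (univ ×ˢ univ.pi fun _ => stadium (2 * etaRadius r)) := by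
  have hT := fun j => differentiable_tailSum (r := r) j
  refine DifferentiableOn.mul (differentiableOn_fun_prod fun j _ =>
    Differentiable.differentiableOn ?_) ?_
  · have h : Differentiable ℂ fun p : (Fin r → ℂ) × (Fin r → ℂ) => tailSum p.2 j :=
      (hT j).comp differentiable_snd
    fun_prop
  · have hg : Differentiable ℂ fun p : (Fin r → ℂ) × (Fin r → ℂ) =>
        ((p.1, fun j => 1 - Complex.exp (tailSum p.2 (σ j))) : (Fin r → ℂ) × (Fin r → ℂ)) := by
      refine differentiable_fst.prodMk (differentiable_pi.2 fun j => ?_)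
      have h : Differentiable ℂ fun p : (Fin r → ℂ) × (Fin r → ℂ) => tailSum p.2 (σ j) :=
        (hT (σ j)).comp differentiable_snd
      fun_prop
    refine (differentiableOn_normPolylog hb).comp hg.differentiableOn fun p hp j => ?_
    exact mem_slitPlane_of_mem_sectorDomain (by norm_num)
      (one_sub_exp_mem_sectorDomain fun j => hp.2 j (mem_univ j)) j

theorem isDecaying_etaKernel (ha : 1 ≤ a 0) (hb : 1 ≤ b 0) (hb' : 1 ≤ b (σ.symm 0))
    (hab : ∀ j, 1 ≤ a (σ j) + b j) (u : Fin r → ℂ) :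
    IsDecaying (stadium (2 * etaRadius r)) (1 / 2) (etaKernel σ a b u) where
  differentiableOn := (differentiableOn_etaKernel hb).comp (f := fun t => (u, t))
    ((differentiable_const u).prodMk differentiable_id).differentiableOn
    fun t ht => ⟨mem_univ _, ht⟩
  bound := by
    obtain ⟨C, hC⟩ := exists_norm_etaKernel_le ha hb hb' hab ‖u‖
    exact ⟨C, hC u fun j => norm_le_pi_norm u j⟩

/-- The continuation of `η`. -/
def etaContinuation (σ : Equiv.Perm (Fin r)) (a b : Fin r → ℕ) (u s : Fin r → ℂ) : ℂ :=
  regMellin (etaRadius r) (etaKernel σ a b u) s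

theorem exists_nhds_norm_etaKernel_le (ha : 1 ≤ a 0) (hb : 1 ≤ b 0) (hb' : 1 ≤ b (σ.symm 0))
    (hab : ∀ j, 1 ≤ a (σ j) + b j) (u : Fin r → ℂ) :
    ∃ V ∈ 𝓝 u, ∃ C, ∀ v ∈ V, ∀ t : Fin r → ℂ, (∀ j, t j ∈ stadium (2 * etaRadius r)) →
      ‖etaKernel σ a b v t‖ ≤ C * ∏ j, Real.exp (-(1 / 2) * (t j).re) := by
  obtain ⟨C, hC⟩ := exists_norm_etaKernel_le ha hb hb' hab (‖u‖ + 1)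
  refine ⟨Metric.ball u 1, Metric.ball_mem_nhds u one_pos, C, fun v hv t ht =>
    hC v (fun j => ?_) t ht⟩
  have h1 : ‖v - u‖ < 1 := by simpa [dist_eq_norm] using hv
  calc ‖v j‖ ≤ ‖v‖ := norm_le_pi_norm _ j
    _ ≤ ‖u‖ + ‖v - u‖ := norm_le_insert' _ _
    _ ≤ _ := by linarith

theorem differentiableOn_etaContinuation_swap (ha : 1 ≤ a 0) (hb : 1 ≤ b 0)
    (hb' : 1 ≤ b (σ.symm 0)) (hab : ∀ j, 1 ≤ a (σ j) + b j) :
    DifferentiableOn ℂ (fun p : (Fin r → ℂ) × (Fin r → ℂ) => etaContinuation σ a b p.2 p.1)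
      (univ ×ˢ univ) :=
  differentiableOn_regMellin (E := Fin r → ℂ) (n := r) (c := 1 / 2) (etaRadius_pos r) one_half_pos
    isOpen_univ (G := etaKernel σ a b)
    (fun t ht => (differentiableOn_etaKernel hb).comp (f := fun u => (u, t))
      (differentiable_id.prodMk (differentiable_const t)).differentiableOn
      fun _ _ => ⟨mem_univ _, fun j _ => ht j⟩)
    (fun u _ => (isDecaying_etaKernel ha hb hb' hab u).differentiableOn.continuousOn)
    (fun u _ => exists_nhds_norm_etaKernel_le ha hb hb' hab u)

theorem differentiable_etaContinuation (ha : 1 ≤ a 0) (hb : 1 ≤ b 0) (hb' : 1 ≤ b (σ.symm 0))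
    (hab : ∀ j, 1 ≤ a (σ j) + b j) : Differentiable ℂ
      fun p : (Fin r → ℂ) × (Fin r → ℂ) => etaContinuation σ a b p.1 p.2 := by
  have h := differentiableOn_etaContinuation_swap ha hb hb' hab
  generalize etaContinuation σ a b = E at h ⊢
  rw [univ_prod_univ, differentiableOn_univ] at h
  exact Differentiable.comp (g := fun p : (Fin r → ℂ) × (Fin r → ℂ) => E p.2 p.1) h
    (differentiable_snd.prodMk differentiable_fst)

theorem etaIntegrand_eq (hb : 1 ≤ b 0) (u s : Fin r → ℂ) {t : Fin r → ℝ}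
    (ht : t ∈ openOrthant r) : etaIntegrand σ a b u s t =
      etaKernel σ a b u (fun j => t j) * ∏ j, (t j : ℂ) ^ (s j - 1) := by
  have hT : ∀ j, 0 < tailSum t j := fun j =>
    Finset.sum_pos (fun i _ => ht i (mem_univ i)) ⟨j, Finset.mem_Ici.2 le_rfl⟩
  have hne : ∀ j, (1 - Complex.exp (tailSum t (σ j) : ℝ)) ≠ 0 := fun j h => by
    rw [sub_eq_zero, ← Complex.ofReal_exp] at h
    have h' : (1 : ℝ) = Real.exp (tailSum t (σ j)) := by exact_mod_cast h
    exact absurd h' (Real.one_lt_exp_iff.2 (hT _)).ne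
  have hs : ∀ j, 1 - (1 - Complex.exp (tailSum t (σ j) : ℝ)) ∈ Complex.slitPlane := fun j => by
    rw [sub_sub_cancel, ← Complex.ofReal_exp, Complex.ofReal_mem_slitPlane]
    exact Real.exp_pos _
  rw [etaIntegrand, polylog_eq hb u hs,
    mul_div_cancel_left₀ _ (Finset.prod_ne_zero_iff.2 fun j _ => pow_ne_zero _ (hne j)),
    Finset.prod_mul_distrib, etaKernel]
  simp only [ofReal_tailSum]
  ring

theorem isEtaContinuation_etaContinuation (ha : 1 ≤ a 0) (hb : 1 ≤ b 0)
    (hb' : 1 ≤ b (σ.symm 0)) (hab : ∀ j, 1 ≤ a (σ j) + b j) :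
    IsEtaContinuation σ a b (etaContinuation σ a b) := by
  have hmeas : MeasurableSet (openOrthant r) := MeasurableSet.univ_pi fun _ => measurableSet_Ioi
  have key := fun (u s : Fin r → ℂ) (hs : ∀ j, 0 < (s j).re) =>
    regMellin_eq_integral (etaRadius_pos r) (show (0 : ℝ) < 1 / 2 by norm_num)
      (isDecaying_etaKernel ha hb hb' hab u) hs
  refine ⟨differentiable_etaContinuation ha hb hb' hab, fun u s _ hs => ?_, fun u s _ hs => ?_⟩
  · exact (key u s hs).1.congr_fun (fun t ht => (etaIntegrand_eq hb u s ht).symm) hmeas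
  · rw [etaContinuation, (key u s hs).2,
      setIntegral_congr_fun hmeas fun t ht => etaIntegrand_eq hb u s ht]

end

end

/-! ### Uniqueness of expansions and the poly-Bernoulli numbers -/

section

/-- Divide by the lowest power with non-zero coefficient and let `t → 0+`. Only positive real `t`
are used, since the generating function is constrained only where its denominators do not vanish. -/
theorem eq_zero_of_hasSum_pow_zero {d : ℕ → ℂ} {ρ : ℝ} (hρ : 0 < ρ)
    (h : ∀ t : ℝ, 0 < t → t < ρ → HasSum (fun m => d m * (t : ℂ) ^ m) 0) : d = 0 := by
  by_contra hd
  have hex : ∃ m, d m ≠ 0 := by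
    by_contra hh
    push Not at hh
    exact hd (funext hh)
  classical
  let N := Nat.find hex
  have hN : d N ≠ 0 := Nat.find_spec hex
  have hlt : ∀ m < N, d m = 0 := fun m hm => not_not.1 (Nat.find_min hex hm)
  have hs : ∀ t : ℝ, 0 < t → t < ρ → HasSum (fun m => d (m + N) * (t : ℂ) ^ m) 0 := by
    intro t ht htρ
    have h1 := (hasSum_nat_add_iff' N).2 (h t ht htρ)
    rw [Finset.sum_eq_zero fun m hm => by rw [hlt m (Finset.mem_range.1 hm), zero_mul],
      sub_zero] at h1
    have h2 := h1.mul_right ((t : ℂ) ^ N)⁻¹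
    rw [zero_mul] at h2
    have hne : (t : ℂ) ^ N ≠ 0 := pow_ne_zero _ (by exact_mod_cast ht.ne')
    refine h2.congr_term fun m => Eq.symm ?_
    rw [pow_add, ← mul_assoc, mul_inv_cancel_right₀ hne]
  let τ : ℝ := ρ / 2
  have hτ : 0 < τ := half_pos hρ
  have hsum : Summable fun m => ‖d (m + N)‖ * τ ^ m := by
    have := (hs τ hτ (half_lt_self hρ)).summable.norm
    simpa [abs_of_pos hτ] using this
  have hcont : ContinuousOn (fun t : ℝ => ∑' m, d (m + N) * (t : ℂ) ^ m) (Icc 0 τ) := by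
    refine continuousOn_tsum (fun m => by fun_prop) hsum fun m t ht => ?_
    rw [norm_mul, norm_pow, Complex.norm_real, Real.norm_of_nonneg ht.1]
    gcongr
    · exact ht.1
    · exact ht.2
  have h0 := (hcont 0 ⟨le_rfl, hτ.le⟩).tendsto.mono_left
    (nhdsWithin_mono _ (Ioc_subset_Icc_self (a := 0) (b := τ)))
  rw [tsum_eq_single 0 (fun m hm => by simp [hm])] at h0
  have h1 : Tendsto (fun t : ℝ => ∑' m, d (m + N) * (t : ℂ) ^ m) (𝓝[Ioc 0 τ] 0) (𝓝 0) := by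
    refine tendsto_const_nhds.congr' ?_
    filter_upwards [self_mem_nhdsWithin] with t ht
    exact (hs t ht.1 (ht.2.trans_lt (half_lt_self hρ))).tsum_eq.symm
  have : (𝓝[Ioc 0 τ] (0 : ℝ)).NeBot := by
    rw [nhdsWithin_Ioc_eq_nhdsGT hτ]; infer_instance
  exact hN (by simpa using tendsto_nhds_unique h0 h1)

theorem eq_zero_of_hasSum_prod_pow_zero {n : ℕ} {c : (Fin n → ℕ) → ℂ} {ρ : ℝ} (hρ : 0 < ρ)
    (h : ∀ t : Fin n → ℝ, (∀ j, 0 < t j ∧ t j < ρ) →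
      HasSum (fun m : Fin n → ℕ => c m * ∏ j, (t j : ℂ) ^ m j) 0) : c = 0 := by
  induction n with
  | zero =>
    funext m
    have h1 := h 0 (fun j => j.elim0)
    simp only [Finset.univ_eq_empty, Finset.prod_empty, mul_one] at h1
    exact (congrArg c (Subsingleton.elim _ _)).trans ((hasSum_unique c).unique h1)
  | succ n ih =>
    let e : ℕ × (Fin n → ℕ) ≃ (Fin (n + 1) → ℕ) := Fin.consEquiv (fun _ : Fin (n + 1) => ℕ)
    have key : ∀ x : ℝ, 0 < x → x < ρ → ∀ t : Fin n → ℝ, (∀ j, 0 < t j ∧ t j < ρ) →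
        HasSum (fun p : ℕ × (Fin n → ℕ) => c (e p) * ((x : ℂ) ^ p.1 * ∏ j, (t j : ℂ) ^ p.2 j))
          0 := by
      intro x hx hxρ t ht
      have h1 := h (Fin.cons x t) fun j => by
        refine Fin.cases ⟨hx, hxρ⟩ (fun j => ?_) j
        simpa using ht j
      rw [← e.hasSum_iff] at h1
      convert! h1 using 2 with p
      rw [Function.comp_apply, Fin.prod_univ_succ]
      simp [e]
    -- Summability in the last `n` variables is read off at the particular value `x = ρ / 2` and
    -- does not depend on it.
    have hfib : ∀ (m : ℕ) (t : Fin n → ℝ), (∀ j, 0 < t j ∧ t j < ρ) →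
        Summable fun q : Fin n → ℕ => c (e (m, q)) * ∏ j, (t j : ℂ) ^ q j := by
      intro m t ht
      have hx : ((ρ / 2 : ℝ) : ℂ) ^ m ≠ 0 := pow_ne_zero _ (by exact_mod_cast (half_pos hρ).ne')
      have h1 := ((key (ρ / 2) (half_pos hρ) (half_lt_self hρ) t ht).summable.prod_factor m).mul_left
        (((ρ / 2 : ℝ) : ℂ) ^ m)⁻¹
      refine h1.congr fun q => ?_
      field_simp
    have hzero : ∀ m : ℕ, (fun q => c (e (m, q))) = 0 := fun m => by
      refine ih fun t ht => ?_
      have hd : (fun m => ∑' q : Fin n → ℕ, c (e (m, q)) * ∏ j, (t j : ℂ) ^ q j) = 0 := by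
        refine eq_zero_of_hasSum_pow_zero hρ fun x hx hxρ => ?_
        refine (key x hx hxρ t ht).prod_fiberwise fun m => ?_
        convert! (hfib m t ht).hasSum.mul_right ((x : ℂ) ^ m) using 2 with q
        ring
      have h2 := (hfib m t ht).hasSum
      rwa [show ∑' q : Fin n → ℕ, c (e (m, q)) * ∏ j, (t j : ℂ) ^ q j = 0 from congrFun hd m] at h2
    funext m
    rw [← e.apply_symm_apply m]
    exact congrFun (hzero (e.symm m).1) (e.symm m).2

variable {r : ℕ} {σ : Equiv.Perm (Fin r)} {a b : Fin r → ℕ}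

/-- The poly-Bernoulli numbers as Taylor coefficients at `0` of the kernel of `η`. -/
def bernoulliCoeff (k : Fin r → ℤ) (σ : Equiv.Perm (Fin r)) (a b : Fin r → ℕ)
    (m : Fin r → ℕ) : ℂ :=
  (∏ j, ((-1) ^ m j * ((m j).factorial : ℂ))) *
    torusCoeff (etaRadius r) (etaKernel σ a b fun j => (k j : ℂ)) m

theorem tailSum_neg (t : Fin r → ℂ) (j : Fin r) : tailSum (-t) j = -tailSum t j := by
  simp [tailSum]

theorem eventually_norm_one_sub_exp_lt :
    ∀ᶠ t : Fin r → ℂ in 𝓝 0, ∀ j, ‖1 - Complex.exp (-tailSum t (σ j))‖ < 1 := by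
  refine eventually_all.2 fun j => ?_
  have hT : Continuous fun t : Fin r → ℂ => tailSum t (σ j) := continuous_tailSum _
  have hc : Continuous fun t : Fin r → ℂ => ‖1 - Complex.exp (-tailSum t (σ j))‖ := by fun_prop
  exact (isOpen_lt hc continuous_const).mem_nhds (by simp [tailSum])

/-- The sign change `t ↦ -t` turns `1 - exp (-T)` and `exp ((a_j - 1) T_j)` into the corresponding
expressions of the kernel of `η`. -/
theorem bernoulliGenFun_eq [NeZero r] (hb : 1 ≤ b 0) (k : Fin r → ℤ) {t : Fin r → ℂ}
    (ht : ∀ j, ‖1 - Complex.exp (-tailSum t (σ j))‖ < 1)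
    (hne : ∀ j, 1 - Complex.exp (-tailSum t (σ j)) ≠ 0) :
    bernoulliGenFun k σ a b t = etaKernel σ a b (fun j => (k j : ℂ)) (-t) := by
  rw [bernoulliGenFun, polylogSeries_eq hb _ ht,
    mul_div_cancel_left₀ _ (Finset.prod_ne_zero_iff.2 fun j _ => pow_ne_zero _ (hne j)), etaKernel]
  simp only [tailSum_neg]
  congr 1
  refine Finset.prod_congr rfl fun j _ => ?_
  congr 1
  ring

theorem isMultiPolyBernoulli_bernoulliCoeff [NeZero r] (ha : 1 ≤ a 0) (hb : 1 ≤ b 0)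
    (hb' : 1 ≤ b (σ.symm 0)) (hab : ∀ j, 1 ≤ a (σ j) + b j) (k : Fin r → ℤ) :
    IsMultiPolyBernoulli k σ a b (bernoulliCoeff k σ a b) := by
  have hball : ∀ᶠ t : Fin r → ℂ in 𝓝 0, ‖t‖ < etaRadius r :=
    (isOpen_lt continuous_norm continuous_const).mem_nhds (by simpa using etaRadius_pos r)
  filter_upwards [eventually_norm_one_sub_exp_lt (σ := σ), hball] with t ht ht' hne
  rw [bernoulliGenFun_eq hb k ht hne]
  have h := hasSum_torusCoeff (isDecaying_etaKernel ha hb hb' hab fun j => (k j : ℂ))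
    (etaRadius_pos r) (t := -t) fun j => (norm_le_pi_norm (-t) j).trans_lt (by rwa [norm_neg])
  refine h.congr_term fun m => Eq.symm ?_
  -- The signs `(-1) ^ m_j` from evaluating at `-t` are those produced by the values of the
  -- reciprocal Gamma coefficients at `-m_j`.
  have h1 : ∏ j, (-t) j ^ m j = (∏ j, ((-1) ^ m j * ((m j).factorial : ℂ))) *
      ∏ j, t j ^ m j / ((m j).factorial : ℂ) := by
    rw [← Finset.prod_mul_distrib]
    refine Finset.prod_congr rfl fun j _ => ?_
    rw [Pi.neg_apply, neg_pow]
    field_simp [Nat.cast_ne_zero.2 (m j).factorial_ne_zero]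
  rw [h1, bernoulliCoeff]
  ring

/-- At points with all `t_j > 0` every tail sum is positive, so no denominator vanishes and both
expansions are valid there. -/
theorem IsMultiPolyBernoulli.unique {k : Fin r → ℤ} {B B' : (Fin r → ℕ) → ℂ}
    (h : IsMultiPolyBernoulli k σ a b B) (h' : IsMultiPolyBernoulli k σ a b B') : B = B' := by
  obtain ⟨ρ, hρ, hball⟩ := Metric.eventually_nhds_iff.1 (h.and h')
  have hc : (fun m => (B m - B' m) / ∏ j, ((m j).factorial : ℂ)) = 0 := by
    refine eq_zero_of_hasSum_prod_pow_zero hρ fun t ht => ?_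
    have hd : dist (fun j => (t j : ℂ)) 0 < ρ := by
      rw [dist_pi_lt_iff hρ]
      intro j
      rw [Pi.zero_apply, dist_zero_right, Complex.norm_real, Real.norm_of_nonneg (ht j).1.le]
      exact (ht j).2
    have hne : ∀ j, 1 - Complex.exp (-tailSum (fun j => (t j : ℂ)) (σ j)) ≠ 0 := fun j h0 => by
      have hT : 0 < tailSum t (σ j) :=
        Finset.sum_pos (fun i _ => (ht i).1) ⟨σ j, Finset.mem_Ici.2 le_rfl⟩
      rw [← ofReal_tailSum, sub_eq_zero, ← Complex.ofReal_neg, ← Complex.ofReal_exp] at h0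
      have h0' : (1 : ℝ) = Real.exp (-tailSum t (σ j)) := by exact_mod_cast h0
      exact absurd h0' (Real.exp_lt_one_iff.2 (neg_neg_of_pos hT)).ne'
    have h1 := ((hball hd).1 hne).sub ((hball hd).2 hne)
    rw [sub_self] at h1
    refine h1.congr_term fun m => Eq.symm ?_
    rw [Finset.prod_div_distrib]
    ring
  funext m
  have hm := congrFun hc m
  have hf : ∏ j, ((m j).factorial : ℂ) ≠ 0 :=
    Finset.prod_ne_zero_iff.2 fun j _ => Nat.cast_ne_zero.2 (m j).factorial_ne_zero
  simpa [sub_eq_zero, hf, Nat.factorial_ne_zero] using hm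

end

end

/-! ### The main theorem -/

theorem proposition4p1 {r : ℕ} [NeZero r] (k : Fin r → ℤ) (n : Fin r → ℕ)
    (σ : Equiv.Perm (Fin r)) (a b : Fin r → ℕ)
    (ha : 1 ≤ a 0) (ha' : 1 ≤ a (σ.symm 0)) (hb : 1 ≤ b 0) (hb' : 1 ≤ b (σ.symm 0))
    (hab : ∀ j, 1 ≤ a (σ j) + b j) :
    (∃ L, IsPolylogContinuation b L) ∧
    (∃! E, IsEtaContinuation σ a b E) ∧
    (∃! B, IsMultiPolyBernoulli k σ a b B) ∧
    eta σ a b (fun j => (k j : ℂ)) (fun j => -(n j : ℂ)) = multiPolyBernoulli k σ a b n := by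
  have hE := isEtaContinuation_etaContinuation ha hb hb' hab
  have hB := isMultiPolyBernoulli_bernoulliCoeff ha hb hb' hab k
  have hEeq : eta σ a b = etaContinuation σ a b :=
    IsEtaContinuation.unique (Classical.epsilon_spec ⟨_, hE⟩) hE
  have hBeq : multiPolyBernoulli k σ a b = bernoulliCoeff k σ a b :=
    IsMultiPolyBernoulli.unique (Classical.epsilon_spec ⟨_, hB⟩) hB
  refine ⟨⟨_, isPolylogContinuation_normPolylog hb⟩, ⟨_, hE, fun E h => h.unique hE⟩,
    ⟨_, hB, fun B h => h.unique hB⟩, ?_⟩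
  rw [hEeq, hBeq]
  -- `bernoulliCoeff` is by definition the value of the regularised Mellin transform at `-n`.
  exact regMellin_neg_natCast (etaRadius_pos r) _ _
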